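/- **Setting.** Let $\kappa>0$, $0<\beta_L\le\beta_R<\infty$, $N\in\mathbb N\cup\{0\}$, $x_0\in\mathbb Z$, and $\mathfrak h=\ell^2(\mathbb Z)$ with canonical basis $(\delta_x)$. Let $(uf)(x)=f(x-1)$, $h=\mathrm{Re}(u)$ and $h_{\rm B}=h+\kappa(\delta_0,\cdot)\delta_0$. Let $\mathfrak A$ be the selfdual CAR algebra generated by $B([f_1,f_2])=a^*(f_1)+a(\bar f_2)$, $f_1,f_2\in\mathfrak h$, on the fermionic Fock space over $\mathfrak h$, with the dynamics $\tau_{\rm B}^t(B(F))=B({\rm e}^{{\rm i}t(h_{\rm B}\oplus -h_{\rm B})}F)$. Let $\omega_0$ be the quasifree state with $\omega_0(B^*(F)B(G))=(F,(s_{0,-}\oplus s_{0,+})G)$, where $s_{0,\pm}=(1+{\rm e}^{\pm k_0})^{-1}$, $k_0=\beta_Lh_L\oplus 0\oplus\beta_Rh_R$ with respect to $\mathfrak h=\ell^2(\{x<-N\})\oplus\ell^2(\{|x|\le N\})\oplus\ell^2(\{x>N\})$, and $h_L,h_R$ are the compressions of $h$ to the first and the last summand. Let $\omega_{\rm B}$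 be the NESS, that is, a state which is a weak-$*$ limit point for $T\to\infty$ of $\frac1T\int_0^T\omega_0\circ\tau_{\rm B}^t\,{\rm d}t$. With $a_x=a(\delta_x)$, the NESS emptiness formation probability is ${\rm P}(n)=\omega_{\rm B}\big(\prod_{x=x_0}^{x_0+n-1}a_xa_x^*\big)$. **Symbols.** For $k\in(-\pi,\pi]$ and $\alpha=L,R$ put $\hat s_{-,\alpha}(k)=\frac12(1-\tanh[\frac12\beta_\alpha\cos k])$, $\varphi_{\rm B}(k)=\chi_{[0,\pi]}(k)\frac{\sin^2k}{\sin^2k+\kappa^2}$ and $$a=\varphi_{\rm B}\,\hat s_{-,L}+(1-\varphi_{\rm B})\,\hat s_{-,R},$$ and, for $y\in\mathbb Z$, $$b_y(k)={\rm i}\kappa\,\frac{{\rm e}^{-{\rm i}k(2y-1)}}{{\rm i}\kappa-\sin k}\,\big[(f_{\rm B},s_{0,-}f_{\rm B})-\hat s_{-,R}(k)\big],$$ where $f_{\rm B}(x)=n_{\rm B}^{-1}{\rm e}^{-\lambda_{\rm B}|x|}$ with $e_{\rm B}=\sqrt{1+\kappa^2}$, $\lambda_{\rm B}=\log(\kappa+e_{\rm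 B})$, $n_{\rm B}=\sqrt{e_{\rm B}/\kappa}$ is the normalized eigenfunction of $h_{\rm B}$ with eigenvalue $e_{\rm B}$. For a function $f$ write $f_m=\int_{-\pi}^{\pi}\frac{{\rm d}k}{2\pi}{\rm e}^{-{\rm i}mk}f(k)$, $T_n[f]=(f_{i-j})_{i,j=1}^n$ and $H_n[f]=(f_{i+j-1})_{i,j=1}^n$. **Proposition (Determinantal structure).** We have $a\in L^\infty(\mathbb T)$, and $b_y\in C^\infty(\mathbb T)$ for all $y\in\mathbb Z$. (1) If $x_0\ge 0$, then ${\rm P}(n)=\det(T_n[a]+H_n[b_{x_0}])$ for all $n$. (2) If $x_0<0$, put $n_0=-x_0$. There is a bounded operator $M$ of finite rank on $\mathbb C^{n_0}\oplus\ell^2(\mathbb N)\simeq\ell^2(\mathbb N)$, with matrix entries $M_{ij}=0$ if $i,j>n_0$ and $M_{ij}=(-1)^{i+j}\,\omega_{\rm B}(a_{x_0+j-1}a^*_{x_0+i-1})$ otherwise, such that, for all $n\ge n_0$, $${\rm P}(n)=\det\big(0\oplus(T_{n-n_0}[a]+H_{n-n_0}[b_0])+M_n\big),$$ where $M_n=(M_{ij})_{i,j=1}^n$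 and $0\oplus\cdot$ refers to $\mathbb C^n=\mathbb C^{n_0}\oplus\mathbb C^{n-n_0}$. -/

import Mathlib

open scoped ComplexOrder

noncomputable section

namespace XYImpurity

/-! ### Square-summable functions and weighted substitution operators -/

/-- `ℓ²(ι)`. -/
abbrev Ell2 (ι : Type) : Type := lp (fun _ : ι => ℂ) 2

theorem sum_wcomp_le {ι : Type} (σ : ι → ι) (w : ι → ℂ) (hw : ∀ i, ‖w i‖ ≤ 1)
    (hσ : Set.InjOn σ {i | w i ≠ 0}) (ψ : Ell2 ι) (s : Finset ι) :
    ∑ i ∈ s, ‖w i * ψ (σ i)‖ ^ (2 : ENNReal).toReal ≤ ‖ψ‖ ^ (2 : ENNReal).toReal := by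
  classical
  have h2 : (0 : ℝ) < (2 : ENNReal).toReal := by simp
  calc ∑ i ∈ s, ‖w i * ψ (σ i)‖ ^ (2 : ENNReal).toReal
      = ∑ i ∈ s with w i ≠ 0, ‖w i * ψ (σ i)‖ ^ (2 : ENNReal).toReal := by
        rw [Finset.sum_filter]
        refine Finset.sum_congr rfl fun i _ => ?_
        by_cases h : w i = 0 <;> simp [h]
    _ ≤ ∑ i ∈ s with w i ≠ 0, ‖ψ (σ i)‖ ^ (2 : ENNReal).toReal := by
        refine Finset.sum_le_sum fun i _ => ?_
        refine Real.rpow_le_rpow (norm_nonneg _) ?_ h2.le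
        rw [norm_mul]
        exact mul_le_of_le_one_left (norm_nonneg _) (hw i)
    _ = ∑ j ∈ (s.filter fun i => w i ≠ 0).image σ, ‖ψ j‖ ^ (2 : ENNReal).toReal := by
        rw [Finset.sum_image]
        intro i hi j hj hij
        exact hσ (by simpa using (Finset.mem_filter.1 hi).2)
          (by simpa using (Finset.mem_filter.1 hj).2) hij
    _ ≤ _ := lp.sum_rpow_le_norm_rpow h2 ψ _

/-- The bounded operator `(T ψ)(i) = w(i) ψ(σ(i))` on `ℓ²(ι)`, where `|w| ≤ 1` and `σ` is injective
on the support of `w`. -/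
def wcomp {ι : Type} (σ : ι → ι) (w : ι → ℂ) (hw : ∀ i, ‖w i‖ ≤ 1)
    (hσ : Set.InjOn σ {i | w i ≠ 0}) : Ell2 ι →L[ℂ] Ell2 ι :=
  LinearMap.mkContinuous
    { toFun := fun ψ => ⟨fun i => w i * ψ (σ i), memℓp_gen' (sum_wcomp_le σ w hw hσ ψ)⟩
      map_add' := fun ψ φ => by
        ext i
        exact mul_add _ _ _
      map_smul' := fun c ψ => by
        ext i
        exact mul_left_comm _ _ _ }
    1 fun ψ => by
      rw [one_mul]
      exact lp.norm_le_of_forall_sum_le (by simp) (norm_nonneg _) (sum_wcomp_le σ w hw hσ ψ)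

@[simp] theorem wcomp_apply {ι : Type} (σ : ι → ι) (w : ι → ℂ) (hw : ∀ i, ‖w i‖ ≤ 1)
    (hσ : Set.InjOn σ {i | w i ≠ 0}) (ψ : Ell2 ι) (i : ι) :
    wcomp σ w hw hσ ψ i = w i * ψ (σ i) := rfl

/-! ### The one-particle space -/

/-- The one-particle Hilbert space `ℓ²(ℤ)`. -/
abbrev OneParticle : Type := Ell2 ℤ

/-- The doubled one-particle Hilbert space `ℓ²(ℤ) ⊕ ℓ²(ℤ)`. -/
abbrev Doubled : Type := WithLp 2 (OneParticle × OneParticle)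

/-- The Kronecker function at the site `x`. -/
def delta (x : ℤ) : OneParticle := lp.single 2 x (1 : ℂ)

/-- The translation `(u f)(x) = f(x - 1)`. -/
def shift : OneParticle →L[ℂ] OneParticle :=
  wcomp (fun x => x - 1) (fun _ => 1) (by simp) (by intro a _ b _ h; simpa using h)

/-- Multiplication by the indicator function of `s`, that is, the orthogonal projection of `ℓ²(ℤ)`
onto the subspace `ℓ²(s)`. -/
def siteProj (s : Set ℤ) : OneParticle →L[ℂ] OneParticle :=
  open Classical in
  wcomp id (fun x => if x ∈ s then 1 else 0) (by intro x; split_ifs <;> simp)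
    Function.injective_id.injOn

/-- The XY Hamiltonian `h = Re(u) = (u + u*) / 2`. -/
def hXY : OneParticle →L[ℂ] OneParticle :=
  (1 / 2 : ℂ) • (shift + ContinuousLinearMap.adjoint shift)

/-- The magnetic Hamiltonian `h_B = h + κ (δ_0, ·) δ_0`. -/
def hMag (κ : ℝ) : OneParticle →L[ℂ] OneParticle :=
  hXY + (κ : ℂ) • InnerProductSpace.rankOne ℂ (delta 0) (delta 0)

/-- The left reservoir `{x ≤ -(N + 1)}`. -/
def leftSites (N : ℕ) : Set ℤ := {x | x ≤ -((N : ℤ) + 1)}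

/-- The right reservoir `{x ≥ N + 1}`. -/
def rightSites (N : ℕ) : Set ℤ := {x | (N : ℤ) + 1 ≤ x}

/-- `k_0 = β_L h_L ⊕ 0 ⊕ β_R h_R`, where `h_L`, `h_R` are the compressions of `h` to the
reservoirs. -/
def kInit (βL βR : ℝ) (N : ℕ) : OneParticle →L[ℂ] OneParticle :=
  (βL : ℂ) • (siteProj (leftSites N) ∘L hXY ∘L siteProj (leftSites N)) +
    (βR : ℂ) • (siteProj (rightSites N) ∘L hXY ∘L siteProj (rightSites N))

/-- `s_{0,-} = (1 + exp(-k_0))⁻¹`. -/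
def sInitMinus (βL βR : ℝ) (N : ℕ) : OneParticle →L[ℂ] OneParticle :=
  Ring.inverse (1 + NormedSpace.exp (-kInit βL βR N))

/-- `s_{0,+} = (1 + exp(k_0))⁻¹`. -/
def sInitPlus (βL βR : ℝ) (N : ℕ) : OneParticle →L[ℂ] OneParticle :=
  Ring.inverse (1 + NormedSpace.exp (kInit βL βR N))

/-- The direct sum `A ⊕ D` of two operators, acting on the doubled space. -/
def opSum (A D : OneParticle →L[ℂ] OneParticle) : Doubled →L[ℂ] Doubled :=
  (WithLp.prodContinuousLinearEquiv 2 ℂ OneParticle OneParticle).symm.toContinuousLinearMap ∘L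
    (A.prodMap D) ∘L
    (WithLp.prodContinuousLinearEquiv 2 ℂ OneParticle OneParticle).toContinuousLinearMap

/-- The density `S_0 = s_{0,-} ⊕ s_{0,+}` of the initial state. -/
def initialDensity (βL βR : ℝ) (N : ℕ) : Doubled →L[ℂ] Doubled :=
  opSum (sInitMinus βL βR N) (sInitPlus βL βR N)

/-- `H_B = h_B ⊕ (-h_B)`. -/
def HMag (κ : ℝ) : Doubled →L[ℂ] Doubled := opSum (hMag κ) (-hMag κ)

/-! ### Fermionic Fock space and the selfdual CAR algebra -/

/-- The fermionic Fock space over `ℓ²(ℤ)` in the occupation number representation: the finite set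
`{x₁ < ⋯ < x_k}` labels the basis vector `δ_{x₁} ∧ ⋯ ∧ δ_{x_k}`. -/
abbrev Fock : Type := Ell2 (Finset ℤ)

/-- The annihilation operator `a_x = a(δ_x)`, the adjoint of `ψ ↦ δ_x ∧ ψ`. -/
def annSite (x : ℤ) : Fock →L[ℂ] Fock :=
  wcomp (fun S => insert x S)
    (fun S => if x ∈ S then 0 else (-1) ^ (S.filter (· < x)).card)
    (by intro S; split_ifs <;> simp)
    (by
      intro S hS T hT h
      have hS' : x ∉ S := by intro hx; simp [hx] at hS
      have hT' : x ∉ T := by intro hx; simp [hx] at hT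
      have := congrArg (fun U => Finset.erase U x) h
      simpa [Finset.erase_insert hS', Finset.erase_insert hT'] using this)

/-- The creation operator `a_x^* = a^*(δ_x)`. -/
def creSite (x : ℤ) : Fock →L[ℂ] Fock := ContinuousLinearMap.adjoint (annSite x)

/-! The canonical anticommutation relations, and the norm convergence of the series which define
`a(f)` and `a^*(f)`. -/

theorem card_lt_insert (x y : ℤ) (S : Finset ℤ) (hx : x ∉ S) :
    ((insert x S).filter (· < y)).card = (S.filter (· < y)).card + if x < y then 1 else 0 := by
  rw [Finset.filter_insert]
  split_ifs with h
  · rw [Finset.card_insert_of_notMem (by simp [hx])]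
  · simp

theorem annSite_apply (x : ℤ) (ψ : Fock) (S : Finset ℤ) :
    annSite x ψ S =
      (if x ∈ S then 0 else (-1) ^ (S.filter (· < x)).card) * ψ (insert x S) := rfl

theorem creSite_apply (x : ℤ) (ψ : Fock) (S : Finset ℤ) :
    creSite x ψ S = if x ∈ S then (-1) ^ (S.filter (· < x)).card * ψ (S.erase x) else 0 := by
  have h := ContinuousLinearMap.adjoint_inner_right (annSite x) (lp.single 2 S (1 : ℂ)) ψ
  have h1 : annSite x (lp.single 2 S (1 : ℂ)) =
      if x ∈ S then lp.single 2 (S.erase x) ((-1 : ℂ) ^ (S.filter (· < x)).card) else 0 := by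
    ext T
    rw [annSite_apply]
    by_cases hxT : x ∈ T
    · have : T ≠ S.erase x := by rintro rfl; simp at hxT
      split_ifs <;> simp [lp.single_apply, this, hxT, Pi.single_apply]
    · by_cases hS : insert x T = S
      · subst hS
        simp [hxT, Finset.filter_insert]
      · have : x ∈ S → T ≠ S.erase x := by
          rintro hx rfl; exact hS (Finset.insert_erase hx)
        split_ifs with hxS <;> simp_all [lp.single_apply]
  rw [h1, lp.inner_single_left] at h
  rw [creSite]
  split_ifs with hx
  · rw [if_pos hx, lp.inner_single_left] at h
    simpa [mul_comm] using h
  · rw [if_neg hx] at h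
    simpa using h

theorem car_site (x y : ℤ) :
    annSite x * creSite y + creSite y * annSite x = if x = y then 1 else 0 := by
  ext ψ S
  have hl : ((annSite x * creSite y + creSite y * annSite x) ψ) S =
      annSite x (creSite y ψ) S + creSite y (annSite x ψ) S := rfl
  rw [hl, creSite_apply, annSite_apply, annSite_apply, creSite_apply]
  by_cases hxy : x = y
  · subst hxy
    by_cases hx : x ∈ S
    · have := card_lt_insert x x (S.erase x) (by simp)
      rw [Finset.insert_erase hx] at this
      simp [hx, this, ← mul_assoc, ← mul_pow]
    · have := card_lt_insert x x S hx
      simp [hx, this, ← mul_assoc, ← mul_pow]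
  · have h0 : ((if x = y then (1 : Fock →L[ℂ] Fock) else 0) ψ) S = 0 := by simp [hxy]
    rw [h0]
    by_cases hx : x ∈ S
    · simp [hx, hxy]
    by_cases hy : y ∈ S
    · have h1 := card_lt_insert x y S hx
      have h2 := card_lt_insert y x (S.erase y) (by simp)
      rw [Finset.insert_erase hy] at h2
      have h3 : (insert x S).erase y = insert x (S.erase y) :=
        Finset.erase_insert_of_ne hxy
      rcases lt_or_gt_of_ne hxy with h | h
      · simp [hx, hy, h1, h2, h3, h, h.not_gt]
        ring
      · simp [hx, hy, h1, h2, h3, h, h.not_gt]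
        ring
    · simp [hx, hy, Ne.symm hxy]

theorem norm_sum_annSite_le (c : ℤ → ℂ) (s : Finset ℤ) :
    ‖∑ x ∈ s, c x • annSite x‖ ^ 2 ≤ ∑ x ∈ s, ‖c x‖ ^ 2 := by
  set A := ∑ x ∈ s, c x • annSite x with hA
  have hstar : star A = ∑ x ∈ s, star (c x) • creSite x := by
    rw [hA, star_sum]
    refine Finset.sum_congr rfl fun x _ => ?_
    rw [star_smul]; rfl
  have hcar : A * star A + star A * A = ((∑ x ∈ s, ‖c x‖ ^ 2 : ℝ) : ℂ) • 1 := by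
    rw [hstar, hA, Finset.sum_mul_sum, Finset.sum_mul_sum, Finset.sum_comm (s := s) (t := s),
      ← Finset.sum_add_distrib, Complex.ofReal_sum, Finset.sum_smul]
    refine Finset.sum_congr rfl fun y hy => ?_
    rw [← Finset.sum_add_distrib, Finset.sum_eq_single y]
    · rw [smul_mul_smul_comm, smul_mul_smul_comm, mul_comm (star (c y)), ← smul_add, car_site,
        if_pos rfl]
      congr 1
      simpa using Complex.mul_conj' (c y)
    · intro x _ hxy
      rw [smul_mul_smul_comm, smul_mul_smul_comm, mul_comm (star (c y)), ← smul_add, car_site,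
        if_neg hxy, smul_zero]
    · simp [hy]
  have hb : ‖A‖ ≤ Real.sqrt (∑ x ∈ s, ‖c x‖ ^ 2) := by
    refine A.opNorm_le_bound (Real.sqrt_nonneg _) fun ψ => ?_
    have h1 := congrArg (fun T : Fock →L[ℂ] Fock => inner ℂ ψ (T ψ)) hcar
    have h2 : inner ℂ ψ ((A * star A + star A * A) ψ) =
        ((‖star A ψ‖ ^ 2 + ‖A ψ‖ ^ 2 : ℝ) : ℂ) := by
      change inner ℂ ψ (A (star A ψ) + star A (A ψ)) = _
      have e1 : inner ℂ ψ (A (star A ψ)) = inner ℂ (star A ψ) (star A ψ) :=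
        (ContinuousLinearMap.adjoint_inner_left A (star A ψ) ψ).symm
      have e2 : inner ℂ ψ (star A (A ψ)) = inner ℂ (A ψ) (A ψ) :=
        ContinuousLinearMap.adjoint_inner_right A ψ (A ψ)
      rw [inner_add_right, e1, e2, inner_self_eq_norm_sq_to_K,
        inner_self_eq_norm_sq_to_K]
      push_cast
      rfl
    have h3 : inner ℂ ψ ((((∑ x ∈ s, ‖c x‖ ^ 2 : ℝ) : ℂ) • (1 : Fock →L[ℂ] Fock)) ψ) =
        (((∑ x ∈ s, ‖c x‖ ^ 2) * ‖ψ‖ ^ 2 : ℝ) : ℂ) := by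
      rw [smul_apply, inner_smul_right, one_apply_eq_self, inner_self_eq_norm_sq_to_K]
      push_cast
      rfl
    have h4 : ‖star A ψ‖ ^ 2 + ‖A ψ‖ ^ 2 = (∑ x ∈ s, ‖c x‖ ^ 2) * ‖ψ‖ ^ 2 := by
      have := h2.symm.trans (h1.trans h3)
      exact_mod_cast this
    refine le_of_sq_le_sq ?_ (by positivity)
    rw [mul_pow, Real.sq_sqrt (by positivity), ← h4]
    nlinarith [sq_nonneg ‖star A ψ‖]
  calc ‖A‖ ^ 2 ≤ Real.sqrt (∑ x ∈ s, ‖c x‖ ^ 2) ^ 2 := by gcongr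
    _ = _ := Real.sq_sqrt (by positivity)

theorem summable_annSite (c : ℤ → ℂ) (hc : Summable fun x => ‖c x‖ ^ 2) :
    Summable fun x => c x • annSite x := by
  rw [summable_iff_vanishing_norm]
  intro ε hε
  obtain ⟨s, hs⟩ := summable_iff_vanishing_norm.1 hc (ε ^ 2) (by positivity)
  refine ⟨s, fun t ht => ?_⟩
  have h1 := norm_sum_annSite_le c t
  have h2 := hs t ht
  rw [Real.norm_of_nonneg (by positivity)] at h2
  exact lt_of_pow_lt_pow_left₀ 2 hε.le (h1.trans_lt h2)

theorem OneParticle.summable_sq (f : OneParticle) : Summable fun x => ‖f x‖ ^ 2 := by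
  simpa using (lp.memℓp f).summable (by simp)

theorem summable_ann (f : OneParticle) : Summable fun x => star (f x) • annSite x :=
  summable_annSite _ (by simpa using OneParticle.summable_sq f)

theorem summable_cre (f : OneParticle) : Summable fun x => f x • creSite x := by
  refine ((summable_ann f).map (starAddEquiv : (Fock →L[ℂ] Fock) ≃+ _)
    continuous_star).congr fun x => ?_
  simp only [Function.comp_apply, starAddEquiv_apply, star_smul, star_star]
  rfl

/-- `a^*(f)`, complex linear in `f`. -/
def cre (f : OneParticle) : Fock →L[ℂ] Fock := ∑' x : ℤ, f x • creSite x

/-- `a(f)`, complex antilinear in `f`. -/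
def ann (f : OneParticle) : Fock →L[ℂ] Fock := ∑' x : ℤ, star (f x) • annSite x

/-- `B([f₁, f₂]) = a^*(f₁) + a(conj f₂)`. -/
def bOp (F : Doubled) : Fock →L[ℂ] Fock := cre F.fst + ann (star F.snd)

/-- The selfdual CAR algebra: the `C^*`-algebra generated by all `B(F)`. -/
def CAR : StarSubalgebra ℂ (Fock →L[ℂ] Fock) :=
  (StarAlgebra.adjoin ℂ (Set.range bOp)).topologicalClosure

/-- `B(F)` as an element of the selfdual CAR algebra. -/
def gen (F : Doubled) : CAR :=
  ⟨bOp F, StarSubalgebra.le_topologicalClosure _ (StarAlgebra.subset_adjoin ℂ _ ⟨F, rfl⟩)⟩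

/-! ### States -/

/-- States: normalized positive linear functionals. -/
def IsState (ω : CAR →ₗ[ℂ] ℂ) : Prop := ω 1 = 1 ∧ ∀ A : CAR, 0 ≤ ω (star A * A)

/-- The Pfaffian, a sum over the permutations `π` with `π(2j-1) < π(2j+1)` and `π(2j-1) < π(2j)`
(in one-based numbering). -/
def pfaffian (n : ℕ) (A : Matrix (Fin (2 * n)) (Fin (2 * n)) ℂ) : ℂ :=
  open Classical in
  ∑ π : Equiv.Perm (Fin (2 * n)) with
      (∀ i j : Fin n, i < j → π ⟨2 * i, by omega⟩ < π ⟨2 * j, by omega⟩) ∧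
      ∀ j : Fin n, π ⟨2 * j, by omega⟩ < π ⟨2 * j + 1, by omega⟩,
    ((Equiv.Perm.sign π : ℤ) : ℂ) *
      ∏ j : Fin n, A (π ⟨2 * j, by omega⟩) (π ⟨2 * j + 1, by omega⟩)

/-- The skew-symmetric matrix of two-point functions of `F_1, …, F_m`. -/
def corrMatrix (ω : CAR →ₗ[ℂ] ℂ) {m : ℕ} (F : Fin m → Doubled) : Matrix (Fin m) (Fin m) ℂ :=
  fun i j =>
    if i < j then ω (gen (F i) * gen (F j))
    else if j < i then -ω (gen (F j) * gen (F i))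
    else 0

/-- `ω` is a quasifree state: a state which vanishes on odd monomials in the generators and is a
Pfaffian on even ones. -/
def IsQuasifree (ω : CAR →ₗ[ℂ] ℂ) : Prop :=
  IsState ω ∧
  (∀ (n : ℕ) (F : Fin (2 * n + 1) → Doubled), ω (List.ofFn fun i => gen (F i)).prod = 0) ∧
  ∀ (n : ℕ) (F : Fin (2 * n) → Doubled),
    ω (List.ofFn fun i => gen (F i)).prod = pfaffian n (corrMatrix ω F)

/-- `S` is the density of `ω`: `ω(B(F)^* B(G)) = (F, S G)`. -/
def HasDensity (ω : CAR →ₗ[ℂ] ℂ) (S : Doubled →L[ℂ] Doubled) : Prop :=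
  ∀ F G : Doubled, ω (star (gen F) * gen G) = inner ℂ F (S G)

/-- `τ` is the family of Bogoliubov automorphisms with `τ^t(B(F)) = B(exp(itH) F)`. -/
def IsBogoliubov (τ : ℝ → (CAR ≃⋆ₐ[ℂ] CAR)) (H : Doubled →L[ℂ] Doubled) : Prop :=
  ∀ (t : ℝ) (F : Doubled), τ t (gen F) = gen (NormedSpace.exp ((Complex.I * (t : ℂ)) • H) F)

/-- `ω` is a nonequilibrium steady state for the dynamics `τ` and the initial state `ω₀`: a state
which is a weak-`*` limit point, as `T → ∞`, of the time averages `T⁻¹ ∫₀ᵀ ω₀ ∘ τ^t dt`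
(the weak-`*` topology being that of pointwise convergence on the algebra). -/
def IsNESS (τ : ℝ → (CAR ≃⋆ₐ[ℂ] CAR)) (ω₀ ω : CAR →ₗ[ℂ] ℂ) : Prop :=
  IsState ω ∧
  MapClusterPt (fun A : CAR => ω A) Filter.atTop
    (fun (T : ℝ) (A : CAR) => ((1 / T : ℝ) : ℂ) * ∫ t in (0 : ℝ)..T, ω₀ (τ t A))

/-! ### The emptiness formation observable -/

/-- The form factors `F_{2i-1} = (u^i ⊕ u^i) [0, δ_{x₀-1}]`. -/
def formOdd (x₀ : ℤ) (i : ℕ) : Doubled :=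
  opSum (shift ^ i) (shift ^ i) (WithLp.toLp 2 (0, delta (x₀ - 1)))

/-- The form factors `F_{2i} = (u^i ⊕ u^i) [δ_{x₀-1}, 0]`. -/
def formEven (x₀ : ℤ) (i : ℕ) : Doubled :=
  opSum (shift ^ i) (shift ^ i) (WithLp.toLp 2 (delta (x₀ - 1), 0))

/-- The observable `A_n = B(F_1) B(F_2) ⋯ B(F_{2n})`. -/
def efpObservable (x₀ : ℤ) (n : ℕ) : CAR :=
  (List.ofFn fun i : Fin n => gen (formOdd x₀ (i + 1)) * gen (formEven x₀ (i + 1))).prod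

/-- The two-point function `ω(a_x a_y^*)`. -/
def twoPoint (ω : CAR →ₗ[ℂ] ℂ) (x y : ℤ) : ℂ :=
  ω (gen (WithLp.toLp 2 (0, delta x)) * gen (WithLp.toLp 2 (delta y, 0)))

/-! ### The bound state -/

/-- The eigenvalue `e_B = (1 + κ²)^{1/2}` of `h_B`. -/
def eB (κ : ℝ) : ℝ := Real.sqrt (1 + κ ^ 2)

/-- The decay rate `λ_B = log(κ + e_B)`. -/
def lamB (κ : ℝ) : ℝ := Real.log (κ + eB κ)

/-- The normalization constant `n_B = (e_B / κ)^{1/2}`. -/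
def nB (κ : ℝ) : ℝ := Real.sqrt (eB κ / κ)

theorem memlp_bound (κ : ℝ) (hκ : 0 < κ) :
    Memℓp (fun x : ℤ => (((nB κ)⁻¹ * Real.exp (-lamB κ * |(x : ℝ)|) : ℝ) : ℂ)) 2 := by
  have hl0 : 0 < lamB κ := by
    refine Real.log_pos ?_
    have : (1 : ℝ) ≤ eB κ := by
      rw [eB, Real.one_le_sqrt]; nlinarith [sq_nonneg κ]
    linarith
  have hgeo : Summable fun n : ℕ => (nB κ)⁻¹ ^ 2 * Real.exp (-(2 * lamB κ)) ^ n :=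
    (summable_geometric_of_lt_one (Real.exp_pos _).le
      (Real.exp_lt_one_iff.2 (by linarith))).mul_left _
  have key : ∀ n : ℕ, ((nB κ)⁻¹ * Real.exp (-lamB κ * n)) ^ 2 =
      (nB κ)⁻¹ ^ 2 * Real.exp (-(2 * lamB κ)) ^ n := by
    intro n
    rw [mul_pow, ← Real.exp_nat_mul, ← Real.exp_nat_mul]
    congr 2
    push_cast
    ring
  have hs : Summable fun x : ℤ => ((nB κ)⁻¹ * Real.exp (-lamB κ * |(x : ℝ)|)) ^ 2 := by
    refine Summable.of_nat_of_neg ?_ ?_ <;>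
    · refine hgeo.congr fun n => ?_
      rw [← key]
      simp
  apply memℓp_gen
  refine hs.congr fun x => ?_
  rw [Complex.norm_real]
  simp only [ENNReal.toReal_ofNat, Real.rpow_ofNat, Real.norm_eq_abs, sq_abs]

/-- The normalized eigenfunction `f_B(x) = n_B⁻¹ exp(-λ_B |x|)` of `h_B` with eigenvalue `e_B`. -/
def boundState (κ : ℝ) (hκ : 0 < κ) : OneParticle := ⟨_, memlp_bound κ hκ⟩

/-! ### Symbols, Toeplitz and Hankel matrices -/

/-- `ŝ_{-,α}(k) = (1 - tanh(β_α cos(k) / 2)) / 2`. -/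
def sHatMinus (β k : ℝ) : ℝ := (1 - Real.tanh (β * Real.cos k / 2)) / 2

/-- `φ_B(k) = χ_{[0,π]}(k) sin²(k) / (sin²(k) + κ²)`. -/
def phiB (κ k : ℝ) : ℝ :=
  (Set.Icc 0 Real.pi).indicator (fun k => Real.sin k ^ 2 / (Real.sin k ^ 2 + κ ^ 2)) k

/-- The Toeplitz symbol `a = φ_B ŝ_{-,L} + (1 - φ_B) ŝ_{-,R}`. -/
def symbolA (κ βL βR k : ℝ) : ℂ :=
  ((phiB κ k * sHatMinus βL k + (1 - phiB κ k) * sHatMinus βR k : ℝ) : ℂ)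

/-- The Hankel symbol
`b_y(k) = iκ e^{-ik(2y-1)} / (iκ - sin k) * ((f_B, s_{0,-} f_B) - ŝ_{-,R}(k))`. -/
def symbolB (κ : ℝ) (hκ : 0 < κ) (βL βR : ℝ) (N : ℕ) (y : ℤ) (k : ℝ) : ℂ :=
  Complex.I * κ * Complex.exp (-Complex.I * k * (2 * y - 1)) / (Complex.I * κ - Real.sin k) *
    (inner ℂ (boundState κ hκ) (sInitMinus βL βR N (boundState κ hκ)) - sHatMinus βR k)

/-- The Fourier coefficient `∫_{-π}^{π} e^{-imk} f(k) dk / (2π)`. -/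
def coeff (f : ℝ → ℂ) (m : ℤ) : ℂ :=
  (1 / (2 * Real.pi) : ℂ) * ∫ k in (-Real.pi)..Real.pi, Complex.exp (-Complex.I * m * k) * f k

/-- The finite section `T_n[a]`, with entries the Fourier coefficients of `a` at `i - j`. -/
def toeplitz (f : ℝ → ℂ) (n : ℕ) : Matrix (Fin n) (Fin n) ℂ :=
  fun i j => coeff f ((i : ℤ) - (j : ℤ))

/-- The finite section `H_n[b]`, with entries the Fourier coefficients of `b` at `i + j - 1` for
`i, j = 1, …, n`, that is, at `i + j + 1` for indices starting at `0`. -/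
def hankel (f : ℝ → ℂ) (n : ℕ) : Matrix (Fin n) (Fin n) ℂ :=
  fun i j => coeff f ((i : ℤ) + (j : ℤ) + 1)

/-- The section of an operator on `ℓ²(ℕ)` by its first `n₀ + m` coordinates, written as a matrix
with respect to `ℂ^{n₀} ⊕ ℂ^m`. -/
def compress (M : Ell2 ℕ →L[ℂ] Ell2 ℕ) (n₀ m : ℕ) :
    Matrix (Fin n₀ ⊕ Fin m) (Fin n₀ ⊕ Fin m) ℂ :=
  fun i j => M (lp.single 2 (finSumFinEquiv j : ℕ) (1 : ℂ)) (finSumFinEquiv i : ℕ)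

end XYImpurity

end

open XYImpurity

noncomputable section

namespace XYImpurity

section Pfaffian

/-- The flip of the second coordinate. -/
def pairFlip (n : ℕ) : Equiv.Perm (Fin n × Bool) := Equiv.prodCongrRight fun _ => Equiv.boolNot

@[simp] theorem pairFlip_apply {n : ℕ} (p : Fin n × Bool) : pairFlip n p = (p.1, !p.2) := rfl

/-- The enumeration of `Fin (2 * n)` by pairs. -/
def pairEquiv (n : ℕ) : Fin n × Bool ≃ Fin (2 * n) where
  toFun p := ⟨2 * p.1 + p.2.toNat, by have := p.1.2; have := p.2.toNat_lt; omega⟩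
  invFun k := (⟨k / 2, by omega⟩, decide ((k : ℕ) % 2 = 1))
  left_inv := by
    rintro ⟨i, b⟩
    cases b <;> simp [Prod.ext_iff, Fin.ext_iff]
    omega
  right_inv := by
    intro k
    rw [Fin.ext_iff]
    rcases Nat.mod_two_eq_zero_or_one k with h | h <;> simp [h] <;> omega

/-- A summand of the Pfaffian. -/
def pfTerm {n : ℕ} (B : Fin n × Bool → Fin n × Bool → ℂ) (π : Equiv.Perm (Fin n × Bool)) : ℂ :=
  ((Equiv.Perm.sign π : ℤ) : ℂ) * ∏ j : Fin n, B (π (j, false)) (π (j, true))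

/-- The ordering constraints on the permutations in the Pfaffian. -/
def PfOrdered {n : ℕ} (π : Equiv.Perm (Fin n × Bool)) : Prop :=
  (∀ i j : Fin n, i < j → pairEquiv n (π (i, false)) < pairEquiv n (π (j, false))) ∧
    ∀ j : Fin n, pairEquiv n (π (j, false)) < pairEquiv n (π (j, true))

theorem pfTerm_mul_prodCongrLeft {n : ℕ} (B : Fin n × Bool → Fin n × Bool → ℂ)
    (π : Equiv.Perm (Fin n × Bool)) (ρ : Equiv.Perm (Fin n)) :
    pfTerm B (π * Equiv.prodCongrLeft fun _ => ρ) = pfTerm B π := by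
  have hs : Equiv.Perm.sign (Equiv.prodCongrLeft fun _ : Bool => ρ) = 1 := by
    rw [Equiv.Perm.sign_prodCongrLeft]
    simp
  simp only [pfTerm, map_mul, hs, mul_one, Equiv.Perm.mul_apply, Equiv.prodCongrLeft_apply]
  congr 1
  exact Equiv.prod_comp ρ fun j => B (π (j, false)) (π (j, true))

theorem pfTerm_mul_prodCongrRight {n : ℕ} (B : Fin n × Bool → Fin n × Bool → ℂ)
    (hB : ∀ p q, B p q = -B q p)
    (π : Equiv.Perm (Fin n × Bool)) (ε : Fin n → Bool) :
    pfTerm B (π * Equiv.prodCongrRight fun j => if ε j then Equiv.boolNot else 1) = pfTerm B π := by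
  have hb : Equiv.Perm.sign Equiv.boolNot = -1 := by decide
  simp only [pfTerm, map_mul, Equiv.Perm.sign_prodCongrRight, Equiv.Perm.mul_apply,
    Equiv.prodCongrRight_apply, Units.val_mul, Int.cast_mul, Units.coe_prod, Int.cast_prod]
  rw [mul_assoc, ← Finset.prod_mul_distrib]
  congr 1
  refine Finset.prod_congr rfl fun j _ => ?_
  cases ε j
  · simp
  · simp [hb, hB (π (j, true))]

theorem exists_pfOrdered {n : ℕ} (B : Fin n × Bool → Fin n × Bool → ℂ)
    (hB : ∀ p q, B p q = -B q p) (π : Equiv.Perm (Fin n × Bool)) :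
    ∃ π' : Equiv.Perm (Fin n × Bool), PfOrdered π' ∧ pfTerm B π' = pfTerm B π ∧
      π' * pairFlip n * π'⁻¹ = π * pairFlip n * π⁻¹ := by
  set ε : Fin n → Bool :=
    fun j => decide (pairEquiv n (π (j, true)) < pairEquiv n (π (j, false))) with hε
  set β : Equiv.Perm (Fin n × Bool) :=
    Equiv.prodCongrRight fun j => if ε j then Equiv.boolNot else 1 with hβ
  set f : Fin n → Fin (2 * n) := fun j => pairEquiv n ((π * β) (j, false)) with hf
  set ρ := Tuple.sort f with hρ
  set γ : Equiv.Perm (Fin n × Bool) := Equiv.prodCongrLeft fun _ => ρ with hγ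
  have hfinj : Function.Injective f := by
    intro i j hij
    simpa using (π * β).injective ((pairEquiv n).injective hij)
  have hmono : StrictMono (f ∘ ρ) :=
    (Tuple.monotone_sort f).strictMono_of_injective (hfinj.comp ρ.injective)
  have hlt : ∀ j, pairEquiv n ((π * β) (j, false)) < pairEquiv n ((π * β) (j, true)) := by
    intro j
    by_cases h : pairEquiv n (π (j, true)) < pairEquiv n (π (j, false))
    · simp [hβ, hε, h]
    · have hne : pairEquiv n (π (j, true)) ≠ pairEquiv n (π (j, false)) := by simp
      have : pairEquiv n (π (j, false)) < pairEquiv n (π (j, true)) :=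
        lt_of_le_of_ne (not_lt.1 h) hne.symm
      simp [hβ, hε, h, this]
  refine ⟨π * β * γ, ⟨fun i j hij => hmono hij, fun j => hlt (ρ j)⟩, ?_, ?_⟩
  · rw [pfTerm_mul_prodCongrLeft, pfTerm_mul_prodCongrRight B hB]
  · have h1 : γ * pairFlip n = pairFlip n * γ := by
      ext p <;> simp [hγ]
    have h2 : β * pairFlip n = pairFlip n * β := by
      ext1 p
      by_cases h : ε p.1 = true <;> simp [hβ, h]
    calc π * β * γ * pairFlip n * (π * β * γ)⁻¹
        = π * β * (γ * pairFlip n) * γ⁻¹ * β⁻¹ * π⁻¹ := by group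
      _ = π * (β * pairFlip n) * β⁻¹ * π⁻¹ := by rw [h1]; group
      _ = _ := by rw [h2]; group

theorem PfOrdered.eq {n : ℕ} {π π' : Equiv.Perm (Fin n × Bool)} (h : PfOrdered π)
    (h' : PfOrdered π') (hc : π * pairFlip n * π⁻¹ = π' * pairFlip n * π'⁻¹) : π = π' := by
  have key : ∀ π : Equiv.Perm (Fin n × Bool), PfOrdered π →
      Set.range (fun j => pairEquiv n (π (j, false))) =
        {k | k < pairEquiv n ((π * pairFlip n * π⁻¹) ((pairEquiv n).symm k))} := by
    intro π h
    ext k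
    constructor
    · rintro ⟨j, rfl⟩
      simpa using h.2 j
    · intro hk
      obtain ⟨⟨j, b⟩, hj⟩ : ∃ p, k = pairEquiv n (π p) := ⟨π⁻¹ ((pairEquiv n).symm k), by simp⟩
      subst hj
      cases b
      · exact ⟨j, rfl⟩
      · exact absurd (h.2 j) (not_lt_of_gt (by simpa using hk))
  have h0 : ∀ j, π (j, false) = π' (j, false) := by
    have : (fun j => pairEquiv n (π (j, false))) = fun j => pairEquiv n (π' (j, false)) := by
      refine (StrictMono.range_inj (fun i j hij => h.1 i j hij)
        (fun i j hij => h'.1 i j hij)).1 ?_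
      rw [key π h, key π' h', hc]
    intro j
    exact (pairEquiv n).injective (congrFun this j)
  ext1 ⟨j, b⟩
  cases b
  · exact h0 j
  · have h1 : (π * pairFlip n * π⁻¹) (π (j, false)) = π (j, true) := by simp
    have h2 : (π' * pairFlip n * π'⁻¹) (π' (j, false)) = π' (j, true) := by simp
    rw [← h1, ← h2, hc, h0]

/-- The permutation which fixes the even points and acts by `σ` on the odd ones. -/
def oddPerm {n : ℕ} (σ : Equiv.Perm (Fin n)) : Equiv.Perm (Fin n × Bool) :=
  Equiv.prodCongrLeft fun b => if b then σ else 1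

@[simp] theorem oddPerm_false {n : ℕ} (σ : Equiv.Perm (Fin n)) (i : Fin n) :
    oddPerm σ (i, false) = (i, false) := by simp [oddPerm]

@[simp] theorem oddPerm_true {n : ℕ} (σ : Equiv.Perm (Fin n)) (i : Fin n) :
    oddPerm σ (i, true) = (σ i, true) := by simp [oddPerm]

theorem pfTerm_oddPerm {n : ℕ} (B : Fin n × Bool → Fin n × Bool → ℂ) (σ : Equiv.Perm (Fin n)) :
    pfTerm B (oddPerm σ) =
      ((Equiv.Perm.sign σ : ℤ) : ℂ) * ∏ j : Fin n, B (j, false) (σ j, true) := by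
  have hs : Equiv.Perm.sign (oddPerm σ) = Equiv.Perm.sign σ := by
    rw [oddPerm, Equiv.Perm.sign_prodCongrLeft]
    simp
  simp [pfTerm, hs]

theorem conj_oddPerm_false {n : ℕ} (σ : Equiv.Perm (Fin n)) (i : Fin n) :
    (oddPerm σ * pairFlip n * (oddPerm σ)⁻¹) (i, false) = (σ i, true) := by
  have h : (oddPerm σ)⁻¹ (i, false) = (i, false) := by
    rw [Equiv.Perm.inv_eq_iff_eq, oddPerm_false]
  simp only [Equiv.Perm.mul_apply, h]
  simp

theorem conj_oddPerm_true {n : ℕ} (σ : Equiv.Perm (Fin n)) (i : Fin n) :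
    (oddPerm σ * pairFlip n * (oddPerm σ)⁻¹) (i, true) = (σ⁻¹ i, false) := by
  have h : (oddPerm σ)⁻¹ (i, true) = (σ⁻¹ i, true) := by
    rw [Equiv.Perm.inv_eq_iff_eq, oddPerm_true]
    simp
  simp only [Equiv.Perm.mul_apply, h]
  simp

theorem exists_oddPerm {n : ℕ} (π : Equiv.Perm (Fin n × Bool))
    (h : ∀ j, (π (j, true)).2 = !(π (j, false)).2) :
    ∃ σ : Equiv.Perm (Fin n), oddPerm σ * pairFlip n * (oddPerm σ)⁻¹ = π * pairFlip n * π⁻¹ := by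
  set ν := π * pairFlip n * π⁻¹ with hν
  have hflip : ∀ p, (ν p).2 = !p.2 := by
    intro p
    obtain ⟨⟨j, b⟩, rfl⟩ : ∃ q, p = π q := ⟨π⁻¹ p, by simp⟩
    cases b <;> simp [hν, h]
  have hinv : ∀ p, ν (ν p) = p := by
    intro p
    simp [hν]
  have hn : ∀ i b, ν (i, b) = ((ν (i, b)).1, !b) := fun i b => Prod.ext rfl (hflip (i, b))
  let σ : Equiv.Perm (Fin n) :=
    { toFun := fun i => (ν (i, false)).1
      invFun := fun i => (ν (i, true)).1
      left_inv := fun i => by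
        have := hinv (i, false)
        rw [hn i false] at this
        exact congrArg Prod.fst this
      right_inv := fun i => by
        have := hinv (i, true)
        rw [hn i true] at this
        exact congrArg Prod.fst this }
  refine ⟨σ, ?_⟩
  ext1 ⟨i, b⟩
  cases b
  · rw [conj_oddPerm_false, hn]; rfl
  · rw [conj_oddPerm_true, hn]; rfl

theorem sum_pfOrdered_eq_det {n : ℕ} (B : Fin n × Bool → Fin n × Bool → ℂ)
    (hB : ∀ p q, B p q = -B q p) (h0 : ∀ i j b, B (i, b) (j, b) = 0) :
    (open Classical in ∑ π : Equiv.Perm (Fin n × Bool) with PfOrdered π, pfTerm B π) =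
      Matrix.det (Matrix.of fun i j => B (i, false) (j, true)) := by
  classical
  rw [← Matrix.det_transpose, Matrix.det_apply']
  choose Φ hΦ using exists_pfOrdered B hB
  symm
  refine Finset.sum_of_injOn (fun σ => Φ (oddPerm σ)) ?_ ?_ ?_ ?_
  · intro σ _ σ' _ h
    have h' : oddPerm σ * pairFlip n * (oddPerm σ)⁻¹ =
        oddPerm σ' * pairFlip n * (oddPerm σ')⁻¹ := by
      rw [← (hΦ (oddPerm σ)).2.2, ← (hΦ (oddPerm σ')).2.2]
      simp only at h
      rw [h]
    ext1 i
    have := congrArg (fun p => p (i, false)) h'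
    simpa [conj_oddPerm_false] using this
  · intro σ _
    simpa using (hΦ (oddPerm σ)).1
  · intro π hπ hnot
    by_contra hne
    have hne' : ∀ j, B (π (j, false)) (π (j, true)) ≠ 0 := by
      intro j hj
      exact hne (by rw [pfTerm, Finset.prod_eq_zero (Finset.mem_univ j) hj, mul_zero])
    obtain ⟨σ, hσ⟩ := exists_oddPerm π fun j => by
      have := hne' j
      by_contra hj
      refine this ?_
      have e : (π (j, true)).2 = (π (j, false)).2 := by
        revert hj
        cases (π (j, true)).2 <;> cases (π (j, false)).2 <;> simp
      have := h0 (π (j, false)).1 (π (j, true)).1 (π (j, false)).2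
      rwa [Prod.mk.eta, ← e, Prod.mk.eta] at this
    refine hnot ⟨σ, by simp, ?_⟩
    exact (hΦ (oddPerm σ)).1.eq (by simpa using hπ) ((hΦ (oddPerm σ)).2.2.trans hσ)
  · intro σ _
    rw [(hΦ (oddPerm σ)).2.1, pfTerm_oddPerm]
    rfl

/-- A Pfaffian with vanishing even-even and odd-odd entries is a determinant. -/
theorem pfaffian_eq_det (n : ℕ) (A : Matrix (Fin (2 * n)) (Fin (2 * n)) ℂ)
    (hA : ∀ p q, A p q = -A q p)
    (h0 : ∀ i j b, A (pairEquiv n (i, b)) (pairEquiv n (j, b)) = 0) :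
    pfaffian n A =
      Matrix.det (Matrix.of fun i j => A (pairEquiv n (i, false)) (pairEquiv n (j, true))) := by
  classical
  rw [← sum_pfOrdered_eq_det (fun p q => A (pairEquiv n p) (pairEquiv n q))
    (fun p q => hA _ _) h0, pfaffian]
  symm
  refine Finset.sum_equiv (pairEquiv n).permCongr ?_ ?_
  · intro π
    have e0 : ∀ j : Fin n, (⟨2 * j, by omega⟩ : Fin (2 * n)) = pairEquiv n (j, false) :=
      fun j => rfl
    have e1 : ∀ j : Fin n, (⟨2 * j + 1, by omega⟩ : Fin (2 * n)) = pairEquiv n (j, true) :=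
      fun j => rfl
    rw [Finset.mem_filter, Finset.mem_filter]
    simp only [Finset.mem_univ, true_and, PfOrdered, e0, e1,
      Equiv.permCongr_apply, Equiv.symm_apply_apply]
  · intro π _
    have e0 : ∀ j : Fin n, (⟨2 * j, by omega⟩ : Fin (2 * n)) = pairEquiv n (j, false) :=
      fun j => rfl
    have e1 : ∀ j : Fin n, (⟨2 * j + 1, by omega⟩ : Fin (2 * n)) = pairEquiv n (j, true) :=
      fun j => rfl
    simp [pfTerm, e0, e1, Equiv.permCongr_apply]

end Pfaffian

section Dynamics

theorem hasSum_exp_apply {E : Type*} [NormedAddCommGroup E] [NormedSpace ℂ E] [CompleteSpace E]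
    (A : E →L[ℂ] E) (v : E) :
    HasSum (fun n : ℕ => ((n.factorial : ℂ)⁻¹) • (A ^ n) v) (NormedSpace.exp A v) := by
  have h := NormedSpace.exp_series_hasSum_exp' (𝕂 := ℂ) A
  have := (ContinuousLinearMap.apply ℂ E v).hasSum h
  simpa using this

theorem exp_apply_of_intertwine {E F : Type*} [NormedAddCommGroup E] [NormedSpace ℂ E]
    [CompleteSpace E] [NormedAddCommGroup F] [NormedSpace ℂ F] [CompleteSpace F]
    (A : E →L[ℂ] E) (B : F →L[ℂ] F) (J : E →L[ℂ] F) (h : ∀ v, B (J v) = J (A v)) (v : E) :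
    NormedSpace.exp B (J v) = J (NormedSpace.exp A v) := by
  have hp : ∀ n : ℕ, (B ^ n) (J v) = J ((A ^ n) v) := by
    intro n
    induction n with
    | zero => simp
    | succ n ih => rw [pow_succ', pow_succ', mul_apply_eq_comp, mul_apply_eq_comp, ih, h]
  refine (hasSum_exp_apply B (J v)).unique ?_
  have := J.hasSum (hasSum_exp_apply A v)
  simpa [hp] using this

theorem exp_apply_of_eigen {E : Type*} [NormedAddCommGroup E] [NormedSpace ℂ E]
    [CompleteSpace E] (A : E →L[ℂ] E) (v : E) (c : ℂ) (h : A v = c • v) :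
    NormedSpace.exp A v = Complex.exp c • v := by
  have hp : ∀ n : ℕ, (A ^ n) v = c ^ n • v := by
    intro n
    induction n with
    | zero => simp
    | succ n ih => rw [pow_succ, mul_apply_eq_comp, h, map_smul, ih, smul_smul, pow_succ']
  refine (hasSum_exp_apply A v).unique ?_
  have h1 := NormedSpace.exp_series_hasSum_exp' (𝕂 := ℂ) c
  rw [← Complex.exp_eq_exp_ℂ] at h1
  have := h1.smul_const v
  simpa [hp, smul_smul] using this

/-- The particle component of the doubled space. -/
abbrev pairFst (f : OneParticle) : Doubled := WithLp.toLp 2 (f, 0)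

/-- The hole component of the doubled space. -/
abbrev pairSnd (f : OneParticle) : Doubled := WithLp.toLp 2 (0, f)

theorem exp_HMag_pairFst (κ : ℝ) (z : ℂ) (f : OneParticle) :
    NormedSpace.exp (z • HMag κ) (pairFst f) = pairFst (NormedSpace.exp (z • hMag κ) f) := by
  let J : OneParticle →L[ℂ] Doubled :=
    (WithLp.prodContinuousLinearEquiv 2 ℂ OneParticle OneParticle).symm.toContinuousLinearMap ∘L
      ContinuousLinearMap.inl ℂ OneParticle OneParticle
  refine exp_apply_of_intertwine (z • hMag κ) (z • HMag κ) J (fun v => ?_) f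
  apply WithLp.ofLp_injective
  simp [J, HMag, opSum]

theorem exp_HMag_pairSnd (κ : ℝ) (z : ℂ) (f : OneParticle) :
    NormedSpace.exp (z • HMag κ) (pairSnd f) = pairSnd (NormedSpace.exp (z • -hMag κ) f) := by
  let J : OneParticle →L[ℂ] Doubled :=
    (WithLp.prodContinuousLinearEquiv 2 ℂ OneParticle OneParticle).symm.toContinuousLinearMap ∘L
      ContinuousLinearMap.inr ℂ OneParticle OneParticle
  refine exp_apply_of_intertwine (z • -hMag κ) (z • HMag κ) J (fun v => ?_) f
  apply WithLp.ofLp_injective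
  simp [J, HMag, opSum]

theorem delta_apply (x y : ℤ) : delta x y = if y = x then 1 else 0 := by
  simp [delta, lp.single_apply, Pi.single_apply]

theorem ann_delta (x : ℤ) : ann (star (delta x)) = annSite x := by
  rw [ann, tsum_eq_single x]
  · simp [delta_apply]
  · intro y hy
    simp [delta_apply, hy]

theorem cre_delta (x : ℤ) : cre (delta x) = creSite x := by
  rw [cre, tsum_eq_single x]
  · simp [delta_apply]
  · intro y hy
    simp [delta_apply, hy]

theorem bOp_pairFst_delta (x : ℤ) : bOp (pairFst (delta x)) = creSite x := by
  simp [bOp, cre_delta, ann]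

theorem bOp_pairSnd_delta (x : ℤ) : bOp (pairSnd (delta x)) = annSite x := by
  simp [bOp, ann_delta, cre]

theorem star_gen_pairFst_delta (x : ℤ) : star (gen (pairFst (delta x))) = gen (pairSnd (delta x)) := by
  apply Subtype.ext
  change star (bOp (pairFst (delta x))) = bOp (pairSnd (delta x))
  rw [bOp_pairFst_delta, bOp_pairSnd_delta, creSite, ContinuousLinearMap.star_eq_adjoint,
    ContinuousLinearMap.adjoint_adjoint]

theorem star_gen_pairSnd_delta (x : ℤ) : star (gen (pairSnd (delta x))) = gen (pairFst (delta x)) := by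
  rw [← star_gen_pairFst_delta, star_star]

theorem gen_anticomm (x y : ℤ) (h : x ≠ y) :
    gen (pairFst (delta x)) * gen (pairSnd (delta y)) =
      -(gen (pairSnd (delta y)) * gen (pairFst (delta x))) := by
  apply Subtype.ext
  change bOp (pairFst (delta x)) * bOp (pairSnd (delta y)) =
    -(bOp (pairSnd (delta y)) * bOp (pairFst (delta x)))
  rw [bOp_pairFst_delta, bOp_pairSnd_delta]
  have := car_site y x
  rw [if_neg (Ne.symm h)] at this
  exact eq_neg_of_add_eq_zero_right this

theorem shift_apply (f : OneParticle) (x : ℤ) : shift f x = f (x - 1) := by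
  exact one_mul (f (x - 1))

theorem shift_delta (x : ℤ) : shift (delta x) = delta (x + 1) := by
  ext y
  rw [shift_apply, delta_apply, delta_apply]
  congr 1
  simp only [eq_iff_iff]
  omega

theorem shift_iterate_delta (x : ℤ) (i : ℕ) : (⇑shift)^[i] (delta x) = delta (x + i) := by
  induction i with
  | zero => simp
  | succ i ih =>
    rw [Function.iterate_succ_apply', ih, shift_delta]
    push_cast
    ring_nf

theorem formOdd_eq (x₀ : ℤ) (i : ℕ) : formOdd x₀ (i + 1) = pairSnd (delta (x₀ + i)) := by
  apply WithLp.ofLp_injective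
  simp [formOdd, opSum, shift_delta, shift_iterate_delta]

theorem formEven_eq (x₀ : ℤ) (i : ℕ) : formEven x₀ (i + 1) = pairFst (delta (x₀ + i)) := by
  apply WithLp.ofLp_injective
  simp [formEven, opSum, shift_delta, shift_iterate_delta]

/-- The two-point function of the evolved initial state. -/
def evolvedTwoPoint (κ βL βR : ℝ) (N : ℕ) (t : ℝ) (x y : ℤ) : ℂ :=
  inner ℂ (NormedSpace.exp ((Complex.I * (t : ℂ)) • hMag κ) (delta x))
    (sInitMinus βL βR N (NormedSpace.exp ((Complex.I * (t : ℂ)) • hMag κ) (delta y)))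

section

variable {κ βL βR : ℝ} {N : ℕ} {ω₀ : CAR →ₗ[ℂ] ℂ} {τ : ℝ → (CAR ≃⋆ₐ[ℂ] CAR)}

theorem evolved_star_gen_mul_gen (hS₀ : HasDensity ω₀ (initialDensity βL βR N))
    (hτ : IsBogoliubov τ (HMag κ)) (t : ℝ) (F G : Doubled) :
    ω₀ (τ t (star (gen F) * gen G)) =
      inner ℂ (NormedSpace.exp ((Complex.I * (t : ℂ)) • HMag κ) F)
        (initialDensity βL βR N (NormedSpace.exp ((Complex.I * (t : ℂ)) • HMag κ) G)) := by
  rw [map_mul, map_star, hτ, hτ, hS₀]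

theorem evolved_twoPoint (hS₀ : HasDensity ω₀ (initialDensity βL βR N))
    (hτ : IsBogoliubov τ (HMag κ)) (t : ℝ) (x y : ℤ) :
    ω₀ (τ t (gen (pairSnd (delta x)) * gen (pairFst (delta y)))) =
      evolvedTwoPoint κ βL βR N t x y := by
  rw [← star_gen_pairFst_delta, evolved_star_gen_mul_gen hS₀ hτ, exp_HMag_pairFst,
    exp_HMag_pairFst]
  simp [initialDensity, opSum, evolvedTwoPoint, WithLp.prod_inner_apply]

theorem evolved_ann_ann (hS₀ : HasDensity ω₀ (initialDensity βL βR N))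
    (hτ : IsBogoliubov τ (HMag κ)) (t : ℝ) (x y : ℤ) :
    ω₀ (τ t (gen (pairSnd (delta x)) * gen (pairSnd (delta y)))) = 0 := by
  rw [← star_gen_pairFst_delta, evolved_star_gen_mul_gen hS₀ hτ, exp_HMag_pairFst,
    exp_HMag_pairSnd]
  simp [initialDensity, opSum, WithLp.prod_inner_apply]

theorem evolved_cre_cre (hS₀ : HasDensity ω₀ (initialDensity βL βR N))
    (hτ : IsBogoliubov τ (HMag κ)) (t : ℝ) (x y : ℤ) :
    ω₀ (τ t (gen (pairFst (delta x)) * gen (pairFst (delta y)))) = 0 := by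
  rw [← star_gen_pairSnd_delta, evolved_star_gen_mul_gen hS₀ hτ, exp_HMag_pairSnd,
    exp_HMag_pairFst]
  simp [initialDensity, opSum, WithLp.prod_inner_apply]

theorem evolved_efpObservable (hω₀ : IsQuasifree ω₀) (hS₀ : HasDensity ω₀ (initialDensity βL βR N))
    (hτ : IsBogoliubov τ (HMag κ)) (t : ℝ) (x₀ : ℤ) (n : ℕ) :
    ω₀ (τ t (efpObservable x₀ n)) =
      Matrix.det (Matrix.of fun i j : Fin n =>
        evolvedTwoPoint κ βL βR N t (x₀ + (i : ℕ)) (x₀ + (j : ℕ))) := by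
  set F : Fin (2 * n) → Doubled := fun k =>
    if ((pairEquiv n).symm k).2 then pairFst (delta (x₀ + (((pairEquiv n).symm k).1 : ℕ)))
    else pairSnd (delta (x₀ + (((pairEquiv n).symm k).1 : ℕ))) with hF
  set E := NormedSpace.exp ((Complex.I * (t : ℂ)) • HMag κ) with hE
  have hobs : efpObservable x₀ n = (List.ofFn fun k => gen (F k)).prod := by
    rw [efpObservable, List.ofFn_mul', List.prod_flatten, List.map_ofFn]
    congr 2
    funext i
    have e0 : (⟨2 * i + (0 : Fin 2), by omega⟩ : Fin (2 * n)) = pairEquiv n (i, false) := rfl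
    have e1 : (⟨2 * i + (1 : Fin 2), by omega⟩ : Fin (2 * n)) = pairEquiv n (i, true) := rfl
    simp only [Function.comp_apply, List.ofFn_succ, List.ofFn_zero, List.prod_cons, List.prod_nil,
      mul_one, Fin.succ_zero_eq_one, e0, e1, hF, Equiv.symm_apply_apply, formOdd_eq, formEven_eq]
    simp
  have hmap : τ t (efpObservable x₀ n) = (List.ofFn fun k => gen (E (F k))).prod := by
    rw [hobs, map_list_prod, List.map_ofFn]
    congr 2
    funext k
    exact hτ t (F k)
  have hpair : ∀ k l, ω₀ (gen (E (F k)) * gen (E (F l))) = ω₀ (τ t (gen (F k) * gen (F l))) := by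
    intro k l
    rw [map_mul (τ t), hτ, hτ]
  have hF0 : ∀ i : Fin n, F (pairEquiv n (i, false)) = pairSnd (delta (x₀ + (i : ℕ))) := by
    intro i; simp [hF]
  have hF1 : ∀ i : Fin n, F (pairEquiv n (i, true)) = pairFst (delta (x₀ + (i : ℕ))) := by
    intro i; simp [hF]
  rw [hmap, hω₀.2.2 n, pfaffian_eq_det]
  · congr 1
    ext i j
    simp only [Matrix.of_apply, corrMatrix, hpair]
    simp only [hF0, hF1]
    split_ifs with h1 h2
    · exact evolved_twoPoint hS₀ hτ t _ _
    · have hij : j < i := by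
        have : 2 * (j : ℕ) + 1 < 2 * i + 0 := h2
        exact Fin.lt_def.2 (by omega)
      rw [gen_anticomm _ _ (by have := Fin.lt_def.1 hij; omega), map_neg, map_neg, neg_neg]
      exact evolved_twoPoint hS₀ hτ t _ _
    · have : pairEquiv n (i, false) = pairEquiv n (j, true) :=
        le_antisymm (not_lt.1 h2) (not_lt.1 h1)
      simp at this
  · intro p q
    simp only [corrMatrix]
    rcases lt_trichotomy p q with h | h | h
    · simp [h, h.not_gt]
    · simp [h]
    · simp [h, h.not_gt]
  · intro i j b
    simp only [corrMatrix, hpair]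
    cases b
    · simp [hF0, evolved_ann_ann hS₀ hτ, -map_mul]
    · simp [hF1, evolved_cre_cre hS₀ hτ, -map_mul]

end

end Dynamics

section FourierSide

/-- Bounded measurable functions. -/
def BddMeas (m : ℝ → ℂ) : Prop := Measurable m ∧ ∃ B, ∀ k, ‖m k‖ ≤ B

theorem BddMeas.add {m m' : ℝ → ℂ} (h : BddMeas m) (h' : BddMeas m') :
    BddMeas fun k => m k + m' k := by
  obtain ⟨hm, B, hB⟩ := h
  obtain ⟨hm', B', hB'⟩ := h'
  exact ⟨hm.add hm', B + B', fun k => (norm_add_le _ _).trans (add_le_add (hB k) (hB' k))⟩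

theorem BddMeas.mul {m m' : ℝ → ℂ} (h : BddMeas m) (h' : BddMeas m') :
    BddMeas fun k => m k * m' k := by
  obtain ⟨hm, B, hB⟩ := h
  obtain ⟨hm', B', hB'⟩ := h'
  refine ⟨hm.mul hm', B * B', fun k => ?_⟩
  rw [norm_mul]
  exact mul_le_mul (hB k) (hB' k) (norm_nonneg _) ((norm_nonneg _).trans (hB k))

theorem BddMeas.const (c : ℂ) : BddMeas fun _ => c := ⟨measurable_const, ‖c‖, fun _ => le_rfl⟩

theorem BddMeas.sub {m m' : ℝ → ℂ} (h : BddMeas m) (h' : BddMeas m') :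
    BddMeas fun k => m k - m' k := by
  simpa [sub_eq_add_neg] using h.add ((BddMeas.const (-1)).mul h')

theorem BddMeas.comp {m : ℝ → ℂ} (h : BddMeas m) {g : ℝ → ℝ} (hg : Measurable g) :
    BddMeas fun k => m (g k) :=
  ⟨h.1.comp hg, h.2.imp fun _ hB k => hB (g k)⟩

theorem BddMeas.conj {m : ℝ → ℂ} (h : BddMeas m) : BddMeas fun k => starRingEnd ℂ (m k) :=
  ⟨Complex.continuous_conj.measurable.comp h.1, h.2.imp fun _ hB k => by simpa using hB k⟩

theorem BddMeas.indicator {m : ℝ → ℂ} (h : BddMeas m) {s : Set ℝ} (hs : MeasurableSet s) :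
    BddMeas (s.indicator m) :=
  ⟨h.1.indicator hs, h.2.imp fun _ hB k => (norm_indicator_le_norm_self _ _).trans (hB k)⟩

theorem BddMeas.pow {m : ℝ → ℂ} (h : BddMeas m) (n : ℕ) : BddMeas fun k => m k ^ n := by
  induction n with
  | zero => simpa using BddMeas.const 1
  | succ n ih => simpa [pow_succ] using ih.mul h

theorem bddMeas_cos : BddMeas fun k => (Real.cos k : ℂ) :=
  ⟨by fun_prop, 1, fun k => by rw [Complex.norm_real]; exact Real.abs_cos_le_one k⟩

theorem bddMeas_exp_cos (z : ℂ) : BddMeas fun k => Complex.exp (z * Real.cos k) := by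
  refine ⟨by fun_prop, Real.exp ‖z‖, fun k => ?_⟩
  rw [Complex.norm_exp]
  refine Real.exp_le_exp.2 ((Complex.re_le_norm _).trans ?_)
  rw [norm_mul, Complex.norm_real]
  exact mul_le_of_le_one_right (norm_nonneg _) (Real.abs_cos_le_one k)

theorem BddMeas.intervalIntegrable {m : ℝ → ℂ} (h : BddMeas m) (a b : ℝ) :
    IntervalIntegrable m MeasureTheory.volume a b := by
  obtain ⟨hm, B, hB⟩ := h
  refine (intervalIntegrable_const (c := B)).mono_fun hm.aestronglyMeasurable ?_
  exact Filter.Eventually.of_forall fun k => (hB k).trans (le_abs_self B)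

/-- The mean value over the circle. -/
def circ (f : ℝ → ℂ) : ℂ := (1 / (2 * Real.pi) : ℂ) * ∫ k in (-Real.pi)..Real.pi, f k

theorem circ_add {f g : ℝ → ℂ} (hf : BddMeas f) (hg : BddMeas g) :
    circ (fun k => f k + g k) = circ f + circ g := by
  rw [circ, intervalIntegral.integral_add (hf.intervalIntegrable _ _) (hg.intervalIntegrable _ _),
    mul_add]
  rfl

theorem circ_sub {f g : ℝ → ℂ} (hf : BddMeas f) (hg : BddMeas g) :
    circ (fun k => f k - g k) = circ f - circ g := by
  rw [circ, intervalIntegral.integral_sub (hf.intervalIntegrable _ _) (hg.intervalIntegrable _ _),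
    mul_sub]
  rfl

theorem circ_const_mul (c : ℂ) (f : ℝ → ℂ) : circ (fun k => c * f k) = c * circ f := by
  rw [circ, circ, intervalIntegral.integral_const_mul]
  ring

theorem circ_comp_neg (f : ℝ → ℂ) : circ (fun k => f (-k)) = circ f := by
  rw [circ, circ, intervalIntegral.integral_comp_neg]
  simp

theorem circ_congr {f g : ℝ → ℂ} (h : ∀ k, -Real.pi < k → k < Real.pi → k ≠ 0 → f k = g k) :
    circ f = circ g := by
  rw [circ, circ]
  congr 1
  refine intervalIntegral.integral_congr_ae ?_
  have h0 : ∀ᵐ k : ℝ, k ≠ 0 := by simp [MeasureTheory.ae_iff]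
  have h1 : ∀ᵐ k : ℝ, k ≠ Real.pi := by simp [MeasureTheory.ae_iff]
  filter_upwards [h0, h1] with k hk hk' hm
  rw [Set.uIoc_of_le (by linarith [Real.pi_pos])] at hm
  exact h k hm.1 (lt_of_le_of_ne hm.2 hk') hk

theorem norm_circ_le {f : ℝ → ℂ} {B : ℝ} (h : ∀ k, ‖f k‖ ≤ B) : ‖circ f‖ ≤ B := by
  have h1 := intervalIntegral.norm_integral_le_of_norm_le_const
    (f := f) (a := -Real.pi) (b := Real.pi) fun k _ => h k
  have hpi := Real.pi_pos
  rw [circ, norm_mul]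
  have e : ‖(1 / (2 * Real.pi) : ℂ)‖ = 1 / (2 * Real.pi) := by
    rw [norm_div, norm_mul, Complex.norm_real]
    simp [abs_of_pos hpi]
  rw [e]
  calc 1 / (2 * Real.pi) * ‖∫ k in (-Real.pi)..Real.pi, f k‖
      ≤ 1 / (2 * Real.pi) * (B * |Real.pi - -Real.pi|) := by gcongr
    _ = B := by
      rw [abs_of_pos (by linarith)]
      field_simp
      ring

theorem hasSum_circ {F : ℕ → ℝ → ℂ} {f : ℝ → ℂ} {b : ℕ → ℝ} (hF : ∀ n, Measurable (F n))
    (hb : ∀ n k, ‖F n k‖ ≤ b n) (hs : Summable b) (hf : ∀ k, HasSum (fun n => F n k) (f k)) :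
    HasSum (fun n => circ (F n)) (circ f) := by
  refine HasSum.mul_left _ ?_
  refine intervalIntegral.hasSum_integral_of_dominated_convergence (fun n _ => b n)
    (fun n => (hF n).aestronglyMeasurable) ?_ ?_ ?_ ?_
  · exact fun n => Filter.Eventually.of_forall fun k _ => hb n k
  · exact Filter.Eventually.of_forall fun k _ => hs
  · exact intervalIntegrable_const
  · exact Filter.Eventually.of_forall fun k _ => hf k

/-- The staggered plane waves. -/
def plane (x : ℤ) (k : ℝ) : ℂ := (-1) ^ x * Complex.exp (Complex.I * x * k)

theorem norm_neg_one_zpow (x : ℤ) : ‖(-1 : ℂ) ^ x‖ = 1 := by simp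

theorem neg_one_zpow_inv (x : ℤ) : ((-1 : ℂ) ^ x)⁻¹ = (-1) ^ x := by
  rw [← inv_zpow]
  norm_num

theorem norm_plane (x : ℤ) (k : ℝ) : ‖plane x k‖ = 1 := by
  rw [plane, norm_mul, norm_neg_one_zpow, one_mul, Complex.norm_exp]
  simp

theorem bddMeas_plane (x : ℤ) : BddMeas (plane x) :=
  ⟨by unfold plane; fun_prop, 1, fun k => (norm_plane x k).le⟩

theorem plane_zero (k : ℝ) : plane 0 k = 1 := by simp [plane]

theorem plane_add (x y : ℤ) (k : ℝ) : plane (x + y) k = plane x k * plane y k := by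
  rw [plane, plane, plane, zpow_add₀ (by norm_num)]
  have : Complex.exp (Complex.I * ((x + y : ℤ) : ℂ) * k) =
      Complex.exp (Complex.I * x * k) * Complex.exp (Complex.I * y * k) := by
    rw [← Complex.exp_add]
    push_cast
    ring_nf
  rw [this]
  ring

theorem plane_neg (x : ℤ) (k : ℝ) : plane (-x) k = starRingEnd ℂ (plane x k) := by
  rw [plane, plane, map_mul, ← Complex.exp_conj]
  simp [neg_one_zpow_inv]

theorem plane_neg_right (x : ℤ) (k : ℝ) : plane x (-k) = plane (-x) k := by
  simp [plane, neg_one_zpow_inv]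

theorem plane_one_add_neg_one (k : ℝ) : plane 1 k + plane (-1) k = -2 * Real.cos k := by
  have := Complex.two_cos (k : ℂ)
  rw [Complex.ofReal_cos, plane, plane]
  simp only [zpow_one, Int.cast_one, mul_one, Int.cast_neg, mul_neg, zpow_neg_one]
  rw [show Complex.I * (k : ℂ) = k * Complex.I by ring,
    show -Complex.I * (k : ℂ) = -k * Complex.I by ring, show ((-1 : ℂ))⁻¹ = -1 by norm_num]
  linear_combination this

theorem memℓp_circ_plane {m : ℝ → ℂ} (hm : BddMeas m) :
    HasSum (fun x => ‖circ fun k => m k * plane x k‖ ^ 2)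
      ((1 / (2 * Real.pi)) * ∫ k in (-Real.pi)..Real.pi, ‖m k‖ ^ 2) := by
  have hab : -Real.pi < Real.pi := by linarith [Real.pi_pos]
  obtain ⟨hmm, B, hB⟩ := hm
  have hL : MeasureTheory.MemLp m 2 (MeasureTheory.volume.restrict (Set.Ioc (-Real.pi) Real.pi)) :=
    MeasureTheory.MemLp.of_bound hmm.aestronglyMeasurable B (Filter.Eventually.of_forall hB)
  have h := hasSum_sq_fourierCoeffOn hab hL
  have h2 := (Equiv.neg ℤ).hasSum_iff.2 h
  have e1 : Real.pi - -Real.pi = 2 * Real.pi := by ring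
  convert h2 using 1
  · funext x
    simp only [Function.comp_apply, Equiv.neg_apply]
    rw [fourierCoeffOn_eq_integral]
    have hI : ∫ k in (-Real.pi)..Real.pi, m k * plane x k = (-1) ^ x *
        ∫ k in (-Real.pi)..Real.pi, fourier (-(-x)) (k : AddCircle (Real.pi - -Real.pi)) • m k := by
      rw [← intervalIntegral.integral_const_mul]
      refine intervalIntegral.integral_congr fun k _ => ?_
      have hpi : (Real.pi : ℂ) ≠ 0 := by exact_mod_cast Real.pi_ne_zero
      simp only [fourier_coe_apply, neg_neg, smul_eq_mul, plane]
      rw [show 2 * (Real.pi : ℂ) * Complex.I * x * k / ((Real.pi - -Real.pi : ℝ) : ℂ) =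
        Complex.I * x * k by push_cast; field_simp; ring]
      ring
    have e2 : (circ fun k => m k * plane x k) = (-1) ^ x * ((1 / (Real.pi - -Real.pi) : ℝ) •
        ∫ k in (-Real.pi)..Real.pi, fourier (-(-x)) (k : AddCircle (Real.pi - -Real.pi)) • m k) := by
      rw [circ, hI, Complex.real_smul, e1]
      push_cast
      ring
    rw [e2, norm_mul, norm_neg_one_zpow, one_mul]
  · rw [e1, smul_eq_mul, one_div]

/-- The vector with the staggered Fourier coefficients of `m`, for bounded measurable `m`. -/
def fourierVec (m : ℝ → ℂ) : OneParticle :=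
  open Classical in
  if h : Memℓp (fun x : ℤ => circ fun k => m k * plane x k) 2 then ⟨_, h⟩ else 0

theorem fourierVec_apply {m : ℝ → ℂ} (hm : BddMeas m) (x : ℤ) :
    fourierVec m x = circ fun k => m k * plane x k := by
  have h : Memℓp (fun x : ℤ => circ fun k => m k * plane x k) 2 := by
    refine memℓp_gen ?_
    simpa using (memℓp_circ_plane hm).summable
  rw [fourierVec, dif_pos h]

theorem fourierVec_add {m m' : ℝ → ℂ} (hm : BddMeas m) (hm' : BddMeas m') :
    fourierVec (fun k => m k + m' k) = fourierVec m + fourierVec m' := by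
  ext x
  change _ = fourierVec m x + fourierVec m' x
  rw [fourierVec_apply (hm.add hm'), fourierVec_apply hm, fourierVec_apply hm',
    ← circ_add (hm.mul (bddMeas_plane x)) (hm'.mul (bddMeas_plane x))]
  simp only [add_mul]

theorem fourierVec_const_mul {m : ℝ → ℂ} (hm : BddMeas m) (c : ℂ) :
    fourierVec (fun k => c * m k) = c • fourierVec m := by
  ext x
  change _ = c * fourierVec m x
  rw [fourierVec_apply ((BddMeas.const c).mul hm), fourierVec_apply hm, ← circ_const_mul]
  simp only [mul_assoc]

theorem norm_fourierVec_sq {m : ℝ → ℂ} (hm : BddMeas m) :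
    ‖fourierVec m‖ ^ 2 = (1 / (2 * Real.pi)) * ∫ k in (-Real.pi)..Real.pi, ‖m k‖ ^ 2 := by
  have h := lp.norm_rpow_eq_tsum (p := 2) (by simp) (fourierVec m)
  simp only [ENNReal.toReal_ofNat, Real.rpow_ofNat, fourierVec_apply hm] at h
  rw [h, (memℓp_circ_plane hm).tsum_eq]

theorem norm_fourierVec_le {m : ℝ → ℂ} (hm : BddMeas m) {B : ℝ} (hB : ∀ k, ‖m k‖ ≤ B) :
    ‖fourierVec m‖ ≤ B := by
  have hB0 : 0 ≤ B := (norm_nonneg _).trans (hB 0)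
  have hpi := Real.pi_pos
  refine le_of_sq_le_sq ?_ hB0
  rw [norm_fourierVec_sq hm]
  have h1 : ∫ k in (-Real.pi)..Real.pi, ‖m k‖ ^ 2 ≤ ∫ _ in (-Real.pi)..Real.pi, B ^ 2 := by
    refine intervalIntegral.integral_mono_on (by linarith) ?_ intervalIntegrable_const
      fun k _ => by gcongr; exact hB k
    refine (intervalIntegrable_const (c := B ^ 2)).mono_fun
      (hm.1.norm.pow_const 2).aestronglyMeasurable (Filter.Eventually.of_forall fun k => ?_)
    change ‖‖m k‖ ^ 2‖ ≤ ‖B ^ 2‖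
    rw [Real.norm_of_nonneg (by positivity), Real.norm_of_nonneg (by positivity)]
    gcongr; exact hB k
  calc _ ≤ (1 / (2 * Real.pi)) * ∫ _ in (-Real.pi)..Real.pi, B ^ 2 := by gcongr
    _ = B ^ 2 := by
      rw [intervalIntegral.integral_const, smul_eq_mul]
      field_simp
      ring

theorem inner_fourierVec {m m' : ℝ → ℂ} (hm : BddMeas m) (hm' : BddMeas m') :
    inner ℂ (fourierVec m) (fourierVec m') = circ fun k => starRingEnd ℂ (m k) * m' k := by
  have key : ∀ c : ℂ, ((‖fourierVec m + c • fourierVec m'‖ ^ 2 : ℝ) : ℂ) =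
      circ fun k => ((‖m k + c * m' k‖ ^ 2 : ℝ) : ℂ) := by
    intro c
    rw [← fourierVec_const_mul hm', ← fourierVec_add hm ((BddMeas.const c).mul hm'),
      norm_fourierVec_sq (hm.add ((BddMeas.const c).mul hm')), circ, intervalIntegral.integral_ofReal]
    push_cast
    rfl
  have hb : ∀ c : ℂ, BddMeas fun k => ((‖m k + c * m' k‖ ^ 2 : ℝ) : ℂ) := by
    intro c
    have h := hm.add ((BddMeas.const c).mul hm')
    convert h.conj.mul h using 2 with k
    rw [← Complex.normSq_eq_conj_mul_self, Complex.normSq_eq_norm_sq]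
  have k1 := key 1
  have k2 := key (-1)
  have k3 := key (-Complex.I)
  have k4 := key Complex.I
  rw [inner_eq_sum_norm_sq_div_four]
  simp only [one_smul, neg_smul, ← sub_eq_add_neg] at k1 k2 k3 k4
  simp only [RCLike.I_to_complex, Complex.coe_algebraMap] at *
  have e : ∀ a b : ℂ, starRingEnd ℂ a * b =
      (1 / 4) * ((((‖a + 1 * b‖ ^ 2 : ℝ) : ℂ) - ((‖a + -1 * b‖ ^ 2 : ℝ) : ℂ)) +
        Complex.I * (((‖a + -Complex.I * b‖ ^ 2 : ℝ) : ℂ) - ((‖a + Complex.I * b‖ ^ 2 : ℝ) : ℂ))) := by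
    intro a b
    simp only [← Complex.normSq_eq_norm_sq, ← Complex.mul_conj, map_add, map_mul, map_neg,
      Complex.conj_I, map_one]
    linear_combination ((1 / 2) * b * starRingEnd ℂ a - (1 / 2) * a * starRingEnd ℂ b) *
      Complex.I_sq
  simp only [e (m _)]
  rw [circ_const_mul, circ_add ((hb 1).sub (hb (-1)))
    ((BddMeas.const _).mul ((hb (-Complex.I)).sub (hb Complex.I))), circ_const_mul,
    circ_sub (hb 1) (hb (-1)), circ_sub (hb (-Complex.I)) (hb Complex.I), ← k1, ← k2, ← k3, ← k4]
  push_cast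
  ring

end FourierSide

section ScatteringStates

theorem inner_delta_left (x : ℤ) (f : OneParticle) : inner ℂ (delta x) f = f x := by
  rw [delta, lp.inner_single_left]
  simp

theorem adjoint_shift_apply (f : OneParticle) (x : ℤ) :
    ContinuousLinearMap.adjoint shift f x = f (x + 1) := by
  rw [← inner_delta_left, ContinuousLinearMap.adjoint_inner_right, shift_delta, inner_delta_left]

theorem hMag_apply (κ : ℝ) (f : OneParticle) (x : ℤ) :
    hMag κ f x = 1 / 2 * (f (x + 1) + f (x - 1)) + if x = 0 then κ * f 0 else 0 := by
  have h : hMag κ f x = 1 / 2 * (shift f x + ContinuousLinearMap.adjoint shift f x) +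
      κ * (inner ℂ (delta 0) f * delta 0 x) := rfl
  rw [h, shift_apply, adjoint_shift_apply, inner_delta_left, delta_apply]
  split_ifs <;> ring

theorem hMag_zero : hMag 0 = hXY := by simp [hMag]

/-- The scattering amplitude of the impurity. -/
def scatC (κ p : ℝ) : ℂ := -κ / (κ - Complex.I * Real.sin p)

theorem scatC_zero (p : ℝ) : scatC 0 p = 0 := by simp [scatC]

theorem scatC_mul (κ p : ℝ) : scatC κ p * (κ - Complex.I * Real.sin p) = -κ := by
  by_cases h : (κ : ℂ) - Complex.I * Real.sin p = 0
  · have : κ = 0 := by simpa using congrArg Complex.re h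
    simp [this, scatC_zero]
  · rw [scatC, div_mul_cancel₀ _ h]

theorem norm_scatC_le (κ p : ℝ) : ‖scatC κ p‖ ≤ 1 := by
  rw [scatC, norm_div]
  refine div_le_one_of_le₀ ?_ (norm_nonneg _)
  have := Complex.abs_re_le_norm ((κ : ℂ) - Complex.I * Real.sin p)
  simpa using this

theorem bddMeas_scatC (κ : ℝ) : BddMeas (scatC κ) :=
  ⟨by unfold scatC; fun_prop, 1, norm_scatC_le κ⟩

/-- The staggered generalized eigenfunctions of `h_B`, up to complex conjugation in the
momentum. -/
def wave (κ : ℝ) (x : ℤ) (k : ℝ) : ℂ := plane x k + scatC κ |k| * plane |x| |k|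

theorem bddMeas_wave (κ : ℝ) (x : ℤ) : BddMeas (wave κ x) :=
  (bddMeas_plane x).add (((bddMeas_scatC κ).comp measurable_norm).mul
    ((bddMeas_plane |x|).comp measurable_norm))

theorem wave_zero (x : ℤ) (k : ℝ) : wave 0 x k = plane x k := by simp [wave, scatC_zero]

theorem plane_succ_add_pred (x : ℤ) (k : ℝ) :
    plane (x + 1) k + plane (x - 1) k = -2 * Real.cos k * plane x k := by
  rw [sub_eq_add_neg, plane_add, plane_add, ← mul_add, plane_one_add_neg_one]
  ring

theorem plane_one (k : ℝ) : plane 1 k = -(Real.cos k + Complex.I * Real.sin k) := by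
  rw [plane, zpow_one, Int.cast_one, mul_one, mul_comm Complex.I (k : ℂ), Complex.exp_mul_I]
  push_cast
  ring

theorem wave_eigen (κ : ℝ) (x : ℤ) (k : ℝ) :
    1 / 2 * (wave κ (x + 1) k + wave κ (x - 1) k) + (if x = 0 then κ * wave κ 0 k else 0) =
      -Real.cos k * wave κ x k := by
  have h1 := plane_succ_add_pred x k
  rcases lt_trichotomy x 0 with hx | hx | hx
  · have h2 := plane_succ_add_pred |x| |k|
    rw [Real.cos_abs] at h2
    have e1 : |x + 1| = |x| - 1 := by rw [abs_of_neg hx, abs_of_nonpos (by omega)]; ring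
    have e2 : |x - 1| = |x| + 1 := by rw [abs_of_neg hx, abs_of_nonpos (by omega)]; ring
    rw [if_neg hx.ne, wave, wave, wave, e1, e2]
    linear_combination (1 / 2) * h1 + (1 / 2) * scatC κ |k| * h2
  · subst hx
    have h3 := scatC_mul κ |k|
    simp only [wave, zero_add, zero_sub, abs_neg, abs_one, abs_zero, plane_zero, if_true,
      plane_one |k|, Real.cos_abs] at h1 ⊢
    linear_combination (1 / 2) * h1 + h3
  · have h2 := plane_succ_add_pred |x| |k|
    rw [Real.cos_abs] at h2
    have e1 : |x + 1| = |x| + 1 := by rw [abs_of_pos hx, abs_of_nonneg (by omega)]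
    have e2 : |x - 1| = |x| - 1 := by rw [abs_of_pos hx, abs_of_nonneg (by omega)]
    rw [if_neg hx.ne', wave, wave, wave, e1, e2]
    linear_combination (1 / 2) * h1 + (1 / 2) * scatC κ |k| * h2

/-- The operator `(T f)(x) = f(|x|)`. -/
def absOp : OneParticle →L[ℂ] OneParticle :=
  wcomp id (fun x => if 0 ≤ x then 1 else 0) (by intro x; split_ifs <;> simp)
      Function.injective_id.injOn +
    wcomp (fun x => -x) (fun x => if 0 ≤ x then 0 else 1) (by intro x; split_ifs <;> simp)
      neg_injective.injOn

theorem absOp_apply (f : OneParticle) (x : ℤ) : absOp f x = f |x| := by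
  have h : absOp f x = (if 0 ≤ x then 1 else 0) * f x + (if 0 ≤ x then 0 else 1) * f (-x) := rfl
  rw [h]
  split_ifs with hx
  · rw [abs_of_nonneg hx]; ring
  · rw [abs_of_neg (not_le.1 hx)]; ring

theorem circ_eq_circ_indicator {f : ℝ → ℂ} (hf : BddMeas f) :
    circ f = circ ((Set.Ioi 0).indicator fun k => f k + f (-k)) := by
  have h1 : circ f = circ fun k => (Set.Ioi 0).indicator f k + (Set.Iio 0).indicator f k := by
    refine circ_congr fun k _ _ hk => ?_
    rcases lt_or_gt_of_ne hk with h | h <;> simp [h, h.le]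
  have h2 : circ ((Set.Iio 0).indicator f) =
      circ fun k => (Set.Ioi 0).indicator (fun k => f (-k)) k := by
    rw [← circ_comp_neg]
    refine circ_congr fun k _ _ _ => ?_
    simp [Set.indicator_apply]
  rw [h1, circ_add (hf.indicator measurableSet_Ioi) (hf.indicator measurableSet_Iio), h2,
    ← circ_add (hf.indicator measurableSet_Ioi)
      ((hf.comp measurable_neg).indicator measurableSet_Ioi)]
  congr 1
  funext k
  simp only [Set.indicator_apply]
  split_ifs <;> simp

/-- The symbol of the scattered wave. -/
def scatSymbol (κ : ℝ) (m : ℝ → ℂ) : ℝ → ℂ :=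
  (Set.Ioi 0).indicator fun k => scatC κ k * (m k + m (-k))

theorem BddMeas.scatSymbol {m : ℝ → ℂ} (hm : BddMeas m) (κ : ℝ) : BddMeas (scatSymbol κ m) :=
  ((bddMeas_scatC κ).mul (hm.add (hm.comp measurable_neg))).indicator measurableSet_Ioi

/-- The wave packet with momentum distribution `m`. -/
def waveVec (κ : ℝ) (m : ℝ → ℂ) : OneParticle :=
  fourierVec m + absOp (fourierVec (scatSymbol κ m))

theorem waveVec_apply (κ : ℝ) {m : ℝ → ℂ} (hm : BddMeas m) (x : ℤ) :
    waveVec κ m x = circ fun k => m k * wave κ x k := by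
  have h : waveVec κ m x = fourierVec m x + absOp (fourierVec (scatSymbol κ m)) x := rfl
  have hC : BddMeas fun k => scatC κ |k| * plane |x| |k| :=
    ((bddMeas_scatC κ).comp measurable_norm).mul ((bddMeas_plane |x|).comp measurable_norm)
  rw [h, absOp_apply, fourierVec_apply hm, fourierVec_apply (hm.scatSymbol κ)]
  simp only [wave, mul_add]
  rw [circ_add (hm.mul (bddMeas_plane x)) (hm.mul hC), circ_eq_circ_indicator (hm.mul hC)]
  congr 2
  funext k
  simp only [scatSymbol, Set.indicator_apply, Set.mem_Ioi]
  split_ifs with hk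
  · simp [abs_of_pos hk]
    ring
  · simp

theorem waveVec_zero {m : ℝ → ℂ} (hm : BddMeas m) : waveVec 0 m = fourierVec m := by
  ext x
  rw [waveVec_apply 0 hm, fourierVec_apply hm]
  simp only [wave_zero]

theorem hMag_waveVec (κ : ℝ) {m : ℝ → ℂ} (hm : BddMeas m) (z : ℂ) :
    (z • hMag κ) (waveVec κ m) = waveVec κ fun k => -z * Real.cos k * m k := by
  ext x
  have h : ((z • hMag κ) (waveVec κ m)) x = z * (hMag κ (waveVec κ m)) x := rfl
  have hm' : BddMeas fun k => -z * Real.cos k * m k :=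
    ((BddMeas.const (-z)).mul bddMeas_cos).mul hm
  have hw := fun y => hm.mul (bddMeas_wave κ y)
  rw [h, hMag_apply, waveVec_apply κ hm', waveVec_apply κ hm, waveVec_apply κ hm,
    waveVec_apply κ hm]
  have e : ∀ k, -z * Real.cos k * m k * wave κ x k =
      z * (1 / 2 * (m k * wave κ (x + 1) k + m k * wave κ (x - 1) k) +
        (if x = 0 then (κ : ℂ) else 0) * (m k * wave κ 0 k)) := by
    intro k
    have := wave_eigen κ x k
    split_ifs at this ⊢ <;> linear_combination (-z * m k) * this
  simp only [e]
  rw [circ_const_mul, circ_add ((BddMeas.const _).mul ((hw _).add (hw _)))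
    ((BddMeas.const _).mul (hw _)), circ_const_mul, circ_const_mul, circ_add (hw _) (hw _)]
  split_ifs <;> simp

theorem exp_hMag_waveVec (κ : ℝ) {m : ℝ → ℂ} (hm : BddMeas m) (z : ℂ) :
    NormedSpace.exp (z • hMag κ) (waveVec κ m) =
      waveVec κ fun k => Complex.exp (-z * Real.cos k) * m k := by
  have hb : ∀ n : ℕ, BddMeas fun k => (-z * Real.cos k) ^ n * m k :=
    fun n => (((BddMeas.const (-z)).mul bddMeas_cos).pow n).mul hm
  have hp : ∀ n : ℕ, ((z • hMag κ) ^ n) (waveVec κ m) =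
      waveVec κ fun k => (-z * Real.cos k) ^ n * m k := by
    intro n
    induction n with
    | zero => simp
    | succ n ih =>
      rw [pow_succ', mul_apply_eq_comp, ih, hMag_waveVec κ (hb n)]
      congr 1
      funext k
      ring
  ext x
  have h1 := (innerSL ℂ (delta x)).hasSum (hasSum_exp_apply (z • hMag κ) (waveVec κ m))
  simp only [innerSL_apply_apply, hp, inner_smul_right, inner_delta_left] at h1
  rw [waveVec_apply κ ((bddMeas_exp_cos (-z)).mul hm)]
  refine h1.unique ?_
  obtain ⟨B, hB⟩ := (hm.mul (bddMeas_wave κ x)).2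
  have hB0 : 0 ≤ B := (norm_nonneg _).trans (hB 0)
  have h2 : HasSum (fun n : ℕ => circ fun k => ((n.factorial : ℂ)⁻¹) *
      ((-z * Real.cos k) ^ n * m k * wave κ x k))
      (circ fun k => Complex.exp (-z * Real.cos k) * m k * wave κ x k) := by
    refine hasSum_circ (b := fun n => ‖z‖ ^ n / n.factorial * B) ?_ ?_ ?_ ?_
    · exact fun n => ((BddMeas.const _).mul ((hb n).mul (bddMeas_wave κ x))).1
    · intro n k
      have hc : ‖(Real.cos k : ℂ)‖ ≤ 1 := by
        rw [Complex.norm_real]; exact Real.abs_cos_le_one k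
      have h3 := hB k
      rw [mul_assoc ((-z * Real.cos k) ^ n), norm_mul, norm_mul, norm_inv, norm_pow, norm_mul,
        norm_neg, Complex.norm_natCast]
      calc ((n.factorial : ℝ))⁻¹ * ((‖z‖ * ‖(Real.cos k : ℂ)‖) ^ n * ‖m k * wave κ x k‖)
          ≤ ((n.factorial : ℝ))⁻¹ * ((‖z‖ * 1) ^ n * B) := by gcongr
        _ = _ := by rw [mul_one]; ring
    · exact (Real.summable_pow_div_factorial ‖z‖).mul_right B
    · intro k
      have h4 := NormedSpace.exp_series_hasSum_exp' (𝕂 := ℂ) (-z * Real.cos k : ℂ)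
      rw [← Complex.exp_eq_exp_ℂ] at h4
      have h5 := h4.mul_right (m k * wave κ x k)
      simpa [mul_assoc] using h5
  simp only [circ_const_mul] at h2
  simp only [waveVec_apply κ (hb _)]
  exact h2

theorem exp_hXY_fourierVec {m : ℝ → ℂ} (hm : BddMeas m) (z : ℂ) :
    NormedSpace.exp (z • hXY) (fourierVec m) =
      fourierVec fun k => Complex.exp (-z * Real.cos k) * m k := by
  rw [← waveVec_zero hm, ← waveVec_zero ((bddMeas_exp_cos (-z)).mul hm), ← hMag_zero,
    exp_hMag_waveVec 0 hm]

end ScatteringStates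

section NonstationaryPhase

open Filter Topology

theorem tendsto_integral_mul_exp_cos (m : ℝ → ℂ) :
    Tendsto (fun t : ℝ => ∫ p in (0 : ℝ)..Real.pi, m p * Complex.exp (-Complex.I * t * Real.cos p))
      atTop (𝓝 0) := by
  set s : Set ℝ := Set.Ioo 0 Real.pi with hs
  have hinj : Set.InjOn Real.cos s := Real.injOn_cos.mono Set.Ioo_subset_Icc_self
  set S : Set ℝ := Real.cos '' s with hS
  have hSm : MeasurableSet S :=
    measurableSet_Ioo.image_of_continuousOn_injOn Real.continuous_cos.continuousOn hinj
  set f : ℝ → ℂ := S.indicator fun c => m (Real.arccos c) / Real.sin (Real.arccos c) with hf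
  have h1 := Real.tendsto_integral_exp_smul_cocompact f
  have h2 : Tendsto (fun t : ℝ => t / (2 * Real.pi)) atTop (cocompact ℝ) :=
    (tendsto_id.atTop_div_const (by positivity)).mono_right atTop_le_cocompact
  refine (h1.comp h2).congr fun t => ?_
  have hpi : (Real.pi : ℂ) ≠ 0 := by exact_mod_cast Real.pi_ne_zero
  have e1 : ∀ v : ℝ, Real.fourierChar (-(v * (t / (2 * Real.pi)))) • f v =
      S.indicator (fun c => Complex.exp (-Complex.I * t * c) *
        (m (Real.arccos c) / Real.sin (Real.arccos c))) v := by
    intro v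
    classical
    rw [Circle.smul_def, Real.fourierChar_apply, hf, Set.indicator_apply, Set.indicator_apply]
    split_ifs
    · rw [smul_eq_mul]
      congr 2
      push_cast
      field_simp
    · simp
  simp only [Function.comp_apply, e1]
  rw [MeasureTheory.integral_indicator hSm, hS,
    MeasureTheory.integral_image_eq_integral_abs_deriv_smul measurableSet_Ioo
      (fun p _ => (Real.hasDerivAt_cos p).hasDerivWithinAt) hinj,
    intervalIntegral.integral_of_le Real.pi_pos.le, MeasureTheory.integral_Ioc_eq_integral_Ioo]
  refine MeasureTheory.setIntegral_congr_fun measurableSet_Ioo fun p hp => ?_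
  have hsin : 0 < Real.sin p := Real.sin_pos_of_pos_of_lt_pi hp.1 hp.2
  have hsin' : (Real.sin p : ℂ) ≠ 0 := by exact_mod_cast hsin.ne'
  simp only [Real.arccos_cos hp.1.le hp.2.le, abs_neg, abs_of_pos hsin, Complex.real_smul]
  field_simp

theorem norm_integral_phase_le_of_cos_sign {m m' : ℝ → ℂ} (hm : ∀ p, HasDerivAt m (m' p) p)
    (hm' : Continuous m') {B B' : ℝ} (hB : ∀ p ∈ Set.Icc 0 Real.pi, ‖m p‖ ≤ B)
    (hB' : ∀ p ∈ Set.Icc 0 Real.pi, ‖m' p‖ ≤ B') {ν t : ℝ} (hν : 0 < ν) (ht : 0 ≤ t)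
    {a b σ : ℝ} (ha : 0 ≤ a) (hab : a ≤ b) (hb : b ≤ Real.pi) (hσ : |σ| = 1)
    (hcos : ∀ p ∈ Set.Icc a b, 0 ≤ σ * Real.cos p) :
    ‖∫ p in a..b, m p * Complex.exp (Complex.I * (ν * p - t * Real.cos p))‖ ≤
      (3 * B + (b - a) * B') / ν := by
  have hsub : ∀ p ∈ Set.Icc a b, p ∈ Set.Icc 0 Real.pi :=
    fun p hp => ⟨ha.trans hp.1, hp.2.trans hb⟩
  set D : ℝ → ℝ := fun p => ν + t * Real.sin p with hD
  have hDν : ∀ p ∈ Set.Icc a b, ν ≤ D p := by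
    intro p hp
    have := Real.sin_nonneg_of_mem_Icc (hsub p hp)
    have := mul_nonneg ht this
    simp only [hD]; linarith
  have hD0 : ∀ p ∈ Set.Icc a b, (D p : ℂ) ≠ 0 := by
    intro p hp
    exact_mod_cast (hν.trans_le (hDν p hp)).ne'
  have hB0 : 0 ≤ B := (norm_nonneg _).trans (hB a (hsub a ⟨le_rfl, hab⟩))
  set E : ℝ → ℂ := fun p => Complex.exp (Complex.I * (ν * p - t * Real.cos p)) with hE
  have hEn : ∀ p, ‖E p‖ = 1 := by
    intro p
    simp only [hE]
    rw [show Complex.I * ((ν : ℂ) * p - t * Real.cos p) = ((ν * p - t * Real.cos p : ℝ) : ℂ) *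
      Complex.I by push_cast; ring, Complex.norm_exp_ofReal_mul_I]
  have hDd : ∀ p, HasDerivAt D (t * Real.cos p) p := fun p => by
    simpa [hD] using ((Real.hasDerivAt_sin p).const_mul t).const_add ν
  have hEd : ∀ p, HasDerivAt E (Complex.I * D p * E p) p := by
    intro p
    have h1 : HasDerivAt (fun p : ℝ => ν * p - t * Real.cos p) (D p) p := by
      exact (((hasDerivAt_id p).const_mul ν).sub ((Real.hasDerivAt_cos p).const_mul t)).congr_deriv
        (by simp only [hD]; ring)
    have h2 := (h1.ofReal_comp.const_mul Complex.I).cexp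
    have e : E = fun p : ℝ => Complex.exp (Complex.I * ((ν * p - t * Real.cos p : ℝ) : ℂ)) := by
      funext p; simp only [hE]; push_cast; rfl
    rw [e]
    exact h2.congr_deriv (by ring)
  set G' : ℝ → ℂ := fun p => (m' p * D p - m p * (t * Real.cos p : ℝ)) / (D p) ^ 2 / Complex.I
    with hG'
  have hGd : ∀ p ∈ Set.Icc a b, HasDerivAt (fun p => m p / D p / Complex.I) (G' p) p := by
    intro p hp
    exact ((hm p).div (hDd p).ofReal_comp (hD0 p hp)).div_const Complex.I
  have hGc : ContinuousOn G' (Set.Icc a b) := by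
    have c1 : Continuous m := continuous_iff_continuousAt.2 fun p => (hm p).continuousAt
    have c2 : Continuous D := continuous_iff_continuousAt.2 fun p => (hDd p).continuousAt
    refine ContinuousOn.div_const (ContinuousOn.div (by fun_prop) (by fun_prop) ?_) _
    exact fun p hp => pow_ne_zero 2 (hD0 p hp)
  have hEc : Continuous E := continuous_iff_continuousAt.2 fun p => (hEd p).continuousAt
  have hmc : Continuous m := continuous_iff_continuousAt.2 fun p => (hm p).continuousAt
  have hIcc : Set.uIcc a b = Set.Icc a b := Set.uIcc_of_le hab
  have hi1 : IntervalIntegrable (fun p => G' p * E p) MeasureTheory.volume a b :=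
    ContinuousOn.intervalIntegrable (by rw [hIcc]; exact hGc.mul hEc.continuousOn)
  have hi2 : IntervalIntegrable (fun p => m p * E p) MeasureTheory.volume a b :=
    (hmc.mul hEc).intervalIntegrable _ _
  have hparts : ∫ p in a..b, (G' p * E p + m p * E p) =
      m b / D b / Complex.I * E b - m a / D a / Complex.I * E a := by
    refine intervalIntegral.integral_eq_sub_of_hasDerivAt
      (f := fun p => m p / D p / Complex.I * E p) (fun p hp => ?_) (hi1.add hi2)
    rw [hIcc] at hp
    refine ((hGd p hp).mul (hEd p)).congr_deriv ?_
    have := hD0 p hp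
    have hI := Complex.I_ne_zero
    field_simp
  rw [intervalIntegral.integral_add hi1 hi2] at hparts
  have hbd : ∀ p ∈ Set.Icc a b, ‖m p / D p / Complex.I * E p‖ ≤ B / ν := by
    intro p hp
    rw [norm_mul, hEn, mul_one, norm_div, norm_div, Complex.norm_I, div_one, Complex.norm_real,
      Real.norm_of_nonneg (hν.le.trans (hDν p hp))]
    exact div_le_div₀ hB0 (hB p (hsub p hp)) hν (hDν p hp)
  have hVd : ∀ p ∈ Set.uIcc a b, HasDerivAt (fun p => B' / ν * p - B * σ * (1 / D p))
      (B' / ν + B * (σ * (t * Real.cos p) / D p ^ 2)) p := by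
    intro p hp
    rw [hIcc] at hp
    have h0 : D p ≠ 0 := (hν.trans_le (hDν p hp)).ne'
    have h1 := ((hDd p).inv h0).const_mul (B * σ)
    have h2 := ((hasDerivAt_id p).const_mul (B' / ν)).sub h1
    have e : (fun p => B' / ν * p - B * σ * (1 / D p)) =
        fun p => B' / ν * p - B * σ * (D p)⁻¹ := by
      funext q; rw [one_div]
    rw [e]
    exact h2.congr_deriv (by ring)
  have hVi : IntervalIntegrable (fun p => B' / ν + B * (σ * (t * Real.cos p) / D p ^ 2))
      MeasureTheory.volume a b := by
    refine ContinuousOn.intervalIntegrable ?_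
    rw [hIcc]
    have c2 : Continuous D := continuous_iff_continuousAt.2 fun p => (hDd p).continuousAt
    refine continuousOn_const.add (continuousOn_const.mul
      (ContinuousOn.div (by fun_prop) (by fun_prop) ?_))
    exact fun p hp => pow_ne_zero 2 (hν.trans_le (hDν p hp)).ne'
  have hV := intervalIntegral.integral_eq_sub_of_hasDerivAt hVd hVi
  have hle : ‖∫ p in a..b, G' p * E p‖ ≤
      ∫ p in a..b, (B' / ν + B * (σ * (t * Real.cos p) / D p ^ 2)) := by
    refine intervalIntegral.norm_integral_le_of_norm_le hab ?_ hVi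
    refine Eventually.of_forall fun p hp' => ?_
    have hp : p ∈ Set.Icc a b := Set.Ioc_subset_Icc_self hp'
    have hDp := hν.trans_le (hDν p hp)
    rw [norm_mul, hEn, mul_one]
    simp only [hG']
    rw [norm_div, norm_div, Complex.norm_I, div_one, norm_pow, Complex.norm_real,
      Real.norm_of_nonneg hDp.le, div_le_iff₀ (by positivity)]
    have habs : |t * Real.cos p| = σ * (t * Real.cos p) := by
      have h0 : 0 ≤ σ * (t * Real.cos p) := by
        have := mul_nonneg ht (hcos p hp)
        linarith [this, mul_left_comm σ t (Real.cos p)]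
      rw [← abs_of_nonneg h0, abs_mul σ, hσ, one_mul]
    calc ‖m' p * D p - m p * (t * Real.cos p : ℝ)‖
        ≤ ‖m' p‖ * D p + ‖m p‖ * (σ * (t * Real.cos p)) := by
          refine (norm_sub_le _ _).trans ?_
          rw [norm_mul, norm_mul, Complex.norm_real, Complex.norm_real,
            Real.norm_of_nonneg hDp.le, Real.norm_eq_abs, habs]
      _ ≤ B' * D p * (D p / ν) + B * (σ * (t * Real.cos p)) := by
          have h3 : ‖m' p‖ ≤ B' := hB' p (hsub p hp)
          have h4 : 0 ≤ B' := (norm_nonneg _).trans h3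
          refine add_le_add ?_ (mul_le_mul_of_nonneg_right (hB p (hsub p hp))
            (habs ▸ abs_nonneg _))
          calc ‖m' p‖ * D p ≤ B' * D p := by gcongr
            _ = B' * D p * 1 := (mul_one _).symm
            _ ≤ _ := mul_le_mul_of_nonneg_left ((one_le_div hν).2 (hDν p hp)) (by positivity)
      _ = _ := by field_simp
  have hinv : ∀ p ∈ Set.Icc a b, 0 ≤ 1 / D p ∧ 1 / D p ≤ 1 / ν := by
    intro p hp
    have := hDν p hp
    exact ⟨by have := hν.trans_le this; positivity, one_div_le_one_div_of_le hν this⟩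
  have hσ2 : B * σ * (1 / D a) - B * σ * (1 / D b) ≤ B * (1 / ν) := by
    have ia := hinv a ⟨le_rfl, hab⟩
    have ib := hinv b ⟨hab, le_rfl⟩
    have h5 : σ * (1 / D a - 1 / D b) ≤ 1 / ν := by
      refine (le_abs_self _).trans ?_
      rw [abs_mul, hσ, one_mul, abs_le]
      constructor <;> linarith [ia.1, ia.2, ib.1, ib.2]
    calc _ = B * (σ * (1 / D a - 1 / D b)) := by ring
      _ ≤ _ := mul_le_mul_of_nonneg_left h5 hB0
  have e : ∫ p in a..b, m p * E p = m b / D b / Complex.I * E b - m a / D a / Complex.I * E a -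
      ∫ p in a..b, G' p * E p := by rw [← hparts]; ring
  change ‖∫ p in a..b, m p * E p‖ ≤ _
  rw [e]
  calc _ ≤ B / ν + B / ν + (B' / ν * b - B * σ * (1 / D b) - (B' / ν * a - B * σ * (1 / D a))) := by
        refine (norm_sub_le _ _).trans (add_le_add ((norm_sub_le _ _).trans (add_le_add
          (hbd b ⟨hab, le_rfl⟩) (hbd a ⟨le_rfl, hab⟩))) ?_)
        rw [← hV]; exact hle
    _ ≤ B / ν + B / ν + (B' / ν * (b - a) + B * (1 / ν)) := by linarith
    _ = _ := by ring

/-- An oscillatory integral without stationary points. -/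
def phaseInt (m : ℝ → ℂ) (ν t : ℝ) : ℂ :=
  ∫ p in (0 : ℝ)..Real.pi, m p * Complex.exp (Complex.I * (ν * p - t * Real.cos p))

theorem exists_norm_phaseInt_le {m : ℝ → ℂ} (hm : ContDiff ℝ 1 m) :
    ∃ K, 0 ≤ K ∧ ∀ (n : ℕ) (t : ℝ), 0 ≤ t → ‖phaseInt m n t‖ ≤ K / (n + 1) := by
  have hd : ∀ p, HasDerivAt m (deriv m p) p :=
    fun p => (hm.differentiable (by norm_num) p).hasDerivAt
  have hc : Continuous (deriv m) := hm.continuous_deriv (by norm_num)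
  obtain ⟨B, hB⟩ := (isCompact_Icc (a := (0 : ℝ)) (b := Real.pi)).exists_bound_of_continuousOn
    hm.continuous.continuousOn
  obtain ⟨B', hB'⟩ := (isCompact_Icc (a := (0 : ℝ)) (b := Real.pi)).exists_bound_of_continuousOn
    hc.continuousOn
  have hpi := Real.pi_pos
  have hB0 : 0 ≤ B := (norm_nonneg _).trans (hB 0 ⟨le_rfl, hpi.le⟩)
  have hB0' : 0 ≤ B' := (norm_nonneg _).trans (hB' 0 ⟨le_rfl, hpi.le⟩)
  refine ⟨2 * (6 * B + Real.pi * B') + Real.pi * B, by positivity, fun n t ht => ?_⟩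
  have hmc := hm.continuous
  rcases Nat.eq_zero_or_pos n with rfl | hn
  · have h1 : ‖phaseInt m ((0 : ℕ) : ℝ) t‖ ≤ B * |Real.pi - 0| := by
      refine intervalIntegral.norm_integral_le_of_norm_le_const fun p hp => ?_
      rw [Set.uIoc_of_le hpi.le] at hp
      rw [norm_mul, show Complex.I * ((((0 : ℕ) : ℝ) : ℂ) * p - t * Real.cos p) =
        ((-(t * Real.cos p) : ℝ) : ℂ) * Complex.I by push_cast; ring,
        Complex.norm_exp_ofReal_mul_I, mul_one]
      exact hB p ⟨hp.1.le, hp.2⟩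
    rw [sub_zero, abs_of_pos hpi] at h1
    refine h1.trans ?_
    rw [Nat.cast_zero, zero_add, div_one]
    nlinarith [mul_nonneg hpi.le hB0']
  · have hν : (0 : ℝ) < n := by exact_mod_cast hn
    have h1 := norm_integral_phase_le_of_cos_sign hd hc hB hB' hν ht (a := 0) (b := Real.pi / 2)
      (σ := 1) le_rfl (by linarith) (by linarith) (by simp) (fun p hp => by
        rw [one_mul]
        exact Real.cos_nonneg_of_mem_Icc ⟨by linarith [hp.1], hp.2⟩)
    have h2 := norm_integral_phase_le_of_cos_sign hd hc hB hB' hν ht (a := Real.pi / 2)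
      (b := Real.pi) (σ := -1) (by linarith) (by linarith) le_rfl (by simp) (fun p hp => by
        have := Real.cos_nonpos_of_pi_div_two_le_of_le hp.1 (by linarith [hp.2])
        linarith)
    have hint : ∀ a b : ℝ, IntervalIntegrable
        (fun p : ℝ => m p * Complex.exp (Complex.I * ((n : ℝ) * p - t * Real.cos p)))
        MeasureTheory.volume a b := by
      intro a b
      exact Continuous.intervalIntegrable (by fun_prop) _ _
    have h3 : ‖phaseInt m n t‖ ≤ (6 * B + Real.pi * B') / n := by
      rw [phaseInt, ← intervalIntegral.integral_add_adjacent_intervals (hint 0 (Real.pi / 2))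
        (hint (Real.pi / 2) Real.pi)]
      refine (norm_add_le _ _).trans ((add_le_add h1 h2).trans (le_of_eq ?_))
      ring
    refine h3.trans ?_
    rw [div_le_div_iff₀ hν (by positivity)]
    have h4 : (1 : ℝ) ≤ n := by exact_mod_cast hn
    have h5 : 0 ≤ 6 * B + Real.pi * B' := by positivity
    nlinarith [mul_nonneg h5 (sub_nonneg.2 h4), mul_nonneg (mul_nonneg hpi.le hB0) hν.le]

theorem tendsto_phaseInt (m : ℝ → ℂ) (ν : ℝ) : Tendsto (phaseInt m ν) atTop (𝓝 0) := by
  refine (tendsto_integral_mul_exp_cos fun p => m p * Complex.exp (Complex.I * (ν * p))).congr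
    fun t => ?_
  refine intervalIntegral.integral_congr fun p _ => ?_
  rw [mul_assoc, ← Complex.exp_add]
  ring_nf

theorem tendsto_tsum_phaseInt {m : ℝ → ℂ} (hm : ContDiff ℝ 1 m) :
    Tendsto (fun t : ℝ => ∑' n : ℕ, ‖phaseInt m n t‖ ^ 2) atTop (𝓝 0) := by
  obtain ⟨K, hK, hb⟩ := exists_norm_phaseInt_le hm
  have hs : Summable fun n : ℕ => (K / (n + 1)) ^ 2 := by
    have h1 : Summable fun n : ℕ => 1 / ((n : ℝ)) ^ 2 := Real.summable_one_div_nat_pow.2 (by norm_num)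
    have h2 := ((summable_nat_add_iff 1).2 h1).mul_left (K ^ 2)
    refine h2.congr fun n => ?_
    push_cast
    rw [div_pow]; ring
  have h := tendsto_tsum_of_dominated_convergence (𝓕 := atTop)
    (f := fun (t : ℝ) (n : ℕ) => ‖phaseInt m n t‖ ^ 2) (g := fun _ => (0 : ℝ)) hs ?_ ?_
  · simpa using h
  · intro n
    simpa using (tendsto_phaseInt m n).norm.pow 2
  · filter_upwards [eventually_ge_atTop (0 : ℝ)] with t ht n
    rw [Real.norm_of_nonneg (by positivity)]
    have := hb n t ht
    gcongr

end NonstationaryPhase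

section Propagation

open Filter Topology

theorem siteProj_apply (s : Set ℤ) (f : OneParticle) (x : ℤ) [Decidable (x ∈ s)] :
    siteProj s f x = if x ∈ s then f x else 0 := by
  have h : siteProj s f x = (@ite ℂ (x ∈ s) (Classical.propDecidable _) 1 0) * f x := rfl
  rw [h]
  by_cases hx : x ∈ s <;> simp [hx]

theorem norm_sq_eq_tsum (f : OneParticle) : ‖f‖ ^ 2 = ∑' x, ‖f x‖ ^ 2 := by
  simpa using lp.norm_rpow_eq_tsum (p := 2) (by simp) f

theorem norm_sq_siteProj_range {g : ℕ → ℤ} (hg : Function.Injective g) (f : OneParticle) :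
    ‖siteProj (Set.range g) f‖ ^ 2 = ∑' n, ‖f (g n)‖ ^ 2 := by
  classical
  rw [norm_sq_eq_tsum, ← hg.tsum_eq]
  · simp [siteProj_apply]
  · intro x hx
    by_contra h
    rw [Function.mem_support, siteProj_apply, if_neg h] at hx
    simp at hx

/-- The free evolution of the symbol `m`. -/
def evo (t : ℝ) (m : ℝ → ℂ) (k : ℝ) : ℂ := Complex.exp (-(Complex.I * t) * Real.cos k) * m k

theorem BddMeas.evo {m : ℝ → ℂ} (hm : BddMeas m) (t : ℝ) : BddMeas (evo t m) :=
  (bddMeas_exp_cos _).mul hm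

theorem norm_evo (t : ℝ) (m : ℝ → ℂ) (k : ℝ) : ‖evo t m k‖ = ‖m k‖ := by
  rw [XYImpurity.evo, norm_mul, show -(Complex.I * t) * (Real.cos k : ℂ) =
    ((-(t * Real.cos k) : ℝ) : ℂ) * Complex.I by push_cast; ring, Complex.norm_exp_ofReal_mul_I,
    one_mul]

theorem circ_indicator_Ioi (F : ℝ → ℂ) :
    circ ((Set.Ioi 0).indicator F) = 1 / (2 * Real.pi) * ∫ p in (0 : ℝ)..Real.pi, F p := by
  have hpi := Real.pi_pos
  rw [circ, intervalIntegral.integral_of_le (by linarith), intervalIntegral.integral_of_le hpi.le,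
    MeasureTheory.setIntegral_indicator measurableSet_Ioi]
  congr 3
  ext p
  simp only [Set.mem_inter_iff, Set.mem_Ioc, Set.mem_Ioi]
  constructor
  · rintro ⟨⟨_, h⟩, h'⟩; exact ⟨h', h⟩
  · rintro ⟨h, h'⟩; exact ⟨⟨by linarith, h'⟩, h⟩

theorem contDiff_ofReal {n : WithTop ℕ∞} : ContDiff ℝ n fun k : ℝ => (k : ℂ) :=
  Complex.ofRealCLM.contDiff

theorem contDiff_plane (x : ℤ) : ContDiff ℝ 1 (plane x) :=
  contDiff_const.mul (contDiff_const.mul contDiff_ofReal).cexp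

theorem circ_evo_indicator (m : ℝ → ℂ) (a : ℤ) (n : ℕ) (t : ℝ) :
    (circ fun k => evo t ((Set.Ioi 0).indicator m) k * plane (a + n) k) =
      1 / (2 * Real.pi) * ((-1) ^ (n : ℤ) * phaseInt (fun p => m p * plane a p) n t) := by
  have e : (fun k => evo t ((Set.Ioi 0).indicator m) k * plane (a + n) k) =
      (Set.Ioi 0).indicator fun k => evo t m k * plane (a + n) k := by
    funext k
    simp only [evo, Set.indicator_apply]
    split_ifs <;> simp
  rw [e, circ_indicator_Ioi, phaseInt, ← intervalIntegral.integral_const_mul ((-1 : ℂ) ^ (n : ℤ))]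
  congr 1
  refine intervalIntegral.integral_congr fun p _ => ?_
  simp only [evo]
  rw [plane_add, plane.eq_def (n : ℤ), show Complex.I * (((n : ℝ) : ℂ) * p - t * Real.cos p) =
    -(Complex.I * t) * Real.cos p + Complex.I * ((n : ℤ) : ℂ) * p by push_cast; ring,
    Complex.exp_add]
  ring

theorem tendsto_zero_of_tendsto_norm_sq {E : Type*} [NormedAddCommGroup E] {f : ℝ → E}
    (h : Tendsto (fun t => ‖f t‖ ^ 2) atTop (𝓝 0)) : Tendsto f atTop (𝓝 0) := by
  rw [tendsto_zero_iff_norm_tendsto_zero]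
  have := h.sqrt
  simpa using this

theorem tendsto_tsum_circ {m : ℝ → ℂ} (hm : ContDiff ℝ 1 m) (a : ℤ) :
    Tendsto (fun t : ℝ => ∑' n : ℕ,
      ‖circ fun k => evo t ((Set.Ioi 0).indicator m) k * plane (a + n) k‖ ^ 2) atTop (𝓝 0) := by
  have h := (tendsto_tsum_phaseInt (hm.mul (contDiff_plane a))).const_mul
    (‖(1 / (2 * Real.pi) : ℂ)‖ ^ 2)
  rw [mul_zero] at h
  refine h.congr fun t => ?_
  rw [← tsum_mul_left]
  refine tsum_congr fun n => ?_
  rw [circ_evo_indicator, norm_mul _ ((-1 : ℂ) ^ (n : ℤ) * _), norm_mul ((-1 : ℂ) ^ (n : ℤ)),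
    norm_neg_one_zpow, one_mul, mul_pow]

/-- The left moving wave packets with smooth profile. -/
def LeftMover (m : ℝ → ℂ) : Prop :=
  ∃ m₀, ContDiff ℝ 1 m₀ ∧ BddMeas m₀ ∧ m = (Set.Ioi 0).indicator m₀

/-- The right moving wave packets with smooth profile. -/
def RightMover (m : ℝ → ℂ) : Prop :=
  ∃ m₀, ContDiff ℝ 1 m₀ ∧ BddMeas m₀ ∧ m = (Set.Iio 0).indicator m₀

theorem LeftMover.bddMeas {m : ℝ → ℂ} (h : LeftMover m) : BddMeas m := by
  obtain ⟨m₀, _, h, rfl⟩ := h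
  exact h.indicator measurableSet_Ioi

theorem RightMover.bddMeas {m : ℝ → ℂ} (h : RightMover m) : BddMeas m := by
  obtain ⟨m₀, _, h, rfl⟩ := h
  exact h.indicator measurableSet_Iio

theorem LeftMover.mul {m g : ℝ → ℂ} (h : LeftMover m) (hg : ContDiff ℝ 1 g) (hg' : BddMeas g) :
    LeftMover fun k => g k * m k := by
  obtain ⟨m₀, h1, h2, rfl⟩ := h
  refine ⟨fun k => g k * m₀ k, hg.mul h1, hg'.mul h2, ?_⟩
  funext k
  simp only [Set.indicator_apply]
  split_ifs <;> simp

theorem RightMover.mul {m g : ℝ → ℂ} (h : RightMover m) (hg : ContDiff ℝ 1 g) (hg' : BddMeas g) :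
    RightMover fun k => g k * m k := by
  obtain ⟨m₀, h1, h2, rfl⟩ := h
  refine ⟨fun k => g k * m₀ k, hg.mul h1, hg'.mul h2, ?_⟩
  funext k
  simp only [Set.indicator_apply]
  split_ifs <;> simp

theorem LeftMover.vacates {m : ℝ → ℂ} (h : LeftMover m) (a : ℤ) :
    Tendsto (fun t => siteProj {x | a ≤ x} (fourierVec (evo t m))) atTop (𝓝 0) := by
  have hb := h.bddMeas
  obtain ⟨m₀, h1, h2, rfl⟩ := h
  refine tendsto_zero_of_tendsto_norm_sq ((tendsto_tsum_circ h1 a).congr fun t => ?_)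
  have hr : {x | a ≤ x} = Set.range fun n : ℕ => a + n := by
    ext x
    constructor
    · intro hx
      exact ⟨(x - a).toNat, by have : a ≤ x := hx; simp; omega⟩
    · rintro ⟨n, rfl⟩; simp
  rw [hr, norm_sq_siteProj_range (fun n n' h => by simpa using h)]
  refine tsum_congr fun n => ?_
  rw [fourierVec_apply (hb.evo t)]

theorem RightMover.vacates {m : ℝ → ℂ} (h : RightMover m) (a : ℤ) :
    Tendsto (fun t => siteProj {x | x ≤ a} (fourierVec (evo t m))) atTop (𝓝 0) := by
  have hb := h.bddMeas
  obtain ⟨m₀, h1, h2, rfl⟩ := h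
  have h1' : ContDiff ℝ 1 fun k => m₀ (-k) := h1.comp contDiff_neg
  refine tendsto_zero_of_tendsto_norm_sq ((tendsto_tsum_circ h1' (-a)).congr fun t => ?_)
  have hr : {x | x ≤ a} = Set.range fun n : ℕ => a - n := by
    ext x
    constructor
    · intro hx
      exact ⟨(a - x).toNat, by have : x ≤ a := hx; simp; omega⟩
    · rintro ⟨n, rfl⟩; simp
  rw [hr, norm_sq_siteProj_range (fun n n' h => by simpa using h)]
  refine tsum_congr fun n => ?_
  rw [fourierVec_apply (hb.evo t), ← circ_comp_neg]
  congr 3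
  funext k
  rw [plane_neg_right, show -(-a + (n : ℤ)) = a - n by ring]
  simp only [evo, Real.cos_neg, Set.indicator_apply, Set.mem_Ioi, Set.mem_Iio, neg_pos, neg_neg]

theorem tendsto_absOp_of_leftMover {m : ℝ → ℂ} (h : LeftMover m) :
    Tendsto (fun t => absOp (fourierVec (evo t m))) atTop (𝓝 0) := by
  classical
  have h1 := (absOp.continuous.tendsto 0).comp (h.vacates 0)
  rw [map_zero] at h1
  refine h1.congr fun t => ?_
  ext x
  simp [absOp_apply, siteProj_apply]

theorem adjoint_siteProj (s : Set ℤ) : ContinuousLinearMap.adjoint (siteProj s) = siteProj s := by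
  classical
  symm
  rw [ContinuousLinearMap.eq_adjoint_iff]
  intro f g
  rw [lp.inner_eq_tsum, lp.inner_eq_tsum]
  refine tsum_congr fun x => ?_
  rw [siteProj_apply, siteProj_apply]
  split_ifs <;> simp

theorem adjoint_hXY : ContinuousLinearMap.adjoint hXY = hXY := by
  rw [hXY, ← ContinuousLinearMap.star_eq_adjoint, star_smul, star_add,
    ContinuousLinearMap.star_eq_adjoint, ContinuousLinearMap.star_eq_adjoint,
    ContinuousLinearMap.adjoint_adjoint, add_comm]
  simp

theorem isSelfAdjoint_kInit (βL βR : ℝ) (N : ℕ) : IsSelfAdjoint (kInit βL βR N) := by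
  rw [isSelfAdjoint_iff, kInit, star_add, star_smul, star_smul]
  simp only [ContinuousLinearMap.star_eq_adjoint, ContinuousLinearMap.adjoint_comp,
    adjoint_siteProj, adjoint_hXY, ContinuousLinearMap.comp_assoc]
  simp

theorem isUnit_one_add_exp {A : OneParticle →L[ℂ] OneParticle} (hA : IsSelfAdjoint A) :
    IsUnit (1 + NormedSpace.exp A) := by
  set b := NormedSpace.exp ((1 / 2 : ℂ) • A) with hb
  have hbs : IsSelfAdjoint b := (IsSelfAdjoint.smul (by simp [isSelfAdjoint_iff]) hA).exp
  have hbb : NormedSpace.exp A = b * b := by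
    let _ : NormedAlgebra ℚ (OneParticle →L[ℂ] OneParticle) := .restrictScalars ℚ ℂ _
    rw [hb, ← NormedSpace.exp_add_of_commute (Commute.refl _), ← add_smul]
    norm_num
  refine ContinuousLinearMap.isUnit_of_forall_le_norm_inner_map _ (c := 1) one_pos fun x => ?_
  have h1 : inner ℂ ((1 + NormedSpace.exp A) x) x = ((‖x‖ ^ 2 + ‖b x‖ ^ 2 : ℝ) : ℂ) := by
    have e : (1 + NormedSpace.exp A) x = x + b (b x) := by rw [hbb]; rfl
    have e2 : inner ℂ (b (b x)) x = inner ℂ (b x) (b x) := by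
      rw [← ContinuousLinearMap.adjoint_inner_right, ← ContinuousLinearMap.star_eq_adjoint,
        hbs.star_eq]
    rw [e, inner_add_left, e2, inner_self_eq_norm_sq_to_K, inner_self_eq_norm_sq_to_K]
    push_cast
    rfl
  rw [h1, Complex.norm_real, Real.norm_of_nonneg (by positivity)]
  simp only [NNReal.coe_one, mul_one]
  nlinarith [sq_nonneg ‖b x‖]

theorem sInitMinus_mul (βL βR : ℝ) (N : ℕ) :
    sInitMinus βL βR N * (1 + NormedSpace.exp (-kInit βL βR N)) = 1 :=
  Ring.inverse_mul_cancel _ (isUnit_one_add_exp (isSelfAdjoint_kInit βL βR N).neg)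

end Propagation

section InitialDensity

open Filter Topology

theorem sHatMinus_eq (β k : ℝ) : sHatMinus β k = (1 + Real.exp (β * Real.cos k))⁻¹ := by
  have h : ∀ y : ℝ, (1 - Real.tanh (y / 2)) / 2 = (1 + Real.exp y)⁻¹ := by
    intro y
    have e : Real.exp y = Real.exp (y / 2) * Real.exp (y / 2) := by rw [← Real.exp_add]; ring_nf
    rw [Real.tanh_eq_sinh_div_cosh, Real.sinh_eq, Real.cosh_eq, e, Real.exp_neg]
    have := Real.exp_pos (y / 2)
    field_simp
    ring
  exact h _

theorem sHatMinus_pos (β k : ℝ) : 0 < sHatMinus β k := by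
  rw [sHatMinus_eq]; positivity

theorem sHatMinus_le_one (β k : ℝ) : sHatMinus β k ≤ 1 := by
  rw [sHatMinus_eq]
  exact inv_le_one_of_one_le₀ (by linarith [Real.exp_pos (β * Real.cos k)])

theorem contDiff_sHatMinus (β : ℝ) {n : WithTop ℕ∞} : ContDiff ℝ n (sHatMinus β) := by
  have : sHatMinus β = fun k => (1 + Real.exp (β * Real.cos k))⁻¹ := funext (sHatMinus_eq β)
  rw [this]
  refine ContDiff.inv ?_ fun k => by positivity
  exact contDiff_const.add (contDiff_const.mul Real.contDiff_cos).exp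

theorem bddMeas_sHatMinus (β : ℝ) : BddMeas fun k => (sHatMinus β k : ℂ) := by
  refine ⟨Complex.measurable_ofReal.comp (contDiff_sHatMinus β (n := 1)).continuous.measurable, 1,
    fun k => ?_⟩
  rw [Complex.norm_real, Real.norm_of_nonneg (sHatMinus_pos β k).le]
  exact sHatMinus_le_one β k

theorem contDiff_ofReal_cos {n : WithTop ℕ∞} : ContDiff ℝ n fun k : ℝ => (Real.cos k : ℂ) :=
  contDiff_ofReal.comp Real.contDiff_cos

/-- The evolved wave packet. -/
def packet (t : ℝ) (m : ℝ → ℂ) : OneParticle := fourierVec (evo t m)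

theorem evo_mul (t : ℝ) (g m : ℝ → ℂ) : evo t (fun k => g k * m k) = fun k => g k * evo t m k := by
  funext k
  simp only [evo]
  ring

theorem packet_add {m m' : ℝ → ℂ} (hm : BddMeas m) (hm' : BddMeas m') (t : ℝ) :
    packet t (fun k => m k + m' k) = packet t m + packet t m' := by
  rw [packet, packet, packet, ← fourierVec_add (hm.evo t) (hm'.evo t)]
  congr 1
  funext k
  simp only [evo]
  ring

theorem exists_norm_packet_le {m : ℝ → ℂ} (hm : BddMeas m) : ∃ B, ∀ t, ‖packet t m‖ ≤ B := by
  obtain ⟨B, hB⟩ := hm.2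
  exact ⟨B, fun t => norm_fourierVec_le (hm.evo t) fun k => by rw [norm_evo]; exact hB k⟩

theorem inner_packet {m m' : ℝ → ℂ} (hm : BddMeas m) (hm' : BddMeas m') (t : ℝ) :
    inner ℂ (packet t m) (packet t m') = circ fun k => starRingEnd ℂ (m k) * m' k := by
  rw [packet, packet, inner_fourierVec (hm.evo t) (hm'.evo t)]
  congr 1
  funext k
  have h : starRingEnd ℂ (Complex.exp (-(Complex.I * t) * Real.cos k)) *
      Complex.exp (-(Complex.I * t) * Real.cos k) = 1 := by
    rw [← Complex.exp_conj, ← Complex.exp_add]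
    simp [-Complex.ofReal_cos, Complex.conj_ofReal]
  simp only [evo, map_mul]
  linear_combination (starRingEnd ℂ (m k) * m' k) * h

theorem smul_hXY_packet {m : ℝ → ℂ} (hm : BddMeas m) (z : ℂ) (t : ℝ) :
    (z • hXY) (packet t m) = packet t fun k => -z * Real.cos k * m k := by
  have h := hMag_waveVec 0 (hm.evo t) z
  rw [hMag_zero, waveVec_zero (hm.evo t), waveVec_zero] at h
  · rw [packet, h, packet, evo_mul t fun k => -z * Real.cos k]
  · exact ((BddMeas.const (-z)).mul bddMeas_cos).mul (hm.evo t)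

theorem hasSum_packet_exp {m : ℝ → ℂ} (hm : BddMeas m) (z : ℂ) (t : ℝ) :
    HasSum (fun n : ℕ => ((n.factorial : ℂ)⁻¹) • packet t fun k => (z * Real.cos k) ^ n * m k)
      (packet t fun k => Complex.exp (z * Real.cos k) * m k) := by
  have hp : ∀ n : ℕ, ((-z • hXY) ^ n) (packet t m) =
      packet t fun k => (z * Real.cos k) ^ n * m k := by
    intro n
    induction n with
    | zero => simp
    | succ n ih =>
      rw [pow_succ', mul_apply_eq_comp, ih, smul_hXY_packet
        ((((BddMeas.const z).mul bddMeas_cos).pow n).mul hm)]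
      congr 1
      funext k
      ring
  have h := hasSum_exp_apply (-z • hXY) (packet t m)
  simp only [hp] at h
  convert h using 1
  rw [packet, packet, exp_hXY_fourierVec (hm.evo t), evo_mul t fun k => Complex.exp (z * Real.cos k)]
  simp

theorem RightMover.tendsto_kInit {m : ℝ → ℂ} (h : RightMover m) (βL βR : ℝ) (N : ℕ) :
    Tendsto (fun t => kInit βL βR N (packet t m) - packet t fun k => -βR * Real.cos k * m k) atTop
      (𝓝 0) := by
  classical
  have hb := h.bddMeas
  have hcm : RightMover fun k => -1 * (Real.cos k : ℂ) * m k :=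
    h.mul (contDiff_const.mul contDiff_ofReal_cos) ((BddMeas.const _).mul bddMeas_cos)
  set Q := siteProj {x | x ≤ (N : ℤ)} with hQ
  set PL := siteProj (leftSites N)
  set PR := siteProj (rightSites N)
  have hPQ : ∀ f, PR f = f - Q f := by
    intro f
    ext x
    change siteProj (rightSites N) f x = f x - siteProj {x | x ≤ (N : ℤ)} f x
    rw [siteProj_apply, siteProj_apply]
    by_cases hx : x ≤ N
    · have : x ∉ rightSites N := by simp only [rightSites, Set.mem_ofPred_eq]; omega
      simp [hx, this]
    · have : x ∈ rightSites N := by simp only [rightSites, Set.mem_ofPred_eq]; omega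
      simp [hx, this]
  have e : ∀ t, kInit βL βR N (packet t m) - packet t (fun k => -βR * Real.cos k * m k) =
      (βL : ℂ) • PL (hXY (PL (packet t m))) - (βR : ℂ) • (PR (hXY (Q (packet t m))) +
        Q (packet t fun k => -1 * (Real.cos k : ℂ) * m k)) := by
    intro t
    have h1 := smul_hXY_packet hb βR t
    have h2 := smul_hXY_packet hb 1 t
    rw [one_smul] at h2
    rw [← h1, ← h2]
    change (βL : ℂ) • PL (hXY (PL (packet t m))) + (βR : ℂ) • PR (hXY (PR (packet t m))) -
      (βR : ℂ) • hXY (packet t m) = _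
    rw [hPQ (packet t m), map_sub, map_sub, hPQ (hXY (packet t m))]
    module
  simp only [e]
  have t1 : Tendsto (fun t => PL (packet t m)) atTop (𝓝 0) := h.vacates (-((N : ℤ) + 1))
  have t2 : Tendsto (fun t => Q (packet t m)) atTop (𝓝 0) := h.vacates N
  have t3 : Tendsto (fun t => Q (packet t fun k => -1 * (Real.cos k : ℂ) * m k)) atTop (𝓝 0) :=
    hcm.vacates N
  have t4 := (PL ∘L hXY).continuous.tendsto 0 |>.comp t1
  have t5 := (PR ∘L hXY).continuous.tendsto 0 |>.comp t2
  rw [map_zero] at t4 t5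
  have t6 := (t4.const_smul (βL : ℂ)).sub ((t5.add t3).const_smul (βR : ℂ))
  simpa using t6

theorem LeftMover.tendsto_kInit {m : ℝ → ℂ} (h : LeftMover m) (βL βR : ℝ) (N : ℕ) :
    Tendsto (fun t => kInit βL βR N (packet t m) - packet t fun k => -βL * Real.cos k * m k) atTop
      (𝓝 0) := by
  classical
  have hb := h.bddMeas
  have hcm : LeftMover fun k => -1 * (Real.cos k : ℂ) * m k :=
    h.mul (contDiff_const.mul contDiff_ofReal_cos) ((BddMeas.const _).mul bddMeas_cos)
  set Q := siteProj {x | -(N : ℤ) ≤ x} with hQ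
  set PL := siteProj (leftSites N)
  set PR := siteProj (rightSites N)
  have hPQ : ∀ f, PL f = f - Q f := by
    intro f
    ext x
    change siteProj (leftSites N) f x = f x - siteProj {x | -(N : ℤ) ≤ x} f x
    rw [siteProj_apply, siteProj_apply]
    by_cases hx : -(N : ℤ) ≤ x
    · have : x ∉ leftSites N := by simp only [leftSites, Set.mem_ofPred_eq]; omega
      simp [hx, this]
    · have : x ∈ leftSites N := by simp only [leftSites, Set.mem_ofPred_eq]; omega
      simp [hx, this]
  have e : ∀ t, kInit βL βR N (packet t m) - packet t (fun k => -βL * Real.cos k * m k) =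
      (βR : ℂ) • PR (hXY (PR (packet t m))) - (βL : ℂ) • (PL (hXY (Q (packet t m))) +
        Q (packet t fun k => -1 * (Real.cos k : ℂ) * m k)) := by
    intro t
    have h1 := smul_hXY_packet hb βL t
    have h2 := smul_hXY_packet hb 1 t
    rw [one_smul] at h2
    rw [← h1, ← h2]
    change (βL : ℂ) • PL (hXY (PL (packet t m))) + (βR : ℂ) • PR (hXY (PR (packet t m))) -
      (βL : ℂ) • hXY (packet t m) = _
    rw [hPQ (packet t m), map_sub, map_sub, hPQ (hXY (packet t m))]
    module
  simp only [e]
  have t1 : Tendsto (fun t => PR (packet t m)) atTop (𝓝 0) := h.vacates ((N : ℤ) + 1)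
  have t2 : Tendsto (fun t => Q (packet t m)) atTop (𝓝 0) := h.vacates (-(N : ℤ))
  have t3 : Tendsto (fun t => Q (packet t fun k => -1 * (Real.cos k : ℂ) * m k)) atTop (𝓝 0) :=
    hcm.vacates (-(N : ℤ))
  have t4 := (PR ∘L hXY).continuous.tendsto 0 |>.comp t1
  have t5 := (PL ∘L hXY).continuous.tendsto 0 |>.comp t2
  rw [map_zero] at t4 t5
  have t6 := (t4.const_smul (βR : ℂ)).sub ((t5.add t3).const_smul (βL : ℂ))
  simpa using t6

theorem tendsto_neg_pow_packet {P : (ℝ → ℂ) → Prop} (hP : ∀ m, P m → BddMeas m)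
    (hPm : ∀ m g, P m → ContDiff ℝ 1 g → BddMeas g → P fun k => g k * m k)
    {K : OneParticle →L[ℂ] OneParticle} {β : ℝ}
    (hK : ∀ m, P m → Tendsto (fun t => K (packet t m) - packet t fun k => -β * Real.cos k * m k)
      atTop (𝓝 0))
    (n : ℕ) (m : ℝ → ℂ) (hm : P m) :
    Tendsto (fun t => ((-K) ^ n) (packet t m) - packet t fun k => (β * Real.cos k) ^ n * m k) atTop
      (𝓝 0) := by
  induction n with
  | zero => simp
  | succ n ih =>
    have hg : P fun k => (β * Real.cos k) ^ n * m k :=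
      hPm m _ hm ((contDiff_const.mul contDiff_ofReal_cos).pow n)
        (((BddMeas.const _).mul bddMeas_cos).pow n)
    have h1 := ((-K).continuous.tendsto 0).comp ih
    rw [map_zero] at h1
    have h2 := h1.sub (hK _ hg)
    rw [sub_zero] at h2
    refine h2.congr fun t => ?_
    have hneg : packet t (fun k => (β * Real.cos k) ^ (n + 1) * m k) =
        -packet t fun k => -β * Real.cos k * ((β * Real.cos k) ^ n * m k) := by
      have h3 := smul_hXY_packet (hP _ hg) β t
      have h4 := smul_hXY_packet (hP _ hg) (-β) t
      rw [← h3, ← neg_apply, ← neg_smul, h4]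
      congr 1
      funext k
      ring
    rw [hneg, pow_succ', mul_apply_eq_comp, Function.comp_apply, map_sub]
    simp only [neg_apply]
    abel

theorem tendsto_exp_neg_packet {P : (ℝ → ℂ) → Prop} (hP : ∀ m, P m → BddMeas m)
    (hPm : ∀ m g, P m → ContDiff ℝ 1 g → BddMeas g → P fun k => g k * m k)
    {K : OneParticle →L[ℂ] OneParticle} {β : ℝ}
    (hK : ∀ m, P m → Tendsto (fun t => K (packet t m) - packet t fun k => -β * Real.cos k * m k)
      atTop (𝓝 0))
    (m : ℝ → ℂ) (hm : P m) :
    Tendsto (fun t => NormedSpace.exp (-K) (packet t m) -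
      packet t fun k => Complex.exp (β * Real.cos k) * m k) atTop (𝓝 0) := by
  have hb := hP m hm
  obtain ⟨B, hB⟩ := hb.2
  have hB0 : 0 ≤ B := (norm_nonneg _).trans (hB 0)
  have hcos : ∀ k, ‖(Real.cos k : ℂ)‖ ≤ 1 := fun k => by
    rw [Complex.norm_real]; exact Real.abs_cos_le_one k
  have hbn : ∀ n : ℕ, BddMeas fun k => ((β : ℂ) * Real.cos k) ^ n * m k :=
    fun n => (((BddMeas.const _).mul bddMeas_cos).pow n).mul hb
  have hs : ∀ t, HasSum (fun n : ℕ => ((n.factorial : ℂ)⁻¹) • (((-K) ^ n) (packet t m) -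
      packet t fun k => (β * Real.cos k) ^ n * m k))
      (NormedSpace.exp (-K) (packet t m) - packet t fun k => Complex.exp (β * Real.cos k) * m k) := by
    intro t
    simp only [smul_sub]
    exact (hasSum_exp_apply (-K) (packet t m)).sub (hasSum_packet_exp hb β t)
  have hsum : Summable fun n : ℕ => (‖K‖ ^ n / n.factorial + |β| ^ n / n.factorial) * B :=
    ((Real.summable_pow_div_factorial ‖K‖).add (Real.summable_pow_div_factorial |β|)).mul_right B
  have h := tendsto_tsum_of_dominated_convergence (𝓕 := atTop)
    (f := fun (t : ℝ) (n : ℕ) => ((n.factorial : ℂ)⁻¹) • (((-K) ^ n) (packet t m) -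
      packet t fun k => (β * Real.cos k) ^ n * m k)) (g := fun _ => (0 : OneParticle)) hsum ?_ ?_
  · simpa only [tsum_zero, (hs _).tsum_eq] using h
  · intro n
    simpa using (tendsto_neg_pow_packet hP hPm hK n m hm).const_smul ((n.factorial : ℂ)⁻¹)
  · refine Eventually.of_forall fun t n => ?_
    have h1 : ‖((-K) ^ n) (packet t m)‖ ≤ ‖K‖ ^ n * B := by
      refine ((-K) ^ n).le_of_opNorm_le_of_le ?_
        (norm_fourierVec_le (hb.evo t) fun k => by rw [norm_evo]; exact hB k)
      rcases Nat.eq_zero_or_pos n with rfl | hn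
      · rw [pow_zero, pow_zero]
        exact ContinuousLinearMap.norm_id_le
      · simpa using norm_pow_le' (-K) hn
    have h2 : ‖packet t fun k => (β * Real.cos k) ^ n * m k‖ ≤ |β| ^ n * B := by
      refine norm_fourierVec_le ((hbn n).evo t) fun k => ?_
      rw [norm_evo, norm_mul, norm_pow, norm_mul, Complex.norm_real, Real.norm_eq_abs]
      calc (|β| * ‖(Real.cos k : ℂ)‖) ^ n * ‖m k‖ ≤ (|β| * 1) ^ n * B := by
            gcongr
            · exact hcos k
            · exact hB k
        _ = _ := by rw [mul_one]
    rw [norm_smul, norm_inv, Complex.norm_natCast]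
    calc ((n.factorial : ℝ))⁻¹ * ‖((-K) ^ n) (packet t m) -
          packet t fun k => (β * Real.cos k) ^ n * m k‖
        ≤ ((n.factorial : ℝ))⁻¹ * (‖K‖ ^ n * B + |β| ^ n * B) := by
          gcongr
          exact (norm_sub_le _ _).trans (add_le_add h1 h2)
      _ = _ := by ring

theorem tendsto_inverse_packet {P : (ℝ → ℂ) → Prop} (hP : ∀ m, P m → BddMeas m)
    (hPm : ∀ m g, P m → ContDiff ℝ 1 g → BddMeas g → P fun k => g k * m k)
    {K : OneParticle →L[ℂ] OneParticle} {β : ℝ}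
    (hK : ∀ m, P m → Tendsto (fun t => K (packet t m) - packet t fun k => -β * Real.cos k * m k)
      atTop (𝓝 0))
    {s : OneParticle →L[ℂ] OneParticle}
    (hs : s * (1 + NormedSpace.exp (-K)) = 1) (m : ℝ → ℂ) (hm : P m) :
    Tendsto (fun t => s (packet t m) - packet t fun k => sHatMinus β k * m k) atTop (𝓝 0) := by
  have hg : P fun k => (sHatMinus β k : ℂ) * m k :=
    hPm m _ hm (contDiff_ofReal.comp (contDiff_sHatMinus β)) (bddMeas_sHatMinus β)
  have h1 := (s.continuous.tendsto 0).comp (tendsto_exp_neg_packet hP hPm hK _ hg)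
  rw [map_zero] at h1
  have h2 := h1.neg
  rw [neg_zero] at h2
  refine h2.congr fun t => ?_
  have e : packet t m = (packet t fun k => (sHatMinus β k : ℂ) * m k) +
      packet t fun k => Complex.exp (β * Real.cos k) * ((sHatMinus β k : ℂ) * m k) := by
    rw [← packet_add (hP _ hg) ((bddMeas_exp_cos _).mul (hP _ hg))]
    congr 1
    funext k
    have : (sHatMinus β k : ℂ) * (1 + Complex.exp (β * Real.cos k)) = 1 := by
      have h : sHatMinus β k * (1 + Real.exp (β * Real.cos k)) = 1 := by
        rw [sHatMinus_eq]
        exact inv_mul_cancel₀ (by positivity)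
      exact_mod_cast h
    linear_combination (-m k) * this
  have hs' : ∀ v, s v + s (NormedSpace.exp (-K) v) = v := by
    intro v
    have := congrArg (fun A : OneParticle →L[ℂ] OneParticle => A v) hs
    simpa [mul_add] using this
  have h3 := hs' (packet t fun k => (sHatMinus β k : ℂ) * m k)
  have key : ∀ a b c d : OneParticle, a + b = d → -(b - c) = a + c - d := by
    rintro a b c d rfl
    abel
  rw [Function.comp_apply, map_sub, e, map_add]
  exact key _ _ _ _ h3

theorem RightMover.tendsto_sInitMinus {m : ℝ → ℂ} (h : RightMover m) (βL βR : ℝ) (N : ℕ) :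
    Tendsto (fun t => sInitMinus βL βR N (packet t m) - packet t fun k => sHatMinus βR k * m k)
      atTop (𝓝 0) :=
  tendsto_inverse_packet (fun _ h => h.bddMeas) (fun _ _ h hg hg' => h.mul hg hg')
    (fun _ h => h.tendsto_kInit βL βR N) (sInitMinus_mul βL βR N) m h

theorem LeftMover.tendsto_sInitMinus {m : ℝ → ℂ} (h : LeftMover m) (βL βR : ℝ) (N : ℕ) :
    Tendsto (fun t => sInitMinus βL βR N (packet t m) - packet t fun k => sHatMinus βL k * m k)
      atTop (𝓝 0) :=
  tendsto_inverse_packet (fun _ h => h.bddMeas) (fun _ _ h hg hg' => h.mul hg hg')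
    (fun _ h => h.tendsto_kInit βL βR N) (sInitMinus_mul βL βR N) m h

end InitialDensity

section Completeness

open Filter Topology

theorem eq_pow_mul_of_bounded_recurrence {u : ℕ → ℂ} {c ρ : ℝ}
    (hu : ∀ n, u (n + 2) = u n - 2 * c * u (n + 1)) (hρ : ρ ^ 2 + 2 * c * ρ = 1) (hρ1 : |ρ| < 1)
    {B : ℝ} (hB : ∀ n, ‖u n‖ ≤ B) (n : ℕ) : u n = ρ ^ n * u 0 := by
  have hρ' : (ρ : ℂ) ^ 2 + 2 * c * ρ = 1 := by exact_mod_cast hρ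
  set s : ℕ → ℂ := fun n => u (n + 1) - ρ * u n with hs
  have hB0 : 0 ≤ B := (norm_nonneg _).trans (hB 0)
  have hstep : ∀ n, s n = -ρ * s (n + 1) := by
    intro n
    simp only [hs, hu]
    linear_combination (-u (n + 1)) * hρ'
  have hpow : ∀ n k, s n = (-ρ) ^ k * s (n + k) := by
    intro n k
    induction k with
    | zero => simp
    | succ k ih => rw [ih, hstep (n + k), ← add_assoc, pow_succ]; ring
  have hsB : ∀ n, ‖s n‖ ≤ B + 1 * B := by
    intro n
    refine (norm_sub_le _ _).trans (add_le_add (hB _) ?_)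
    rw [norm_mul, Complex.norm_real]
    exact mul_le_mul hρ1.le (hB n) (norm_nonneg _) zero_le_one
  have hs0 : ∀ n, s n = 0 := by
    intro n
    have h1 : Tendsto (fun k : ℕ => |ρ| ^ k * (B + 1 * B)) atTop (𝓝 0) := by
      simpa using (tendsto_pow_atTop_nhds_zero_of_lt_one (abs_nonneg ρ) hρ1).mul_const (B + 1 * B)
    have h2 : ‖s n‖ ≤ 0 := by
      refine ge_of_tendsto' h1 fun k => ?_
      rw [hpow n k, norm_mul, norm_pow, norm_neg, Complex.norm_real, Real.norm_eq_abs]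
      exact mul_le_mul_of_nonneg_left (hsB _) (by positivity)
    exact norm_le_zero_iff.1 h2
  induction n with
  | zero => simp
  | succ n ih =>
    have := hs0 n
    simp only [hs, sub_eq_zero] at this
    rw [this, ih]; ring

theorem circ_plane (x : ℤ) : circ (plane x) = if x = 0 then 1 else 0 := by
  have hpi : (Real.pi : ℂ) ≠ 0 := by exact_mod_cast Real.pi_ne_zero
  split_ifs with hx
  · subst hx
    have : plane 0 = fun _ => 1 := funext plane_zero
    rw [this, circ, intervalIntegral.integral_const]
    simp
    field_simp
    norm_num
  · rw [circ]
    have hc : Complex.I * (x : ℂ) ≠ 0 := mul_ne_zero Complex.I_ne_zero (by exact_mod_cast hx)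
    simp only [plane]
    rw [intervalIntegral.integral_const_mul, integral_exp_mul_complex hc]
    have : Complex.exp (Complex.I * x * Real.pi) = Complex.exp (Complex.I * x * (-Real.pi : ℝ)) := by
      rw [Complex.exp_eq_exp_iff_exists_int]
      exact ⟨x, by push_cast; ring⟩
    rw [this]
    simp

theorem conj_scatC (κ p : ℝ) : starRingEnd ℂ (scatC κ p) = scatC κ (-p) := by
  simp [scatC, Complex.conj_ofReal, -Complex.ofReal_sin]

theorem scatC_unitary (κ p : ℝ) :
    scatC κ p + scatC κ (-p) + 2 * (scatC κ p * scatC κ (-p)) = 0 := by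
  by_cases hκ : κ = 0
  · simp [hκ, scatC_zero]
  have h : ∀ q : ℝ, (κ : ℂ) - Complex.I * Real.sin q ≠ 0 := by
    intro q h
    exact hκ (by simpa using congrArg Complex.re h)
  have h1 := scatC_mul κ p
  have h2 := scatC_mul κ (-p)
  have n1 := h p
  have n2 := h (-p)
  rw [Real.sin_neg, Complex.ofReal_neg] at h2 n2
  refine mul_left_cancel₀ (mul_ne_zero n1 n2) ?_
  linear_combination ((κ : ℂ) - Complex.I * -Real.sin p + 2 * (((κ : ℂ) - Complex.I * -Real.sin p) *
    scatC κ (-p))) * h1 + ((κ : ℂ) - Complex.I * Real.sin p - 2 * κ) * h2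

theorem plane_one_sub_neg_one (k : ℝ) : plane 1 k - plane (-1) k = -2 * (Complex.I * Real.sin k) := by
  rw [← plane_neg_right, plane_one, plane_one, Real.sin_neg, Real.cos_neg]
  push_cast
  ring

theorem eB_sq (κ : ℝ) : eB κ ^ 2 = 1 + κ ^ 2 := Real.sq_sqrt (by positivity)

theorem eB_pos (κ : ℝ) : 0 < eB κ := Real.sqrt_pos.2 (by positivity)

theorem exp_lamB {κ : ℝ} (hκ : 0 < κ) : Real.exp (lamB κ) = κ + eB κ :=
  Real.exp_log (add_pos hκ (eB_pos κ))

theorem exp_neg_lamB {κ : ℝ} (hκ : 0 < κ) : Real.exp (-lamB κ) = eB κ - κ := by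
  rw [Real.exp_neg, exp_lamB hκ]
  refine inv_eq_of_mul_eq_one_right ?_
  linear_combination eB_sq κ

/-- The staggered Fourier coefficients of the scattering amplitude. -/
def scatCoeff (κ : ℝ) (x : ℤ) : ℂ := circ fun k => scatC κ k * plane x k

theorem scatCoeff_rec (κ : ℝ) (x : ℤ) :
    κ * scatCoeff κ x + 1 / 2 * (scatCoeff κ (x + 1) - scatCoeff κ (x - 1)) =
      if x = 0 then -(κ : ℂ) else 0 := by
  have hb : ∀ y, BddMeas fun k => scatC κ k * plane y k :=
    fun y => (bddMeas_scatC κ).mul (bddMeas_plane y)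
  have e : ∀ k, -(κ : ℂ) * plane x k = κ * (scatC κ k * plane x k) +
      1 / 2 * (scatC κ k * plane (x + 1) k - scatC κ k * plane (x - 1) k) := by
    intro k
    have h1 := plane_one_sub_neg_one k
    have h2 := scatC_mul κ k
    rw [sub_eq_add_neg x, plane_add, plane_add]
    linear_combination (-plane x k) * h2 - (1 / 2) * scatC κ k * plane x k * h1
  have h := congrArg circ (funext e)
  rw [circ_const_mul, circ_add ((BddMeas.const _).mul (hb _))
    ((BddMeas.const _).mul ((hb _).sub (hb _))), circ_const_mul, circ_const_mul,
    circ_sub (hb _) (hb _), circ_plane] at h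
  simp only [scatCoeff]
  rw [← h]
  split_ifs <;> simp

theorem scatCoeff_nat {κ : ℝ} (hκ : 0 < κ) (n : ℕ) :
    scatCoeff κ n = -((κ / eB κ * Real.exp (-lamB κ) ^ n : ℝ) : ℂ) := by
  set ρ := Real.exp (-lamB κ) with hρ
  have hρe : ρ = eB κ - κ := exp_neg_lamB hκ
  have he := eB_sq κ
  have he0 := eB_pos κ
  have hρ0 : 0 < ρ := Real.exp_pos _
  have hρ1 : ρ < 1 := by
    have : 1 < κ + eB κ := by nlinarith
    rw [hρ, Real.exp_neg, exp_lamB hκ]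
    exact inv_lt_one_of_one_lt₀ this
  have hq : ρ ^ 2 + 2 * κ * ρ = 1 := by rw [hρe]; linear_combination he
  have hbd : ∀ x, ‖scatCoeff κ x‖ ≤ 1 := fun x => norm_circ_le fun k => by
    rw [norm_mul, norm_plane, mul_one]; exact norm_scatC_le κ k
  have hpos := eq_pow_mul_of_bounded_recurrence (u := fun n : ℕ => scatCoeff κ n) (c := κ)
    (fun n => by
      have h := scatCoeff_rec κ (n + 1)
      rw [if_neg (by omega), add_sub_cancel_right, add_assoc, one_add_one_eq_two] at h
      push_cast
      linear_combination 2 * h) hq (by rw [abs_of_pos hρ0]; exact hρ1) (fun n => hbd n)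
  have hneg := eq_pow_mul_of_bounded_recurrence (u := fun n : ℕ => scatCoeff κ (-(n : ℤ)))
    (c := -κ) (ρ := -ρ)
    (fun n => by
      have h := scatCoeff_rec κ (-(n + 1))
      rw [if_neg (by omega), show -((n : ℤ) + 1) + 1 = -n by ring,
        show -((n : ℤ) + 1) - 1 = -(n + 2) by ring] at h
      push_cast
      linear_combination (-2) * h)
    (by linear_combination hq) (by rw [abs_neg, abs_of_pos hρ0]; exact hρ1) (fun n => hbd _)
  have h0 := scatCoeff_rec κ 0
  have hp1 := hpos 1
  have hn1 := hneg 1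
  simp only [Nat.cast_one, Nat.cast_zero, pow_one, neg_zero, zero_add, zero_sub, if_true] at h0 hp1 hn1
  have h2 : (eB κ : ℂ) * scatCoeff κ 0 = -κ := by
    have : (ρ : ℂ) = eB κ - κ := by rw [hρe]; push_cast; ring
    push_cast at hn1
    linear_combination h0 - (1 / 2) * hp1 + (1 / 2) * hn1 - scatCoeff κ 0 * this
  have h3 : scatCoeff κ 0 = -((κ / eB κ : ℝ) : ℂ) := by
    have he0' : (eB κ : ℂ) ≠ 0 := by exact_mod_cast he0.ne'
    refine mul_left_cancel₀ he0' ?_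
    rw [h2]; push_cast; field_simp
  have := hpos n
  simp only [Nat.cast_zero] at this
  rw [this, h3]
  push_cast
  ring

theorem boundState_apply (κ : ℝ) (hκ : 0 < κ) (x : ℤ) :
    boundState κ hκ x = (((nB κ)⁻¹ * Real.exp (-lamB κ * |(x : ℝ)|) : ℝ) : ℂ) := rfl

theorem boundState_apply' (κ : ℝ) (hκ : 0 < κ) (x : ℤ) :
    boundState κ hκ x = (((nB κ)⁻¹ * Real.exp (-lamB κ) ^ x.natAbs : ℝ) : ℂ) := by
  rw [boundState_apply, ← Real.exp_nat_mul, Nat.cast_natAbs, Int.cast_abs, mul_comm (-lamB κ)]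

theorem boundState_mul (κ : ℝ) (hκ : 0 < κ) (x y : ℤ) :
    boundState κ hκ x * boundState κ hκ y = -scatCoeff κ (|x| + |y|) := by
  have hn : (nB κ)⁻¹ * (nB κ)⁻¹ = κ / eB κ := by
    have : 0 ≤ eB κ / κ := (div_pos (eB_pos κ) hκ).le
    rw [nB, ← mul_inv, Real.mul_self_sqrt this, inv_div]
  have hxy : |x| + |y| = ((x.natAbs + y.natAbs : ℕ) : ℤ) := by push_cast; simp
  rw [hxy, scatCoeff_nat hκ, boundState_apply', boundState_apply', ← Complex.ofReal_mul, neg_neg,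
    ← hn, pow_add]
  congr 1
  ring

theorem hMag_boundState (κ : ℝ) (hκ : 0 < κ) :
    hMag κ (boundState κ hκ) = (eB κ : ℂ) • boundState κ hκ := by
  have hρe := exp_neg_lamB hκ
  have he := eB_sq κ
  set ρ := Real.exp (-lamB κ) with hρ
  have key : ∀ n : ℕ, 1 / 2 * (ρ ^ (n + 2) + ρ ^ n) = eB κ * ρ ^ (n + 1) := by
    intro n
    have hq : ρ ^ 2 + 1 = 2 * eB κ * ρ := by rw [hρe]; linear_combination (-1 : ℝ) * he
    linear_combination (1 / 2) * ρ ^ n * hq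
  ext x
  change hMag κ (boundState κ hκ) x = (eB κ : ℂ) * boundState κ hκ x
  rw [hMag_apply]
  simp only [boundState_apply', ← hρ]
  rcases lt_trichotomy x 0 with hx | hx | hx
  · obtain ⟨n, rfl⟩ : ∃ n : ℕ, x = -((n : ℤ) + 1) := ⟨(-x - 1).toNat, by omega⟩
    have e1 : (-((n : ℤ) + 1) + 1).natAbs = n := by omega
    have e2 : (-((n : ℤ) + 1) - 1).natAbs = n + 2 := by omega
    have e3 : (-((n : ℤ) + 1)).natAbs = n + 1 := by omega
    rw [if_neg hx.ne, e1, e2, e3, add_zero]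
    have hk := congrArg Complex.ofReal (key n)
    push_cast at hk ⊢
    linear_combination (nB κ : ℂ)⁻¹ * hk
  · subst hx
    have e1 : ((0 : ℤ) + 1).natAbs = 1 := rfl
    have e2 : ((0 : ℤ) - 1).natAbs = 1 := rfl
    rw [if_pos rfl, e1, e2, Int.natAbs_zero]
    have hk : (ρ : ℂ) = eB κ - κ := by exact_mod_cast hρe
    push_cast
    linear_combination (nB κ : ℂ)⁻¹ * hk
  · obtain ⟨n, rfl⟩ : ∃ n : ℕ, x = (n : ℤ) + 1 := ⟨(x - 1).toNat, by omega⟩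
    have e1 : ((n : ℤ) + 1 + 1).natAbs = n + 2 := by omega
    have e2 : ((n : ℤ) + 1 - 1).natAbs = n := by omega
    have e3 : ((n : ℤ) + 1).natAbs = n + 1 := by omega
    rw [if_neg hx.ne', e1, e2, e3, add_zero]
    have hk := congrArg Complex.ofReal (key n)
    push_cast at hk ⊢
    linear_combination (nB κ : ℂ)⁻¹ * hk

theorem conj_wave (κ : ℝ) (y : ℤ) (k : ℝ) :
    starRingEnd ℂ (wave κ y k) = plane (-y) k + scatC κ (-|k|) * plane (-|y|) |k| := by
  rw [wave, map_add, map_mul, conj_scatC, plane_neg, plane_neg]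

theorem wave_mul_conj_add_of_nonneg {κ : ℝ} {x y : ℤ} (hx : 0 ≤ x) (hy : 0 ≤ y) {k : ℝ} (hk : 0 < k) :
    wave κ x k * starRingEnd ℂ (wave κ y k) =
        (1 + scatC κ k) * (1 + scatC κ (-k)) * plane (x - y) k ∧
      wave κ x (-k) * starRingEnd ℂ (wave κ y (-k)) =
        plane (-(x - y)) k + scatC κ k * scatC κ (-k) * plane (x - y) k +
          (scatC κ k * plane (x + y) k + scatC κ (-k) * plane (-(x + y)) k) := by
  simp only [conj_wave]
  simp only [wave, abs_neg, abs_of_pos hk, abs_of_nonneg hx, abs_of_nonneg hy,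
    plane_neg_right, neg_neg, sub_eq_add_neg, neg_add, plane_add]
  constructor <;> ring

theorem wave_mul_conj_add_of_nonneg_of_nonpos {κ : ℝ} {x y : ℤ} (hx : 0 ≤ x) (hy : y ≤ 0) {k : ℝ}
    (hk : 0 < k) :
    wave κ x k * starRingEnd ℂ (wave κ y k) + wave κ x (-k) * starRingEnd ℂ (wave κ y (-k)) =
      (1 + scatC κ k) * plane (x - y) k + (1 + scatC κ (-k)) * plane (-(x - y)) k := by
  have h := scatC_unitary κ k
  simp only [conj_wave]
  simp only [wave, abs_neg, abs_of_pos hk, abs_of_nonneg hx, abs_of_nonpos hy,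
    plane_neg_right, neg_neg, sub_eq_add_neg, neg_add, plane_add]
  linear_combination (plane x k * plane y k) * h

theorem bddMeas_wave_mul_conj (κ : ℝ) (x y : ℤ) :
    BddMeas fun k => wave κ x k * starRingEnd ℂ (wave κ y k) :=
  (bddMeas_wave κ x).mul (bddMeas_wave κ y).conj

theorem wave_neg (κ : ℝ) (x : ℤ) (k : ℝ) : wave κ (-x) (-k) = wave κ x k := by
  simp [wave, plane_neg_right]

theorem circ_wave_mul_conj_neg (κ : ℝ) (x y : ℤ) :
    (circ fun k => wave κ (-x) k * starRingEnd ℂ (wave κ (-y) k)) =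
      circ fun k => wave κ x k * starRingEnd ℂ (wave κ y k) := by
  rw [← circ_comp_neg]
  simp only [wave_neg]

theorem circ_wave_mul_conj_of_nonneg (κ : ℝ) {x : ℤ} (hx : 0 ≤ x) (y : ℤ) :
    (circ fun k => wave κ x k * starRingEnd ℂ (wave κ y k)) =
      (if x = y then 1 else 0) + scatCoeff κ (|x| + |y|) := by
  have hp : ∀ z, BddMeas fun k => scatC κ k * plane z k :=
    fun z => (bddMeas_scatC κ).mul (bddMeas_plane z)
  have e : (if x = y then (1 : ℂ) else 0) + scatCoeff κ (|x| + |y|) =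
      circ fun k => plane (x - y) k + scatC κ k * plane (|x| + |y|) k := by
    rw [circ_add (bddMeas_plane _) (hp _), circ_plane]
    simp only [sub_eq_zero]
    rfl
  rw [e, circ_eq_circ_indicator (bddMeas_wave_mul_conj κ x y),
    circ_eq_circ_indicator ((bddMeas_plane _).add (hp _))]
  congr 1
  funext k
  simp only [Set.indicator_apply, Set.mem_Ioi]
  split_ifs with hk
  · rcases le_total 0 y with hy | hy
    · have h := wave_mul_conj_add_of_nonneg (κ := κ) hx hy hk
      rw [h.1, h.2, abs_of_nonneg hx, abs_of_nonneg hy, plane_neg_right, plane_neg_right]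
      linear_combination plane (x - y) k * scatC_unitary κ k
    · rw [wave_mul_conj_add_of_nonneg_of_nonpos hx hy hk, abs_of_nonneg hx, abs_of_nonpos hy,
        plane_neg_right, plane_neg_right, ← sub_eq_add_neg]
      ring
  · rfl

theorem circ_wave_mul_conj (κ : ℝ) (x y : ℤ) :
    (circ fun k => wave κ x k * starRingEnd ℂ (wave κ y k)) =
      (if x = y then 1 else 0) + scatCoeff κ (|x| + |y|) := by
  rcases le_total 0 x with hx | hx
  · exact circ_wave_mul_conj_of_nonneg κ hx y
  · rw [← circ_wave_mul_conj_neg, circ_wave_mul_conj_of_nonneg κ (by omega), abs_neg, abs_neg]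
    simp

/-- The decomposition of a site into its bound and its scattering part. -/
theorem delta_eq_add (κ : ℝ) (hκ : 0 < κ) (y : ℤ) :
    delta y = boundState κ hκ y • boundState κ hκ +
      waveVec κ fun k => starRingEnd ℂ (wave κ y k) := by
  ext x
  have h : (boundState κ hκ y • boundState κ hκ +
      waveVec κ fun k => starRingEnd ℂ (wave κ y k)) x =
      boundState κ hκ y * boundState κ hκ x +
        (waveVec κ fun k => starRingEnd ℂ (wave κ y k)) x := rfl
  rw [h, waveVec_apply κ (bddMeas_wave κ y).conj, boundState_mul, delta_apply]
  simp only [mul_comm (starRingEnd ℂ _)]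
  rw [circ_wave_mul_conj, add_comm |y|]
  ring

end Completeness

section LongTime

open Filter Topology

theorem tendsto_inner_of_tendsto_apply {p : ℝ → OneParticle} {B : ℝ} (hB : ∀ t, ‖p t‖ ≤ B)
    (hp : ∀ x, Tendsto (fun t => p t x) atTop (𝓝 0)) (v : OneParticle) :
    Tendsto (fun t => inner ℂ v (p t)) atTop (𝓝 0) := by
  have hB0 : 0 ≤ B := (norm_nonneg _).trans (hB 0)
  rw [Metric.tendsto_atTop]
  intro ε hε
  have hs := lp.hasSum_single (p := 2) (by simp) v
  obtain ⟨F, hF⟩ := (hs.eventually (Metric.ball_mem_nhds v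
    (ε := ε / (2 * (B + 1))) (by positivity))).exists
  set w := ∑ x ∈ F, lp.single 2 x (v x) with hw
  have h1 : Tendsto (fun t => inner ℂ w (p t)) atTop (𝓝 0) := by
    have h2 : ∀ t, inner ℂ w (p t) = ∑ x ∈ F, starRingEnd ℂ (v x) * p t x := by
      intro t
      rw [hw, sum_inner]
      refine Finset.sum_congr rfl fun x _ => ?_
      rw [lp.inner_single_left]
      simp [mul_comm]
    simp only [h2]
    simpa using tendsto_finsetSum F fun x _ => (hp x).const_mul (starRingEnd ℂ (v x))
  obtain ⟨T, hT⟩ := Metric.tendsto_atTop.1 h1 (ε / 2) (by positivity)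
  refine ⟨T, fun t ht => ?_⟩
  have h3 := hT t ht
  rw [dist_zero_right] at h3 ⊢
  have hF' : ‖v - w‖ < ε / (2 * (B + 1)) := by
    rw [← dist_eq_norm, dist_comm]; exact hF
  have h4 : ‖inner ℂ (v - w) (p t)‖ ≤ ε / 2 := by
    refine (norm_inner_le_norm _ _).trans ?_
    calc ‖v - w‖ * ‖p t‖ ≤ ε / (2 * (B + 1)) * (B + 1) := by
          gcongr
          exact (hB t).trans (by linarith)
      _ = ε / 2 := by field_simp
  calc ‖inner ℂ v (p t)‖ = ‖inner ℂ (v - w) (p t) + inner ℂ w (p t)‖ := by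
        rw [← inner_add_left, sub_add_cancel]
    _ ≤ _ := norm_add_le _ _
    _ < ε / 2 + ε / 2 := add_lt_add_of_le_of_lt h4 h3
    _ = ε := add_halves ε

theorem tendsto_inner_sub {a a' b b' : ℝ → OneParticle} {A B : ℝ} (ha : ∀ t, ‖a' t‖ ≤ A)
    (hb : ∀ t, ‖b' t‖ ≤ B) (haa : Tendsto (fun t => a t - a' t) atTop (𝓝 0))
    (hbb : Tendsto (fun t => b t - b' t) atTop (𝓝 0)) :
    Tendsto (fun t => inner ℂ (a t) (b t) - inner ℂ (a' t) (b' t)) atTop (𝓝 0) := by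
  have h1 : Tendsto (fun t => inner ℂ (a t - a' t) (b t - b' t)) atTop (𝓝 (0 : ℂ)) := by
    have := haa.inner (𝕜 := ℂ) hbb
    rw [inner_zero_left] at this
    exact this
  have h2 : Tendsto (fun t => inner ℂ (a t - a' t) (b' t)) atTop (𝓝 (0 : ℂ)) := by
    refine squeeze_zero_norm (a := fun t => ‖a t - a' t‖ * B) (fun t => ?_) ?_
    · exact (norm_inner_le_norm _ _).trans (mul_le_mul_of_nonneg_left (hb t) (norm_nonneg _))
    · simpa using haa.norm.mul_const B
  have h3 : Tendsto (fun t => inner ℂ (a' t) (b t - b' t)) atTop (𝓝 (0 : ℂ)) := by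
    refine squeeze_zero_norm (a := fun t => A * ‖b t - b' t‖) (fun t => ?_) ?_
    · exact (norm_inner_le_norm _ _).trans (mul_le_mul_of_nonneg_right (ha t) (norm_nonneg _))
    · simpa using hbb.norm.const_mul A
  have h4 := (h1.add h2).add h3
  rw [add_zero, add_zero] at h4
  refine h4.congr fun t => ?_
  simp only [inner_sub_left, inner_sub_right]
  ring

theorem RightMover.tendsto_packet_apply {m : ℝ → ℂ} (h : RightMover m) (x : ℤ) :
    Tendsto (fun t => packet t m x) atTop (𝓝 0) := by
  classical
  refine squeeze_zero_norm (fun t => ?_) (by simpa using (h.vacates x).norm)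
  have := lp.norm_apply_le_norm (p := 2) (by simp) (siteProj {y | y ≤ x} (fourierVec (evo t m))) x
  rw [siteProj_apply, if_pos (show x ∈ {y | y ≤ x} from le_refl x)] at this
  exact this

theorem LeftMover.tendsto_packet_apply {m : ℝ → ℂ} (h : LeftMover m) (x : ℤ) :
    Tendsto (fun t => packet t m x) atTop (𝓝 0) := by
  classical
  refine squeeze_zero_norm (fun t => ?_) (by simpa using (h.vacates x).norm)
  have := lp.norm_apply_le_norm (p := 2) (by simp) (siteProj {y | x ≤ y} (fourierVec (evo t m))) x
  rw [siteProj_apply, if_pos (show x ∈ {y | x ≤ y} from le_refl x)] at this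
  exact this

theorem fourierVec_congr {m m' : ℝ → ℂ} (hm : BddMeas m) (hm' : BddMeas m')
    (h : ∀ k, -Real.pi < k → k < Real.pi → k ≠ 0 → m k = m' k) : fourierVec m = fourierVec m' := by
  ext x
  rw [fourierVec_apply hm, fourierVec_apply hm']
  exact circ_congr fun k h1 h2 h3 => by rw [h k h1 h2 h3]

theorem packet_congr {m m' : ℝ → ℂ} (hm : BddMeas m) (hm' : BddMeas m')
    (h : ∀ k, -Real.pi < k → k < Real.pi → k ≠ 0 → m k = m' k) (t : ℝ) :
    packet t m = packet t m' :=
  fourierVec_congr (hm.evo t) (hm'.evo t) fun k h1 h2 h3 => by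
    simp only [evo, h k h1 h2 h3]

theorem contDiff_scatC {κ : ℝ} (hκ : 0 < κ) {n : WithTop ℕ∞} : ContDiff ℝ n (scatC κ) := by
  have h : ∀ q : ℝ, (κ : ℂ) - Complex.I * Real.sin q ≠ 0 := by
    intro q h
    exact hκ.ne' (by simpa using congrArg Complex.re h)
  have h1 : ContDiff ℝ n fun q : ℝ => -(κ : ℂ) * ((κ : ℂ) - Complex.I * Real.sin q)⁻¹ :=
    contDiff_const.mul (ContDiff.inv (contDiff_const.sub (contDiff_const.mul
      (contDiff_ofReal.comp Real.contDiff_sin))) h)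
  exact h1

/-- The conjugate scattering wave at the site `y`. -/
def conjWave (κ : ℝ) (y : ℤ) (k : ℝ) : ℂ := starRingEnd ℂ (wave κ y k)

theorem bddMeas_conjWave (κ : ℝ) (y : ℤ) : BddMeas (conjWave κ y) := (bddMeas_wave κ y).conj

theorem rightMover_conjWave {κ : ℝ} (hκ : 0 < κ) (y : ℤ) :
    RightMover ((Set.Iio 0).indicator (conjWave κ y)) := by
  refine ⟨fun k => plane (-y) k + scatC κ k * plane |y| k,
    (contDiff_plane _).add ((contDiff_scatC hκ).mul (contDiff_plane _)),
    (bddMeas_plane _).add ((bddMeas_scatC κ).mul (bddMeas_plane _)), ?_⟩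
  funext k
  simp only [Set.indicator_apply, Set.mem_Iio, conjWave, conj_wave]
  split_ifs with hk
  · rw [abs_of_neg hk, plane_neg_right, neg_neg, neg_neg]
  · rfl

theorem leftMover_conjWave {κ : ℝ} (hκ : 0 < κ) (y : ℤ) :
    LeftMover ((Set.Ioi 0).indicator (conjWave κ y)) := by
  refine ⟨fun k => plane (-y) k + scatC κ (-k) * plane (-|y|) k,
    (contDiff_plane _).add (((contDiff_scatC hκ).comp contDiff_neg).mul (contDiff_plane _)),
    (bddMeas_plane _).add (((bddMeas_scatC κ).comp measurable_neg).mul (bddMeas_plane _)), ?_⟩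
  funext k
  simp only [Set.indicator_apply, Set.mem_Ioi, conjWave, conj_wave]
  split_ifs with hk
  · rw [abs_of_pos hk]
  · rfl

theorem leftMover_scatSymbol_conjWave {κ : ℝ} (hκ : 0 < κ) (y : ℤ) :
    LeftMover (scatSymbol κ (conjWave κ y)) := by
  have hc : ContDiff ℝ 1 fun k => scatC κ (-k) := (contDiff_scatC hκ).comp contDiff_neg
  have hb : BddMeas fun k => scatC κ (-k) := (bddMeas_scatC κ).comp measurable_neg
  refine ⟨fun k => scatC κ k * ((plane (-y) k + scatC κ (-k) * plane (-|y|) k) +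
    (plane y k + scatC κ (-k) * plane (-|y|) k)),
    (contDiff_scatC hκ).mul (((contDiff_plane _).add (hc.mul (contDiff_plane _))).add
      ((contDiff_plane _).add (hc.mul (contDiff_plane _)))),
    (bddMeas_scatC κ).mul (((bddMeas_plane _).add (hb.mul (bddMeas_plane _))).add
      ((bddMeas_plane _).add (hb.mul (bddMeas_plane _)))), ?_⟩
  funext k
  simp only [scatSymbol, Set.indicator_apply, Set.mem_Ioi, conjWave, conj_wave]
  split_ifs with hk
  · rw [abs_neg, abs_of_pos hk, plane_neg_right, neg_neg]
  · rfl

theorem scatSymbol_evo (κ t : ℝ) (m : ℝ → ℂ) : scatSymbol κ (evo t m) = evo t (scatSymbol κ m) := by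
  funext k
  simp only [scatSymbol, evo, Set.indicator_apply, Real.cos_neg]
  split_ifs
  · ring
  · simp

theorem exp_hMag_delta {κ : ℝ} (hκ : 0 < κ) (t : ℝ) (y : ℤ) :
    NormedSpace.exp ((Complex.I * (t : ℂ)) • hMag κ) (delta y) =
      (boundState κ hκ y * Complex.exp (Complex.I * t * eB κ)) • boundState κ hκ +
        (packet t (conjWave κ y) + absOp (packet t (scatSymbol κ (conjWave κ y)))) := by
  have h1 : ((Complex.I * (t : ℂ)) • hMag κ) (boundState κ hκ) =
      (Complex.I * t * eB κ) • boundState κ hκ := by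
    rw [smul_apply, hMag_boundState, smul_smul]
  rw [delta_eq_add κ hκ y, map_add, map_smul, exp_apply_of_eigen _ _ _ h1,
    exp_hMag_waveVec κ (bddMeas_wave κ y).conj, smul_smul]
  congr 1
  change waveVec κ (evo t (conjWave κ y)) = _
  rw [waveVec, scatSymbol_evo]
  rfl

/-- The occupation of the scattering states in the nonequilibrium steady state. -/
def occupation (βL βR k : ℝ) : ℝ := if k < 0 then sHatMinus βR k else sHatMinus βL k

theorem bddMeas_occupation (βL βR : ℝ) : BddMeas fun k => (occupation βL βR k : ℂ) := by
  have e : (fun k => (occupation βL βR k : ℂ)) = fun k =>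
      (Set.Iio 0).indicator (fun k => (sHatMinus βR k : ℂ)) k +
        (Set.Ici 0).indicator (fun k => (sHatMinus βL k : ℂ)) k := by
    funext k
    simp only [occupation, Set.indicator_apply, Set.mem_Iio, Set.mem_Ici]
    by_cases h : k < 0
    · simp [h]
    · simp [h, not_lt.1 h]
  rw [e]
  exact ((bddMeas_sHatMinus βR).indicator measurableSet_Iio).add
    ((bddMeas_sHatMinus βL).indicator measurableSet_Ici)

theorem packet_eq_add {m : ℝ → ℂ} (hm : BddMeas m) (t : ℝ) :
    packet t m = packet t ((Set.Iio 0).indicator m) + packet t ((Set.Ioi 0).indicator m) := by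
  rw [← packet_add (hm.indicator measurableSet_Iio) (hm.indicator measurableSet_Ioi)]
  refine packet_congr hm ((hm.indicator measurableSet_Iio).add (hm.indicator measurableSet_Ioi))
    (fun k _ _ hk => ?_) t
  rcases lt_or_gt_of_ne hk with h | h <;> simp [h, h.le]

theorem tendsto_packet_conjWave_apply {κ : ℝ} (hκ : 0 < κ) (y x : ℤ) :
    Tendsto (fun t => packet t (conjWave κ y) x) atTop (𝓝 0) := by
  have h := ((rightMover_conjWave hκ y).tendsto_packet_apply x).add
    ((leftMover_conjWave hκ y).tendsto_packet_apply x)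
  rw [add_zero] at h
  refine h.congr fun t => ?_
  rw [packet_eq_add (bddMeas_conjWave κ y) t]
  rfl

theorem tendsto_packet_occupation_apply {κ : ℝ} (hκ : 0 < κ) (βL βR : ℝ) (y x : ℤ) :
    Tendsto (fun t => packet t (fun k => occupation βL βR k * conjWave κ y k) x) atTop (𝓝 0) := by
  have hR : RightMover fun k => (sHatMinus βR k : ℂ) * (Set.Iio 0).indicator (conjWave κ y) k :=
    (rightMover_conjWave hκ y).mul (contDiff_ofReal.comp (contDiff_sHatMinus βR))
    (bddMeas_sHatMinus βR)
  have hL : LeftMover fun k => (sHatMinus βL k : ℂ) * (Set.Ioi 0).indicator (conjWave κ y) k :=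
    (leftMover_conjWave hκ y).mul (contDiff_ofReal.comp (contDiff_sHatMinus βL))
    (bddMeas_sHatMinus βL)
  have h := (hR.tendsto_packet_apply x).add (hL.tendsto_packet_apply x)
  rw [add_zero] at h
  refine h.congr fun t => ?_
  have hb := (bddMeas_occupation βL βR).mul (bddMeas_conjWave κ y)
  have e : packet t (fun k => occupation βL βR k * conjWave κ y k) =
      packet t (fun k => sHatMinus βR k * (Set.Iio 0).indicator (conjWave κ y) k) +
        packet t fun k => sHatMinus βL k * (Set.Ioi 0).indicator (conjWave κ y) k := by
    rw [← packet_add hR.bddMeas hL.bddMeas]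
    refine packet_congr hb (hR.bddMeas.add hL.bddMeas) (fun k _ _ hk => ?_) t
    rcases lt_or_gt_of_ne hk with h | h
    · simp [h, h.le, occupation]
    · simp [h, h.not_gt, occupation]
  rw [e]
  rfl

theorem tendsto_sInitMinus_packet {κ : ℝ} (hκ : 0 < κ) (βL βR : ℝ) (N : ℕ) (y : ℤ) :
    Tendsto (fun t => sInitMinus βL βR N (packet t (conjWave κ y)) -
      packet t fun k => occupation βL βR k * conjWave κ y k) atTop (𝓝 0) := by
  have hR : RightMover fun k => (sHatMinus βR k : ℂ) * (Set.Iio 0).indicator (conjWave κ y) k :=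
    (rightMover_conjWave hκ y).mul (contDiff_ofReal.comp (contDiff_sHatMinus βR))
    (bddMeas_sHatMinus βR)
  have hL : LeftMover fun k => (sHatMinus βL k : ℂ) * (Set.Ioi 0).indicator (conjWave κ y) k :=
    (leftMover_conjWave hκ y).mul (contDiff_ofReal.comp (contDiff_sHatMinus βL))
    (bddMeas_sHatMinus βL)
  have h := ((rightMover_conjWave hκ y).tendsto_sInitMinus βL βR N).add
    ((leftMover_conjWave hκ y).tendsto_sInitMinus βL βR N)
  rw [add_zero] at h
  refine h.congr fun t => ?_
  have hb := (bddMeas_occupation βL βR).mul (bddMeas_conjWave κ y)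
  have e : packet t (fun k => occupation βL βR k * conjWave κ y k) =
      packet t (fun k => sHatMinus βR k * (Set.Iio 0).indicator (conjWave κ y) k) +
        packet t fun k => sHatMinus βL k * (Set.Ioi 0).indicator (conjWave κ y) k := by
    rw [← packet_add hR.bddMeas hL.bddMeas]
    refine packet_congr hb (hR.bddMeas.add hL.bddMeas) (fun k _ _ hk => ?_) t
    rcases lt_or_gt_of_ne hk with h | h
    · simp [h, h.le, occupation]
    · simp [h, h.not_gt, occupation]
  rw [e, packet_eq_add (bddMeas_conjWave κ y) t, map_add]
  abel

/-- The two-point function of the nonequilibrium steady state. -/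
def steadyTwoPoint (κ : ℝ) (hκ : 0 < κ) (βL βR : ℝ) (N : ℕ) (x y : ℤ) : ℂ :=
  inner ℂ (boundState κ hκ) (sInitMinus βL βR N (boundState κ hκ)) *
      (boundState κ hκ x * boundState κ hκ y) +
    circ fun k => wave κ x k * (occupation βL βR k * conjWave κ y k)

theorem conj_boundState (κ : ℝ) (hκ : 0 < κ) (x : ℤ) :
    starRingEnd ℂ (boundState κ hκ x) = boundState κ hκ x := by
  rw [boundState_apply, Complex.conj_ofReal]

theorem tendsto_evolvedTwoPoint {κ : ℝ} (hκ : 0 < κ) (βL βR : ℝ) (N : ℕ) (x y : ℤ) :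
    Tendsto (fun t => evolvedTwoPoint κ βL βR N t x y) atTop
      (𝓝 (steadyTwoPoint κ hκ βL βR N x y)) := by
  set f := boundState κ hκ with hf
  set s := sInitMinus βL βR N with hs
  set u : ℝ → ℂ := fun t => Complex.exp (Complex.I * t * eB κ) with hu
  have hun : ∀ t, ‖u t‖ = 1 := by
    intro t
    simp only [hu]
    rw [show Complex.I * (t : ℂ) * eB κ = ((t * eB κ : ℝ) : ℂ) * Complex.I by push_cast; ring,
      Complex.norm_exp_ofReal_mul_I]
  have huu : ∀ t, starRingEnd ℂ (u t) * u t = 1 := by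
    intro t
    rw [← Complex.normSq_eq_conj_mul_self, Complex.normSq_eq_norm_sq, hun]
    simp
  have hbw := fun z => bddMeas_conjWave κ z
  have hbo : BddMeas fun k => occupation βL βR k * conjWave κ y k :=
    (bddMeas_occupation βL βR).mul (hbw y)
  obtain ⟨Bx, hBx⟩ := exists_norm_packet_le (hbw x)
  obtain ⟨By, hBy⟩ := exists_norm_packet_le hbo
  have hd : ∀ z, Tendsto (fun t : ℝ => NormedSpace.exp ((Complex.I * (t : ℂ)) • hMag κ) (delta z) -
      ((f z * u t) • f + packet t (conjWave κ z))) atTop (𝓝 0) := by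
    intro z
    refine (tendsto_absOp_of_leftMover (leftMover_scatSymbol_conjWave hκ z)).congr fun t => ?_
    rw [exp_hMag_delta hκ]
    change absOp (packet t (scatSymbol κ (conjWave κ z))) = _
    simp only [hu, hf]
    abel
  have hsd : Tendsto (fun t : ℝ => s (NormedSpace.exp ((Complex.I * (t : ℂ)) • hMag κ) (delta y)) -
      ((f y * u t) • s f + packet t fun k => occupation βL βR k * conjWave κ y k)) atTop (𝓝 0) := by
    have h1 := (s.continuous.tendsto 0).comp (hd y)
    rw [map_zero] at h1
    have h2 := h1.add (tendsto_sInitMinus_packet hκ βL βR N y)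
    rw [add_zero] at h2
    refine h2.congr fun t => ?_
    simp only [Function.comp_apply, map_sub, map_add, map_smul, ← hs]
    abel
  have hA : ∀ t, ‖(f x * u t) • f + packet t (conjWave κ x)‖ ≤ ‖f x‖ * ‖f‖ + Bx := by
    intro t
    refine (norm_add_le _ _).trans (add_le_add (le_of_eq ?_) (hBx t))
    rw [norm_smul, norm_mul, hun, mul_one]
  have hB : ∀ t, ‖(f y * u t) • s f + packet t fun k => occupation βL βR k * conjWave κ y k‖ ≤
      ‖f y‖ * ‖s f‖ + By := by
    intro t
    refine (norm_add_le _ _).trans (add_le_add (le_of_eq ?_) (hBy t))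
    rw [norm_smul, norm_mul, hun, mul_one]
  have hmain := tendsto_inner_sub hA hB (hd x) hsd
  have hw1 : Tendsto (fun t => starRingEnd ℂ (f x * u t) *
      inner ℂ f (packet t fun k => occupation βL βR k * conjWave κ y k)) atTop (𝓝 0) := by
    have h1 := tendsto_inner_of_tendsto_apply hBy
      (fun z => tendsto_packet_occupation_apply hκ βL βR y z) f
    refine squeeze_zero_norm (a := fun t => ‖f x‖ * ‖inner ℂ f (packet t fun k =>
      occupation βL βR k * conjWave κ y k)‖) (fun t => le_of_eq ?_) ?_
    · rw [norm_mul, RCLike.norm_conj, norm_mul, hun, mul_one]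
    · simpa using h1.norm.const_mul ‖f x‖
  have hw2 : Tendsto (fun t => f y * u t * inner ℂ (packet t (conjWave κ x)) (s f)) atTop
      (𝓝 0) := by
    have h1 := tendsto_inner_of_tendsto_apply hBx
      (fun z => tendsto_packet_conjWave_apply hκ x z) (s f)
    refine squeeze_zero_norm (a := fun t => ‖f y‖ * ‖inner ℂ (s f) (packet t (conjWave κ x))‖)
      (fun t => le_of_eq ?_) ?_
    · rw [norm_mul, norm_mul, hun, mul_one, norm_inner_symm]
    · simpa using h1.norm.const_mul ‖f y‖
  have h3 := ((hmain.add hw1).add hw2).add_const (steadyTwoPoint κ hκ βL βR N x y)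
  rw [add_zero, add_zero, zero_add] at h3
  refine h3.congr fun t => ?_
  have hP : inner ℂ (packet t (conjWave κ x)) (packet t fun k =>
      occupation βL βR k * conjWave κ y k) =
      circ fun k => wave κ x k * (occupation βL βR k * conjWave κ y k) := by
    rw [inner_packet (hbw x) hbo]
    simp only [conjWave, Complex.conj_conj]
  simp only [inner_add_left, inner_add_right, inner_smul_left, inner_smul_right, hP, map_mul,
    steadyTwoPoint, evolvedTwoPoint, ← hf, ← hs]
  rw [hf, conj_boundState, ← hf]
  linear_combination (-(f x * f y * inner ℂ f (s f))) * huu t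

end LongTime

section Symbols

theorem coeff_eq_circ (f : ℝ → ℂ) (m : ℤ) :
    coeff f m = (-1) ^ m * circ fun k => plane (-m) k * f k := by
  rw [← circ_const_mul]
  have h : (-1 : ℂ) ^ m * (-1) ^ (-m) = 1 := by
    rw [← zpow_add₀ (by norm_num), add_neg_cancel, zpow_zero]
  simp only [coeff, circ, plane, ← mul_assoc, h, one_mul]
  congr 2
  funext k
  push_cast
  ring_nf

theorem phiB_of_pos {κ k : ℝ} (hκ : 0 < κ) (hk : 0 < k) (hk' : k < Real.pi) :
    (phiB κ k : ℂ) = 1 - scatC κ k * scatC κ (-k) := by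
  have h : ∀ q : ℝ, (κ : ℂ) - Complex.I * (q : ℂ) ≠ 0 := by
    intro q h
    exact hκ.ne' (by simpa using congrArg Complex.re h)
  have h1 := h (Real.sin k)
  have h2 := h (-Real.sin k)
  have h3 : ((Real.sin k : ℂ)) ^ 2 + (κ : ℂ) ^ 2 =
      ((κ : ℂ) - Complex.I * Real.sin k) * ((κ : ℂ) - Complex.I * (-Real.sin k : ℝ)) := by
    push_cast
    linear_combination (Complex.sin k ^ 2) * Complex.I_sq
  rw [phiB, Set.indicator_of_mem (show k ∈ Set.Icc 0 Real.pi from ⟨hk.le, hk'.le⟩), scatC, scatC, Real.sin_neg]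
  push_cast at h1 h2 h3 ⊢
  rw [h3, div_mul_div_comm, eq_sub_iff_add_eq, ← add_div, div_eq_one_iff_eq (mul_ne_zero h1 h2)]
  linear_combination h3

theorem phiB_of_neg (κ : ℝ) {k : ℝ} (hk : k < 0) : phiB κ k = 0 :=
  Set.indicator_of_notMem (fun h => absurd h.1 (not_le.2 hk)) _

theorem phiB_nonneg (κ k : ℝ) : 0 ≤ phiB κ k :=
  Set.indicator_nonneg (fun _ _ => by positivity) _

theorem phiB_le_one (κ k : ℝ) : phiB κ k ≤ 1 := by
  refine Set.indicator_le' (fun k _ => ?_) (fun _ _ => zero_le_one) k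
  exact div_le_one_of_le₀ (by nlinarith [sq_nonneg κ]) (by positivity)

theorem measurable_phiB (κ : ℝ) : Measurable (phiB κ) :=
  Measurable.indicator (by fun_prop) measurableSet_Icc

theorem sHatMinus_neg (β k : ℝ) : sHatMinus β (-k) = sHatMinus β k := by
  simp [sHatMinus]

theorem bddMeas_symbolA (κ βL βR : ℝ) : BddMeas (symbolA κ βL βR) := by
  have h : BddMeas fun k => (phiB κ k : ℂ) := by
    refine ⟨Complex.measurable_ofReal.comp (measurable_phiB κ), 1, fun k => ?_⟩
    rw [Complex.norm_real, Real.norm_of_nonneg (phiB_nonneg κ k)]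
    exact phiB_le_one κ k
  have e : symbolA κ βL βR = fun k =>
      (phiB κ k : ℂ) * (sHatMinus βL k : ℂ) + (1 - (phiB κ k : ℂ)) * (sHatMinus βR k : ℂ) := by
    funext k
    simp [symbolA]
  rw [e]
  exact (h.mul (bddMeas_sHatMinus βL)).add (((BddMeas.const 1).sub h).mul (bddMeas_sHatMinus βR))

theorem memLp_symbolA (κ βL βR : ℝ) : MeasureTheory.MemLp (symbolA κ βL βR) ⊤
    (MeasureTheory.volume.restrict (Set.Ioc (-Real.pi) Real.pi)) := by
  obtain ⟨hm, B, hB⟩ := bddMeas_symbolA κ βL βR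
  exact MeasureTheory.memLp_top_of_bound hm.aestronglyMeasurable B (Filter.Eventually.of_forall hB)

theorem symbolB_neg {κ : ℝ} (hκ : 0 < κ) (βL βR : ℝ) (N : ℕ) (y : ℤ) (k : ℝ) :
    symbolB κ hκ βL βR N y (-k) = Complex.exp (Complex.I * (2 * y - 1) * k) * (scatC κ k *
      (sHatMinus βR k - inner ℂ (boundState κ hκ) (sInitMinus βL βR N (boundState κ hκ)))) := by
  have h1 : (κ : ℂ) - Complex.I * Real.sin k ≠ 0 := by
    intro h
    exact hκ.ne' (by simpa using congrArg Complex.re h)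
  have h2 : Complex.I * κ - Real.sin (-k) = Complex.I * ((κ : ℂ) - Complex.I * Real.sin k) := by
    rw [Real.sin_neg, Complex.ofReal_neg]
    linear_combination (Real.sin k : ℂ) * Complex.I_sq
  have h3 : -Complex.I * ((-k : ℝ) : ℂ) * (2 * y - 1) = Complex.I * (2 * y - 1) * k := by
    push_cast
    ring
  rw [symbolB, h2, h3, sHatMinus_neg, scatC, mul_assoc Complex.I (κ : ℂ),
    mul_div_mul_left _ _ Complex.I_ne_zero]
  ring

theorem contDiff_symbolB {κ : ℝ} (hκ : 0 < κ) (βL βR : ℝ) (N : ℕ) (y : ℤ) {n : WithTop ℕ∞} :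
    ContDiff ℝ n (symbolB κ hκ βL βR N y) := by
  have h1 : ContDiff ℝ n fun k : ℝ => Complex.exp (Complex.I * (2 * y - 1) * k) :=
    (contDiff_const.mul contDiff_ofReal).cexp
  have h2 : ContDiff ℝ n fun k : ℝ => Complex.exp (Complex.I * (2 * y - 1) * k) * (scatC κ k *
      (sHatMinus βR k - inner ℂ (boundState κ hκ) (sInitMinus βL βR N (boundState κ hκ)))) :=
    h1.mul ((contDiff_scatC hκ).mul
      ((contDiff_ofReal.comp (contDiff_sHatMinus βR)).sub contDiff_const))
  have h3 := h2.comp (contDiff_neg (𝕜 := ℝ))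
  refine (congrArg (ContDiff ℝ n) (funext fun k => ?_)).mp h3
  rw [Function.comp_apply, ← symbolB_neg hκ βL βR N y, neg_neg]

theorem periodic_symbolB {κ : ℝ} (hκ : 0 < κ) (βL βR : ℝ) (N : ℕ) (y : ℤ) :
    Function.Periodic (symbolB κ hκ βL βR N y) (2 * Real.pi) := by
  intro k
  have h : Complex.exp (-Complex.I * ((k + 2 * Real.pi : ℝ) : ℂ) * (2 * y - 1)) =
      Complex.exp (-Complex.I * k * (2 * y - 1)) := by
    rw [Complex.exp_eq_exp_iff_exists_int]
    exact ⟨-(2 * y - 1), by push_cast; ring⟩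
  simp only [symbolB, h, Real.sin_add_two_pi, sHatMinus, Real.cos_add_two_pi]

theorem coeff_symbolB {κ : ℝ} (hκ : 0 < κ) (βL βR : ℝ) (N : ℕ) (y m : ℤ) :
    coeff (symbolB κ hκ βL βR N y) (m + 1) = (-1) ^ m * circ fun k => scatC κ k *
      (sHatMinus βR k - inner ℂ (boundState κ hκ) (sInitMinus βL βR N (boundState κ hκ))) *
        plane (m + 2 * y) k := by
  have h1 : (-1 : ℂ) ^ m * (-1) ^ m = 1 := by
    rw [← mul_zpow]; norm_num
  have h2 : (-1 : ℂ) ^ (2 * y) = 1 := by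
    rw [zpow_mul]; norm_num
  rw [← circ_const_mul, coeff]
  change circ (fun k => Complex.exp (-Complex.I * ((m + 1 : ℤ) : ℂ) * k) *
    symbolB κ hκ βL βR N y k) = _
  rw [← circ_comp_neg]
  congr 1
  funext k
  rw [symbolB_neg, plane, zpow_add₀ (by norm_num), h2, ← mul_assoc (Complex.exp _), ← Complex.exp_add]
  have h3 : -Complex.I * ((m + 1 : ℤ) : ℂ) * ((-k : ℝ) : ℂ) + Complex.I * (2 * y - 1) * k =
      Complex.I * ((m + 2 * y : ℤ) : ℂ) * k := by
    push_cast
    ring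
  rw [h3]
  set E := Complex.exp (Complex.I * ((m + 2 * y : ℤ) : ℂ) * k)
  set S := scatC κ k * ((sHatMinus βR k : ℂ) -
    inner ℂ (boundState κ hκ) (sInitMinus βL βR N (boundState κ hκ)))
  linear_combination (-(E * S)) * h1

theorem steadyTwoPoint_of_nonneg {κ : ℝ} (hκ : 0 < κ) (βL βR : ℝ) (N : ℕ) {x y : ℤ}
    (hx : 0 ≤ x) (hy : 0 ≤ y) :
    steadyTwoPoint κ hκ βL βR N x y = (circ fun k => plane (x - y) k * symbolA κ βL βR k) +
      circ fun k => scatC κ k * (sHatMinus βR k -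
        inner ℂ (boundState κ hκ) (sInitMinus βL βR N (boundState κ hκ))) * plane (x + y) k := by
  set c := inner ℂ (boundState κ hκ) (sInitMinus βL βR N (boundState κ hκ)) with hc
  have hA : BddMeas fun k => plane (x - y) k * symbolA κ βL βR k :=
    (bddMeas_plane _).mul (bddMeas_symbolA κ βL βR)
  have hB : BddMeas fun k => scatC κ k * sHatMinus βR k * plane (x + y) k :=
    ((bddMeas_scatC κ).mul (bddMeas_sHatMinus βR)).mul (bddMeas_plane _)
  have hC : BddMeas fun k => scatC κ k * plane (x + y) k :=
    (bddMeas_scatC κ).mul (bddMeas_plane _)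
  have hW : BddMeas fun k => wave κ x k * (occupation βL βR k * conjWave κ y k) :=
    (bddMeas_wave κ x).mul ((bddMeas_occupation βL βR).mul (bddMeas_conjWave κ y))
  have e1 : (circ fun k => scatC κ k * (sHatMinus βR k - c) * plane (x + y) k) =
      (circ fun k => scatC κ k * sHatMinus βR k * plane (x + y) k) - c * scatCoeff κ (x + y) := by
    rw [scatCoeff, ← circ_const_mul, ← circ_sub hB ((BddMeas.const c).mul hC)]
    congr 1
    funext k
    ring
  have e2 : (circ fun k => wave κ x k * (occupation βL βR k * conjWave κ y k)) =
      circ fun k => plane (x - y) k * symbolA κ βL βR k +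
        scatC κ k * sHatMinus βR k * plane (x + y) k := by
    rw [circ_eq_circ_indicator hW, circ_eq_circ_indicator (hA.add hB)]
    refine circ_congr fun k _ hk' _ => ?_
    simp only [Set.indicator_apply, Set.mem_Ioi]
    split_ifs with hk
    · obtain ⟨h1, h2⟩ := wave_mul_conj_add_of_nonneg (κ := κ) hx hy hk
      have hu := scatC_unitary κ k
      have o1 : occupation βL βR k = sHatMinus βL k := if_neg hk.not_gt
      have o2 : occupation βL βR (-k) = sHatMinus βR k := by
        rw [occupation, if_pos (by linarith), sHatMinus_neg]
      simp only [conjWave, o1, o2, symbolA, sHatMinus_neg, phiB_of_neg κ (neg_neg_of_pos hk),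
        plane_neg_right]
      push_cast
      rw [phiB_of_pos hκ hk hk']
      linear_combination (sHatMinus βL k : ℂ) * h1 + (sHatMinus βR k : ℂ) * h2 +
        (sHatMinus βL k : ℂ) * plane (x - y) k * hu
    · rfl
  rw [steadyTwoPoint, ← hc, e1, e2, circ_add hA hB, boundState_mul, abs_of_nonneg hx,
    abs_of_nonneg hy]
  ring

theorem steadyTwoPoint_eq_coeff {κ : ℝ} (hκ : 0 < κ) (βL βR : ℝ) (N : ℕ) {x₀ : ℤ}
    (hx₀ : 0 ≤ x₀) (i j : ℕ) :
    (-1) ^ (i + j) * steadyTwoPoint κ hκ βL βR N (x₀ + j) (x₀ + i) =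
      coeff (symbolA κ βL βR) ((i : ℤ) - j) +
        coeff (symbolB κ hκ βL βR N x₀) ((i : ℤ) + j + 1) := by
  have h : (-1 : ℂ) ^ ((i : ℤ) - j) = (-1) ^ (i + j) := by
    rw [zpow_sub₀ (by norm_num), zpow_natCast, zpow_natCast, pow_add, div_eq_mul_inv,
      ← zpow_natCast _ j, neg_one_zpow_inv]
  have h' : (-1 : ℂ) ^ ((i : ℤ) + j) = (-1) ^ (i + j) := by
    rw [← Nat.cast_add, zpow_natCast]
  rw [steadyTwoPoint_of_nonneg hκ βL βR N (by positivity) (by positivity), coeff_eq_circ,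
    coeff_symbolB, h, h', mul_add]
  congr 4
  · funext k
    congr 2
    ring
  · funext k
    congr 2
    ring

end Symbols

section SteadyState

open Filter Topology

theorem tendsto_average {f : ℝ → ℂ} {L : ℂ} (hf : Continuous f) (h : Tendsto f atTop (𝓝 L)) :
    Tendsto (fun T : ℝ => ((1 / T : ℝ) : ℂ) * ∫ t in (0 : ℝ)..T, f t) atTop (𝓝 L) := by
  rw [Metric.tendsto_atTop]
  intro ε hε
  obtain ⟨T₀, hT₀⟩ := Metric.tendsto_atTop.1 h (ε / 2) (by positivity)
  set S := max T₀ 1 with hS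
  have hS0 : 0 < S := lt_of_lt_of_le one_pos (le_max_right _ _)
  set C := ‖∫ t in (0 : ℝ)..S, (f t - L)‖ with hC
  have hi : ∀ a b : ℝ, IntervalIntegrable (fun t => f t - L) MeasureTheory.volume a b :=
    fun a b => (hf.sub continuous_const).intervalIntegrable a b
  refine ⟨max S (2 * (C + 1) / ε), fun T hT => ?_⟩
  have hST : S ≤ T := (le_max_left _ _).trans hT
  have hT0 : 0 < T := hS0.trans_le hST
  have hCT : C < ε / 2 * T := by
    have := (div_le_iff₀ hε).1 ((le_max_right _ _).trans hT)
    linarith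
  have e : ((1 / T : ℝ) : ℂ) * (∫ t in (0 : ℝ)..T, f t) - L =
      ((1 / T : ℝ) : ℂ) * ∫ t in (0 : ℝ)..T, (f t - L) := by
    have hT' : (T : ℂ) ≠ 0 := by exact_mod_cast hT0.ne'
    rw [intervalIntegral.integral_sub (hf.intervalIntegrable _ _) intervalIntegrable_const,
      intervalIntegral.integral_const, sub_zero, Complex.real_smul]
    push_cast
    field_simp
  have h2 : ‖∫ t in S..T, (f t - L)‖ ≤ ε / 2 * (T - S) := by
    have := intervalIntegral.norm_integral_le_of_norm_le_const (a := S) (b := T)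
      (f := fun t => f t - L) (C := ε / 2) fun t ht => by
        rw [Set.uIoc_of_le hST] at ht
        rw [← dist_eq_norm]
        exact (hT₀ t ((le_max_left _ _).trans ht.1.le)).le
    rwa [abs_of_nonneg (sub_nonneg.2 hST)] at this
  rw [dist_eq_norm, e, norm_mul, Complex.norm_real, Real.norm_of_nonneg (by positivity),
    ← intervalIntegral.integral_add_adjacent_intervals (hi 0 S) (hi S T)]
  have h3 := (norm_add_le (∫ t in (0 : ℝ)..S, (f t - L)) (∫ t in S..T, (f t - L))).trans
    (add_le_add le_rfl h2)
  calc 1 / T * ‖(∫ t in (0 : ℝ)..S, (f t - L)) + ∫ t in S..T, (f t - L)‖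
      ≤ 1 / T * (C + ε / 2 * (T - S)) := by gcongr
    _ < 1 / T * (ε * T) := by
        refine mul_lt_mul_of_pos_left ?_ (by positivity)
        nlinarith [mul_pos hε hS0]
    _ = ε := by field_simp

theorem eq_of_mapClusterPt_of_tendsto {α X : Type*} [TopologicalSpace X] [T2Space X] {F : Filter α}
    {u : α → X} {x y : X} (h : MapClusterPt x F u) (hy : Tendsto u F (𝓝 y)) : x = y := by
  have : (𝓝 x ⊓ 𝓝 y).NeBot := h.neBot.mono (inf_le_inf_left _ hy)
  exact eq_of_nhds_neBot this

theorem continuous_exp_smul_apply {E : Type*} [NormedAddCommGroup E] [NormedSpace ℂ E]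
    [CompleteSpace E] (A : E →L[ℂ] E) (v : E) :
    Continuous fun t : ℝ => NormedSpace.exp ((Complex.I * (t : ℂ)) • A) v := by
  let _ : NormedAlgebra ℚ (E →L[ℂ] E) := .restrictScalars ℚ ℂ _
  have h : Continuous fun t : ℝ => NormedSpace.exp ((Complex.I * (t : ℂ)) • A) :=
    NormedSpace.exp_continuous.comp
      ((continuous_const.mul Complex.continuous_ofReal).smul continuous_const)
  exact h.clm_apply continuous_const

theorem continuous_evolvedTwoPoint (κ βL βR : ℝ) (N : ℕ) (x y : ℤ) :
    Continuous fun t => evolvedTwoPoint κ βL βR N t x y :=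
  (continuous_exp_smul_apply _ _).inner
    ((sInitMinus βL βR N).continuous.comp (continuous_exp_smul_apply _ _))

theorem IsNESS.apply_eq {τ : ℝ → (CAR ≃⋆ₐ[ℂ] CAR)} {ω₀ ω : CAR →ₗ[ℂ] ℂ} (hω : IsNESS τ ω₀ ω)
    {A : CAR} {f : ℝ → ℂ} {L : ℂ} (hA : ∀ t, ω₀ (τ t A) = f t) (hf : Continuous f)
    (hL : Tendsto f atTop (𝓝 L)) : ω A = L := by
  have h := hω.2.continuousAt_comp (continuous_apply A).continuousAt
  refine eq_of_mapClusterPt_of_tendsto h ((tendsto_average hf hL).congr fun T => ?_)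
  simp only [Function.comp_apply, hA]

variable {κ βL βR : ℝ} {N : ℕ} {ω₀ ω : CAR →ₗ[ℂ] ℂ} {τ : ℝ → (CAR ≃⋆ₐ[ℂ] CAR)}

theorem IsNESS.twoPoint_eq (hω : IsNESS τ ω₀ ω) (hκ : 0 < κ)
    (hS₀ : HasDensity ω₀ (initialDensity βL βR N)) (hτ : IsBogoliubov τ (HMag κ)) (x y : ℤ) :
    twoPoint ω x y = steadyTwoPoint κ hκ βL βR N x y :=
  hω.apply_eq (fun t => evolved_twoPoint hS₀ hτ t x y)
    (continuous_evolvedTwoPoint κ βL βR N x y) (tendsto_evolvedTwoPoint hκ βL βR N x y)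

theorem det_checkerboard_transpose {n : ℕ} (A : Matrix (Fin n) (Fin n) ℂ) :
    Matrix.det (Matrix.of fun i j : Fin n => (-1) ^ ((i : ℕ) + (j : ℕ)) * A j i) = A.det := by
  have e : (Matrix.of fun i j : Fin n => (-1) ^ ((i : ℕ) + (j : ℕ)) * A j i) =
      Matrix.of fun i j : Fin n => (-1 : ℂ) ^ (i : ℕ) *
        (Matrix.of fun i j : Fin n => (-1 : ℂ) ^ (j : ℕ) * A.transpose i j) i j := by
    ext i j
    simp only [Matrix.of_apply, Matrix.transpose_apply, pow_add, mul_assoc]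
  have h1 : (∏ i : Fin n, (-1 : ℂ) ^ (i : ℕ)) * ∏ i : Fin n, (-1 : ℂ) ^ (i : ℕ) = 1 := by
    rw [← Finset.prod_mul_distrib]
    refine Finset.prod_eq_one fun i _ => ?_
    rw [← mul_pow]
    norm_num
  rw [e, Matrix.det_mul_column, Matrix.det_mul_row, Matrix.det_transpose, ← mul_assoc, h1, one_mul]

theorem IsNESS.efpObservable_eq (hω : IsNESS τ ω₀ ω) (hκ : 0 < κ) (hω₀ : IsQuasifree ω₀)
    (hS₀ : HasDensity ω₀ (initialDensity βL βR N)) (hτ : IsBogoliubov τ (HMag κ)) (x₀ : ℤ)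
    (n : ℕ) :
    ω (efpObservable x₀ n) = Matrix.det (Matrix.of fun i j : Fin n =>
      (-1) ^ ((i : ℕ) + (j : ℕ)) *
        steadyTwoPoint κ hκ βL βR N (x₀ + (j : ℕ)) (x₀ + (i : ℕ))) := by
  have h := det_checkerboard_transpose (Matrix.of fun i j : Fin n =>
    steadyTwoPoint κ hκ βL βR N (x₀ + (i : ℕ)) (x₀ + (j : ℕ)))
  simp only [Matrix.of_apply] at h
  rw [h]
  refine hω.apply_eq (evolved_efpObservable hω₀ hS₀ hτ · x₀ n) ?_ ?_
  · exact Continuous.matrix_det (continuous_matrix fun i j => continuous_evolvedTwoPoint ..)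
  · refine (Continuous.matrix_det continuous_id).continuousAt.tendsto.comp ?_
    exact tendsto_pi_nhds.2 fun i => tendsto_pi_nhds.2 fun j => tendsto_evolvedTwoPoint ..

theorem memℓp_section (v : OneParticle) (x₀ : ℤ) {u : ℕ → ℂ} (hu : ∀ i : ℕ, ‖u i‖ = ‖v (x₀ + i)‖) :
    Memℓp u 2 := by
  have h := (OneParticle.summable_sq v).comp_injective
    (i := fun i : ℕ => x₀ + (i : ℤ)) fun a b h => by simpa using h
  refine memℓp_gen (h.congr fun i => ?_)
  simp [hu]

theorem steadyTwoPoint_eq_left (hκ : 0 < κ) (y : ℤ) :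
    ∃ v : OneParticle, ∀ x, steadyTwoPoint κ hκ βL βR N x y = v x := by
  refine ⟨(inner ℂ (boundState κ hκ) (sInitMinus βL βR N (boundState κ hκ)) *
    boundState κ hκ y) • boundState κ hκ +
      waveVec κ fun k => occupation βL βR k * conjWave κ y k, fun x => ?_⟩
  change _ = _ * boundState κ hκ x + waveVec κ _ x
  rw [waveVec_apply κ ((bddMeas_occupation βL βR).mul (bddMeas_conjWave κ y)), steadyTwoPoint]
  simp only [mul_comm (wave κ x _)]
  ring

theorem circ_conj (f : ℝ → ℂ) : (circ fun k => starRingEnd ℂ (f k)) = starRingEnd ℂ (circ f) := by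
  simp [circ, intervalIntegral.intervalIntegral_eq_integral_uIoc, integral_conj, Real.pi_pos.le, Complex.conj_ofNat]

theorem steadyTwoPoint_eq_right (hκ : 0 < κ) (x : ℤ) :
    ∃ v : OneParticle, ∀ y, steadyTwoPoint κ hκ βL βR N x y = v y := by
  refine ⟨(inner ℂ (boundState κ hκ) (sInitMinus βL βR N (boundState κ hκ)) *
    boundState κ hκ x) • boundState κ hκ +
      star (waveVec κ fun k => occupation βL βR k * conjWave κ x k), fun y => ?_⟩
  change _ = _ * boundState κ hκ y + starRingEnd ℂ (waveVec κ _ y)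
  rw [waveVec_apply κ ((bddMeas_occupation βL βR).mul (bddMeas_conjWave κ x)), ← circ_conj,
    steadyTwoPoint, mul_assoc]
  congr 2
  funext k
  simp only [conjWave, map_mul, Complex.conj_conj, Complex.conj_ofReal]
  ring

theorem exists_finiteRank_of_rows_columns (K : ℕ → ℕ → ℂ) (n₀ : ℕ)
    (hrow : ∀ i, Memℓp (fun j => K i j) 2) (hcol : ∀ j, Memℓp (fun i => K i j) 2) :
    ∃ M : Ell2 ℕ →L[ℂ] Ell2 ℕ,
      FiniteDimensional ℂ (LinearMap.range (M : Ell2 ℕ →ₗ[ℂ] Ell2 ℕ)) ∧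
      ∀ i j : ℕ, M (lp.single 2 j (1 : ℂ)) i = if n₀ ≤ i ∧ n₀ ≤ j then 0 else K i j := by
  have hcol' : ∀ j, Memℓp (fun i => if n₀ ≤ i then K i j else 0) 2 := by
    intro j
    refine memℓp_gen (((hcol j).summable (by simp)).of_nonneg_of_le (fun i => by positivity)
      fun i => ?_)
    split_ifs
    · exact le_rfl
    · simp
  let r : ℕ → Ell2 ℕ := fun i => star ⟨fun j => K i j, hrow i⟩
  let c : ℕ → Ell2 ℕ := fun j => ⟨fun i => if n₀ ≤ i then K i j else 0, hcol' j⟩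
  let e : ℕ → Ell2 ℕ := fun i => lp.single 2 i (1 : ℂ)
  let M : Ell2 ℕ →L[ℂ] Ell2 ℕ := ∑ l : Fin n₀, (InnerProductSpace.rankOne ℂ (e l) (r l) +
    InnerProductSpace.rankOne ℂ (c l) (e l))
  have hM : ∀ ψ, M ψ = ∑ l : Fin n₀, (inner ℂ (r l) ψ • e l + inner ℂ (e l) ψ • c l) := by
    intro ψ
    simp [M]
  refine ⟨M, ?_, fun i j => ?_⟩
  · let W := Submodule.span ℂ (Set.range fun l : Fin n₀ => e l) ⊔
      Submodule.span ℂ (Set.range fun l : Fin n₀ => c l)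
    have hW : FiniteDimensional ℂ W := by
      have h1 := FiniteDimensional.span_of_finite ℂ (Set.finite_range fun l : Fin n₀ => e l)
      have h2 := FiniteDimensional.span_of_finite ℂ (Set.finite_range fun l : Fin n₀ => c l)
      exact Submodule.finiteDimensional_sup _ _
    refine Submodule.finiteDimensional_of_le (S₂ := W) ?_
    rintro _ ⟨ψ, rfl⟩
    change M ψ ∈ W
    rw [hM]
    refine Submodule.sum_mem _ fun l _ => add_mem ?_ ?_
    · exact Submodule.smul_mem _ _ (Submodule.mem_sup_left (Submodule.subset_span ⟨l, rfl⟩))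
    · exact Submodule.smul_mem _ _ (Submodule.mem_sup_right (Submodule.subset_span ⟨l, rfl⟩))
  · have h1 : ∀ l : ℕ, inner ℂ (r l) (e j) = K l j := by
      intro l
      rw [lp.inner_single_right]
      change 1 * starRingEnd ℂ (star (K l j)) = _
      simp
    have h2 : ∀ l : ℕ, inner ℂ (e l) (e j) = if l = j then (1 : ℂ) else 0 := by
      intro l
      rw [lp.inner_single_left]
      simp [e, lp.single_apply, Pi.single_apply]
    have h3 : ∀ l : ℕ, e l i = if i = l then (1 : ℂ) else 0 := by
      intro l
      simp [e, lp.single_apply, Pi.single_apply]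
    have h4 : M (e j) i = ∑ l : Fin n₀, (K l j * (if i = (l : ℕ) then 1 else 0) +
        (if (l : ℕ) = j then 1 else 0) * (if n₀ ≤ i then K i l else 0)) := by
      rw [hM, lp.coeFn_sum, Finset.sum_apply]
      refine Finset.sum_congr rfl fun l _ => ?_
      change inner ℂ (r l) (e j) * e l i + inner ℂ (e l) (e j) * c l i = _
      rw [h1, h2, h3]
    change M (e j) i = _
    rw [h4, Finset.sum_add_distrib,
      Fin.sum_univ_eq_sum_range (fun l => K l j * (if i = l then (1 : ℂ) else 0)) n₀,
      Fin.sum_univ_eq_sum_range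
        (fun l => (if l = j then (1 : ℂ) else 0) * (if n₀ ≤ i then K i l else 0)) n₀]
    simp only [mul_ite, mul_one, mul_zero, ite_mul, one_mul, zero_mul, Finset.sum_ite_eq,
      Finset.mem_range]
    by_cases hi : i < n₀ <;> by_cases hj : j < n₀ <;> simp [hi, hj, not_le.2, not_lt.1]

theorem exists_finiteRank_steadyTwoPoint (hκ : 0 < κ) (x₀ : ℤ) (n₀ : ℕ) :
    ∃ M : Ell2 ℕ →L[ℂ] Ell2 ℕ,
      FiniteDimensional ℂ (LinearMap.range (M : Ell2 ℕ →ₗ[ℂ] Ell2 ℕ)) ∧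
      ∀ i j : ℕ, M (lp.single 2 j (1 : ℂ)) i = if n₀ ≤ i ∧ n₀ ≤ j then 0 else
        (-1) ^ (i + j) * steadyTwoPoint κ hκ βL βR N (x₀ + j) (x₀ + i) := by
  refine exists_finiteRank_of_rows_columns _ n₀ (fun i => ?_) fun j => ?_
  · obtain ⟨v, hv⟩ := steadyTwoPoint_eq_left (βL := βL) (βR := βR) (N := N) hκ (x₀ + i)
    exact memℓp_section v x₀ fun j => by simp [hv]
  · obtain ⟨v, hv⟩ := steadyTwoPoint_eq_right (βL := βL) (βR := βR) (N := N) hκ (x₀ + j)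
    exact memℓp_section v x₀ fun i => by simp [hv]

end SteadyState

end XYImpurity

end

theorem proposition3 (κ βL βR : ℝ) (hκ : 0 < κ) (hL : 0 < βL) (hLR : βL ≤ βR) (N : ℕ) (x₀ : ℤ)
    (ω₀ : CAR →ₗ[ℂ] ℂ) (hω₀ : IsQuasifree ω₀) (hS₀ : HasDensity ω₀ (initialDensity βL βR N))
    (τ : ℝ → (CAR ≃⋆ₐ[ℂ] CAR)) (hτ : IsBogoliubov τ (HMag κ))
    (ω : CAR →ₗ[ℂ] ℂ) (hω : IsNESS τ ω₀ ω) :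
    MeasureTheory.MemLp (symbolA κ βL βR) ⊤
        (MeasureTheory.volume.restrict (Set.Ioc (-Real.pi) Real.pi)) ∧
    (∀ y : ℤ, ContDiff ℝ (⊤ : ℕ∞) (symbolB κ hκ βL βR N y) ∧
      Function.Periodic (symbolB κ hκ βL βR N y) (2 * Real.pi)) ∧
    (0 ≤ x₀ → ∀ n : ℕ,
      ω (efpObservable x₀ n) =
        (toeplitz (symbolA κ βL βR) n + hankel (symbolB κ hκ βL βR N x₀) n).det) ∧
    ∀ n₀ : ℕ, x₀ < 0 → (n₀ : ℤ) = -x₀ →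
      ∃ M : Ell2 ℕ →L[ℂ] Ell2 ℕ,
        FiniteDimensional ℂ (LinearMap.range (M : Ell2 ℕ →ₗ[ℂ] Ell2 ℕ)) ∧
        (∀ i j : ℕ, M (lp.single 2 j (1 : ℂ)) i =
          if n₀ ≤ i ∧ n₀ ≤ j then 0
          else (-1) ^ (i + j) * twoPoint ω (x₀ + j) (x₀ + i)) ∧
        ∀ m : ℕ,
          ω (efpObservable x₀ (n₀ + m)) =
            (Matrix.fromBlocks (0 : Matrix (Fin n₀) (Fin n₀) ℂ) 0 0
                (toeplitz (symbolA κ βL βR) m + hankel (symbolB κ hκ βL βR N 0) m) +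
              compress M n₀ m).det := by
  refine ⟨memLp_symbolA κ βL βR, fun y => ⟨contDiff_symbolB hκ βL βR N y,
    periodic_symbolB hκ βL βR N y⟩, fun hx₀ n => ?_, fun n₀ _ hn₀ => ?_⟩
  · rw [hω.efpObservable_eq hκ hω₀ hS₀ hτ]
    congr 1
    ext i j
    exact steadyTwoPoint_eq_coeff hκ βL βR N hx₀ i j
  · obtain ⟨M, hM, hMij⟩ := exists_finiteRank_steadyTwoPoint (βL := βL) (βR := βR) (N := N)
      hκ x₀ n₀
    refine ⟨M, hM, fun i j => ?_, fun m => ?_⟩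
    · rw [hMij, hω.twoPoint_eq hκ hS₀ hτ]
    · rw [hω.efpObservable_eq hκ hω₀ hS₀ hτ, ← Matrix.det_submatrix_equiv_self finSumFinEquiv]
      congr 1
      ext i j
      rw [Matrix.add_apply, compress, hMij]
      rcases i with i | i <;> rcases j with j | j
      · simp [not_le.2 i.isLt]
      · simp
      · simp
      · have h := steadyTwoPoint_eq_coeff hκ βL βR N le_rfl i j
        have e : ∀ l : ℕ, x₀ + ((n₀ + l : ℕ) : ℤ) = 0 + l := by
          intro l
          push_cast
          omega
        have hs : (-1 : ℂ) ^ (n₀ + (i : ℕ) + (n₀ + (j : ℕ))) = (-1) ^ ((i : ℕ) + (j : ℕ)) := by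
          rw [show n₀ + (i : ℕ) + (n₀ + (j : ℕ)) = 2 * n₀ + (i + j) by ring, pow_add, pow_mul]
          norm_num
        simp only [Matrix.submatrix_apply, Matrix.of_apply, Matrix.fromBlocks_apply₂₂,
          finSumFinEquiv_apply_right, Fin.val_natAdd, e, hs, h, Nat.le_add_right, and_self, if_true,
          add_zero]
        rfl
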